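/- For a tuple $x$ of variables let $\mathbb{C}\{x\}$ be the ring of convergent power series (germs at $0$ of holomorphic functions), and let $\mathcal{N}\{x\}\subset\mathbb{C}\{x\}$ be the subring of those that are algebraic over $\mathbb{C}[x]$; for $\eta\in\mathbb{C}\{x\}$, $\bar\eta$ is the series with complex conjugate coefficients. Let $N=n+d$ and let $(M,0)\subset\mathbb{C}^N$ be a germ of a generic real-algebraic submanifold of CR dimension $n$ and codimension $d$. Assume that $M$ is of constant orbit dimension at $0$, i.e. that the dimension of the local CR orbit of $q$ (the dimension at $q$ of the space of values of the Lie algebra generated by the sections of $T^{1,0}M$ and $T^{0,1}M$) is constant for $q\in M$ near $0$; let $c$ be the codimension of these orbits in $M$. Assume that $Z=(z,w,u)\in\mathbb{C}^n\times\mathbb{C}^{d-c}\times\mathbb{C}^c$ are normal coordinates adapted to the orbits: $M$ is given near $0$ by $$(w,u)=\Theta(z,\bar z,\bar w,\bar u)=\bigl(Q(z,\bar z,\bar w,\bar u),\bar u\bigr),$$ where $Q=Q(z,\chi,\tau,u)$ is a $\mathbb{C}^{d-c}$-valued algebraic map near $0$ with $\Theta(z,0,\eta)=\Theta(0,\chi,\eta)=\eta$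 and $\Theta(z,\chi,\bar\Theta(\chi,z,\eta))=\eta$. Let $\mathcal{M}=\{(Z,\zeta):\sigma=\bar\Theta(\chi,z,\eta)\}$, with $Z=(z,\eta)$, $\zeta=(\chi,\sigma)$, be the complexification of $M$ (a germ at $0$ in $\mathbb{C}^{2N}$), and let $\mathbb{C}\{\mathcal{M}\}$ be the quotient of $\mathbb{C}\{Z,\zeta\}$ by the ideal of the series vanishing on $\mathcal{M}$. Let $f\colon(\mathbb{C}^N,0)\to(\mathbb{C}^{N'},0)$ be a germ of a holomorphic map satisfying $(\clubsuit)$ there is an integer $\ell_0$ such that each component $f_s(Z)$ of $f$, regarded as an element of $\mathbb{C}\{\mathcal{M}\}$, is algebraic over the quotient field of the image in $\mathbb{C}\{\mathcal{M}\}$ of the subring of $\mathbb{C}\{Z,\zeta\}$ generated by $\mathcal{N}\{Z,\zeta\}$ and the components of the derivatives $\partial^\gamma\bar f(\zeta)$, $|\gamma|\le\ell_0$. Then each component of $f$ is algebraic over the quotient field of $\mathcal{A}^f=\bigcup_{\ell\ge0}\mathcal{A}^f_\ell$, where $\mathcal{A}^f_\ell$ is the subring of $\mathbb{C}\{z,w,u\}$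 generated by $\mathcal{N}\{z,w,u\}$ and the components of the series $\partial^\alpha f(0,u)$ (the derivative $\partial^\alpha f$ evaluated at $(z,w)=(0,0)$), $\alpha\in\mathbb{N}^N$, $|\alpha|\le\ell$. -/

import Mathlib

open Filter Topology

noncomputable section

namespace KeyAlg

/-! ### Convergent power series, identified with germs of holomorphic functions at the origin -/

section Germs

variable {ι : Type} [Fintype ι]

/-- The ring `ℂ{x}`, `x = (x_i)_{i ∈ ι}`, of convergent power series, i.e. of germs at `0 ∈ ℂ^ι`
of holomorphic functions. -/
def HolGerm (ι : Type) [Fintype ι] : Subring ((𝓝 (0 : ι → ℂ)).Germ ℂ) where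
  carrier := {φ | ∃ g : (ι → ℂ) → ℂ, AnalyticAt ℂ g 0 ∧ φ = (g : (𝓝 (0 : ι → ℂ)).Germ ℂ)}
  mul_mem' := by
    rintro _ _ ⟨g, hg, rfl⟩ ⟨h, hh, rfl⟩
    exact ⟨g * h, hg.mul hh, rfl⟩
  one_mem' := ⟨fun _ => 1, analyticAt_const, rfl⟩
  add_mem' := by
    rintro _ _ ⟨g, hg, rfl⟩ ⟨h, hh, rfl⟩
    exact ⟨g + h, hg.add hh, rfl⟩
  zero_mem' := ⟨fun _ => 0, analyticAt_const, rfl⟩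
  neg_mem' := by
    rintro _ ⟨g, hg, rfl⟩
    exact ⟨-g, hg.neg, rfl⟩

/-- The germ at `0` of a function that is holomorphic near `0`. -/
def germOf (g : (ι → ℂ) → ℂ) (hg : AnalyticAt ℂ g 0) : HolGerm ι :=
  ⟨(g : (𝓝 (0 : ι → ℂ)).Germ ℂ), g, hg, rfl⟩

theorem analyticAt_mvPolynomial (p : MvPolynomial ι ℂ) :
    AnalyticAt ℂ (fun x : ι → ℂ => MvPolynomial.eval x p) 0 :=
  AnalyticOnNhd.eval_mvPolynomial p 0 (Set.mem_univ _)

/-- The inclusion `ℂ[x] → ℂ{x}`. -/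
def polyHom (ι : Type) [Fintype ι] : MvPolynomial ι ℂ →+* HolGerm ι where
  toFun p := germOf (fun x => MvPolynomial.eval x p) (analyticAt_mvPolynomial p)
  map_one' := by
    apply Subtype.ext
    simp only [germOf, map_one]
    rfl
  map_mul' p q := by
    apply Subtype.ext
    simp only [germOf, map_mul]
    rfl
  map_zero' := by
    apply Subtype.ext
    simp only [germOf, map_zero]
    rfl
  map_add' p q := by
    apply Subtype.ext
    simp only [germOf, map_add]
    rfl

/-- The set `𝒩{x}` of algebraic (Nash) power series: the elements of `ℂ{x}` that are algebraic over
the subring `ℂ[x]`. -/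
def nash (ι : Type) [Fintype ι] : Set (HolGerm ι) :=
  {φ | IsAlgebraic (polyHom ι).range φ}

/-- `g` is holomorphic near `0` and its germ is algebraic. -/
def IsNash (g : (ι → ℂ) → ℂ) : Prop :=
  ∃ hg : AnalyticAt ℂ g 0, germOf g hg ∈ nash ι

/-- The function `ḡ(x) = conj (g (conj x))`, whose Taylor coefficients at `0` are the complex
conjugates of those of `g`. -/
def conjFun (g : (ι → ℂ) → ℂ) : (ι → ℂ) → ℂ := fun x => star (g (star x))

/-- `iterPartial [i₁, …, i_k] g = ∂/∂x_{i₁} ⋯ ∂/∂x_{i_k} g`. As lists of length `k` vary, this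
gives exactly the derivatives `∂^α g` with `|α| = k`. -/
def iterPartial [DecidableEq ι] : List ι → ((ι → ℂ) → ℂ) → ((ι → ℂ) → ℂ)
  | [], g => g
  | i :: L, g => fun x => fderiv ℂ (iterPartial L g) x (Pi.single i 1)

theorem analyticAt_iterPartial [DecidableEq ι] (L : List ι) {g : (ι → ℂ) → ℂ}
    (hg : AnalyticAt ℂ g 0) : AnalyticAt ℂ (iterPartial L g) 0 := by
  induction L with
  | nil => exact hg
  | cons i L ih =>
    exact ((ContinuousLinearMap.apply ℂ ℂ (Pi.single i 1 : ι → ℂ)).analyticAt _).comp ih.fderiv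

/-- The multilinear map `v ↦ conj (P (conj v))`. -/
def conjMultilinear {k : ℕ} (P : ContinuousMultilinearMap ℂ (fun _ : Fin k => ι → ℂ) ℂ) :
    ContinuousMultilinearMap ℂ (fun _ : Fin k => ι → ℂ) ℂ where
  toFun v := star (P fun j => star (v j))
  map_update_add' := by
    intro _ v j x y
    have key : ∀ x : ι → ℂ, (fun l => star (Function.update v j x l)) =
        Function.update (fun l => star (v l)) j (star x) := by
      intro x
      funext l
      by_cases h : l = j
      · subst h; simp
      · simp [h]
    simp only [key, star_add, P.map_update_add]
  map_update_smul' := by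
    intro _ v j a x
    have key : ∀ x : ι → ℂ, (fun l => star (Function.update v j x l)) =
        Function.update (fun l => star (v l)) j (star x) := by
      intro x
      funext l
      by_cases h : l = j
      · subst h; simp
      · simp [h]
    simp only [key, star_smul, P.map_update_smul, star_star]
  cont := by
    refine continuous_star.comp (P.cont.comp ?_)
    exact continuous_pi fun j => continuous_star.comp (continuous_apply j)

theorem norm_conjMultilinear_le {k : ℕ}
    (P : ContinuousMultilinearMap ℂ (fun _ : Fin k => ι → ℂ) ℂ) :
    ‖conjMultilinear P‖ ≤ ‖P‖ := by
  refine ContinuousMultilinearMap.opNorm_le_bound (norm_nonneg _) fun v => ?_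
  have h := P.le_opNorm fun j => star (v j)
  simp only [norm_star] at h
  change ‖star (P fun j => star (v j))‖ ≤ _
  rwa [norm_star]

theorem analyticAt_conjFun {g : (ι → ℂ) → ℂ} (hg : AnalyticAt ℂ g 0) :
    AnalyticAt ℂ (conjFun g) 0 := by
  obtain ⟨p, r, hp⟩ := hg
  refine ⟨fun k => conjMultilinear (p k), r, ?_, hp.r_pos, ?_⟩
  · refine hp.r_le.trans ?_
    refine FormalMultilinearSeries.radius_le_of_le (fun k => norm_conjMultilinear_le _)
  · intro y hy
    have hy' : star y ∈ Metric.eball (0 : ι → ℂ) r := by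
      simpa [Metric.mem_eball, edist_zero_right, enorm, nnnorm_star] using hy
    have h := hp.hasSum hy'
    have h2 : HasSum (fun k => star (p k fun _ => star y)) (star (g (0 + star y))) := h.star
    have h3 : conjFun g (0 + y) = star (g (0 + star y)) := by simp [conjFun]
    rw [h3]
    exact h2

end Germs

/-! ### Real submanifolds of `ℂ^ι`, complex tangent vectors, dimension of the CR orbits -/

section CR

variable {ι : Type} [Fintype ι]

/-- `M` is, near `0 ∈ M`, a generic real-algebraic submanifold of `ℂ^ι` of (real) codimension `d`:
near `0` it is the zero set of `d` real-valued functions `ρ_j(Z) = R_j(Z, Z̄)`, with `R_j` an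
algebraic power series in `(Z, ζ)`, such that the complex covectors `∂ρ_j/∂Z (0)` are linearly
independent over `ℂ`. -/
def IsGenericRealAlgebraic [DecidableEq ι] (M : Set (ι → ℂ)) (d : ℕ) : Prop :=
  0 ∈ M ∧ ∃ R : Fin d → (ι ⊕ ι → ℂ) → ℂ,
    (∀ j, IsNash (R j)) ∧
    (∀ j, ∀ᶠ Z : ι → ℂ in 𝓝 0, (R j (Sum.elim Z (star Z))).im = 0) ∧
    (∀ᶠ Z : ι → ℂ in 𝓝 0, Z ∈ M ↔ ∀ j, R j (Sum.elim Z (star Z)) = 0) ∧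
    LinearIndependent ℂ fun (j : Fin d) (i : ι) =>
      fderiv ℂ (R j) 0 (Pi.single (Sum.inl i) 1)

/-- The complex tangent space `T_q M ∩ i T_q M` of `M` at `q`; for a submanifold, the tangent cone
is the (real) tangent space. -/
def complexTangent (M : Set (ι → ℂ)) (q : ι → ℂ) : Set (ι → ℂ) :=
  {v | v ∈ tangentConeAt ℝ M q ∧ Complex.I • v ∈ tangentConeAt ℝ M q}

/-- The real Lie algebra generated by the germs at `q` of real-analytic sections of the complex
tangent bundle of `M`; a section over `M` is given by a real-analytic vector field on a
neighbourhood of `q` in `ℂ^ι` that extends it (the values on `M` of a bracket of fields tangent to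
`M` do not depend on the extensions). Its complexification is the Lie algebra generated by the
sections of `T^{1,0}M` and `T^{0,1}M`. -/
inductive InCRLieAlgebra (M : Set (ι → ℂ)) (q : ι → ℂ) : ((ι → ℂ) → (ι → ℂ)) → Prop
  | section_mem (X : (ι → ℂ) → (ι → ℂ)) (hX : AnalyticAt ℝ X q)
      (hM : ∀ᶠ p in 𝓝[M] q, X p ∈ complexTangent M p) : InCRLieAlgebra M q X
  | add (X Y : (ι → ℂ) → (ι → ℂ)) :
      InCRLieAlgebra M q X → InCRLieAlgebra M q Y → InCRLieAlgebra M q (X + Y)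
  | smul (a : ℝ) (X : (ι → ℂ) → (ι → ℂ)) : InCRLieAlgebra M q X → InCRLieAlgebra M q (a • X)
  | bracket (X Y : (ι → ℂ) → (ι → ℂ)) :
      InCRLieAlgebra M q X → InCRLieAlgebra M q Y →
        InCRLieAlgebra M q (VectorField.lieBracket ℝ X Y)

/-- The tangent space at `q` of the local CR orbit of `q`: the space of values at `q` of the
elements of the Lie algebra above. -/
def orbitTangent (M : Set (ι → ℂ)) (q : ι → ℂ) : Submodule ℝ (ι → ℂ) :=
  Submodule.span ℝ {v | ∃ X, InCRLieAlgebra M q X ∧ v = X q}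

/-- The (real) dimension of the local CR orbit of `q` in `M`. -/
def orbitDim (M : Set (ι → ℂ)) (q : ι → ℂ) : ℕ := Module.finrank ℝ (orbitTangent M q)

/-- The dimension of the local CR orbits is constant on a neighbourhood of `p` in `M`. -/
def HasConstantOrbitDim (M : Set (ι → ℂ)) (p : ι → ℂ) : Prop :=
  ∀ᶠ q in 𝓝[M] p, orbitDim M q = orbitDim M p

end CR

/-! ### Normal coordinates `Z = (z, w, u) ∈ ℂ^n × ℂ^m × ℂ^c` -/

section Coordinates

variable {n m c : ℕ}

/-- The index set of the coordinates `(z, w, u)` of `ℂ^n × ℂ^m × ℂ^c`. -/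
abbrev Idx (n m c : ℕ) : Type := Fin n ⊕ (Fin m ⊕ Fin c)

/-- The point `(z, w, u)`. -/
def pt (z : Fin n → ℂ) (w : Fin m → ℂ) (u : Fin c → ℂ) : Idx n m c → ℂ :=
  Sum.elim z (Sum.elim w u)

/-- The `z`-part of a point. -/
def zPart (Z : Idx n m c → ℂ) : Fin n → ℂ := fun i => Z (Sum.inl i)

/-- The `w`-part of a point. -/
def wPart (Z : Idx n m c → ℂ) : Fin m → ℂ := fun i => Z (Sum.inr (Sum.inl i))

/-- The `u`-part of a point. -/
def uPart (Z : Idx n m c → ℂ) : Fin c → ℂ := fun i => Z (Sum.inr (Sum.inr i))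

/-- `(z, w, u)` are normal coordinates for the germ of `M` at `0`, adapted to the foliation by
`u = const`: `M` is given near `0` by `w = Q(z, z̄, w̄, ū)`, `u = ū`, with `Q = Q(z, χ, τ, u)` an
algebraic map near `0 ∈ ℂ^n × ℂ^(n+m+c)`, where `Θ = (Q, u)` satisfies the normality conditions
`Θ(z, 0, η) = Θ(0, χ, η) = η` and the reality condition `Θ(z, χ, Θ̄(χ, z, η)) = η`,
`η = (w, u)`. -/
structure IsNormalForm (M : Set (Idx n m c → ℂ))
    (Q : Fin m → (Fin n ⊕ Idx n m c → ℂ) → ℂ) : Prop where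
  algebraic : ∀ j, IsNash (Q j)
  normal_left : ∀ j, ∀ᶠ x : Idx n m c → ℂ in 𝓝 0,
    Q j (Sum.elim (zPart x) (pt 0 (wPart x) (uPart x))) = wPart x j
  normal_right : ∀ j, ∀ᶠ x : Idx n m c → ℂ in 𝓝 0, Q j (Sum.elim 0 x) = wPart x j
  reality : ∀ j, ∀ᶠ x : Fin n ⊕ Idx n m c → ℂ in 𝓝 0,
    let χ : Fin n → ℂ := fun i => x (Sum.inl i)
    let Z : Idx n m c → ℂ := fun i => x (Sum.inr i)
    Q j (Sum.elim (zPart Z) (pt χ (fun k => conjFun (Q k) (Sum.elim χ Z)) (uPart Z))) =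
      wPart Z j
  mem_iff : ∀ᶠ Z : Idx n m c → ℂ in 𝓝 0,
    Z ∈ M ↔ (∀ j, wPart Z j = Q j (Sum.elim (zPart Z) (star Z))) ∧ uPart Z = star (uPart Z)

/-- The complexification `𝓜 ⊂ ℂ^N_Z × ℂ^N_ζ`: with `Z = (z, η)`, `ζ = (χ, σ)` it is the set
`σ = Θ̄(χ, z, η)`, where `Θ̄(χ, z, w, u) = (Q̄(χ, z, w, u), u)`. Only its germ at `0` matters. -/
def complexification (Q : Fin m → (Fin n ⊕ Idx n m c → ℂ) → ℂ) :
    Set (Idx n m c ⊕ Idx n m c → ℂ) :=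
  {x | (∀ j, wPart (x ∘ Sum.inr) j =
        conjFun (Q j) (Sum.elim (zPart (x ∘ Sum.inr)) (x ∘ Sum.inl))) ∧
      uPart (x ∘ Sum.inr) = uPart (x ∘ Sum.inl)}

end Coordinates

/-! ### The rings and condition (♣) -/

section Rings

variable {ι : Type} [Fintype ι]

/-- The ideal of `ℂ{x}` of the germs that vanish on (the germ at `0` of) the set `V`. -/
def vanishingIdeal (V : Set (ι → ℂ)) : Ideal (HolGerm ι) where
  carrier := {φ | ∃ g : (ι → ℂ) → ℂ, (φ : (𝓝 (0 : ι → ℂ)).Germ ℂ) = g ∧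
    ∀ᶠ x in 𝓝[V] 0, g x = 0}
  add_mem' := by
    rintro φ ψ ⟨g, hg, hg0⟩ ⟨h, hh, hh0⟩
    refine ⟨g + h, ?_, ?_⟩
    · rw [Subring.coe_add, hg, hh]; rfl
    · filter_upwards [hg0, hh0] with x h1 h2
      simp [h1, h2]
  zero_mem' := ⟨0, rfl, by simp⟩
  smul_mem' := by
    rintro φ ψ ⟨g, hg, hg0⟩
    obtain ⟨_, h, hh, rfl⟩ := φ
    refine ⟨h * g, ?_, ?_⟩
    · rw [smul_eq_mul, Subring.coe_mul, hg]; rfl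
    · filter_upwards [hg0] with x h1
      simp [h1]

/-- The germ in `ℂ{Z, ζ}` of `(Z, ζ) ↦ g(Z)`. -/
def inZ (g : (ι → ℂ) → ℂ) (hg : AnalyticAt ℂ g 0) : HolGerm (ι ⊕ ι) :=
  germOf (fun x => g (x ∘ Sum.inl)) <| by
    have h : AnalyticAt ℂ (fun x : ι ⊕ ι → ℂ => (x ∘ Sum.inl : ι → ℂ)) 0 :=
      AnalyticAt.pi fun i => (ContinuousLinearMap.proj (R := ℂ)
        (φ := fun _ : ι ⊕ ι => ℂ) (Sum.inl i)).analyticAt 0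
    exact AnalyticAt.comp (g := g) (by simpa using hg) h

/-- The germ in `ℂ{Z, ζ}` of `(Z, ζ) ↦ g(ζ)`. -/
def inZeta (g : (ι → ℂ) → ℂ) (hg : AnalyticAt ℂ g 0) : HolGerm (ι ⊕ ι) :=
  germOf (fun x => g (x ∘ Sum.inr)) <| by
    have h : AnalyticAt ℂ (fun x : ι ⊕ ι → ℂ => (x ∘ Sum.inr : ι → ℂ)) 0 :=
      AnalyticAt.pi fun i => (ContinuousLinearMap.proj (R := ℂ)
        (φ := fun _ : ι ⊕ ι => ℂ) (Sum.inr i)).analyticAt 0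
    exact AnalyticAt.comp (g := g) (by simpa using hg) h

variable {n m c N' : ℕ}

/-- The ring `ℛ^f_ℓ ⊂ ℂ{Z, ζ}` of the series `C(Z, ζ, (∂^γ f̄(ζ))_{|γ| ≤ ℓ})`, where `C` is a
polynomial in its last arguments with coefficients in `𝒩{Z, ζ}`. -/
def ringR (f : Fin N' → (Idx n m c → ℂ) → ℂ) (hf : ∀ s, AnalyticAt ℂ (f s) 0) (ℓ : ℕ) :
    Subring (HolGerm (Idx n m c ⊕ Idx n m c)) :=
  Subring.closure (nash (Idx n m c ⊕ Idx n m c) ∪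
    {φ | ∃ (L : List (Idx n m c)) (s : Fin N'), L.length ≤ ℓ ∧
      φ = inZeta (iterPartial L (conjFun (f s)))
        (analyticAt_iterPartial L (analyticAt_conjFun (hf s)))})

/-- Condition (♣): for some `ℓ₀`, every component `f_s(Z)`, regarded as an element of
`ℂ{𝓜} = ℂ{Z, ζ} / I_𝓜`, is algebraic over (the quotient field of) the image `𝒮^f_{ℓ₀}` of
`ℛ^f_{ℓ₀}` in `ℂ{𝓜}`. -/
def Club (Q : Fin m → (Fin n ⊕ Idx n m c → ℂ) → ℂ)
    (f : Fin N' → (Idx n m c → ℂ) → ℂ) (hf : ∀ s, AnalyticAt ℂ (f s) 0) : Prop :=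
  ∃ ℓ₀ : ℕ, ∀ s : Fin N',
    IsAlgebraic
      ((ringR f hf ℓ₀).map (Ideal.Quotient.mk (vanishingIdeal (complexification Q))))
      (Ideal.Quotient.mk (vanishingIdeal (complexification Q)) (inZ (f s) (hf s)))

/-- The germ in `ℂ{z, w, u}` of `(z, w, u) ↦ g(0, 0, u)`. -/
def restrictU (g : (Idx n m c → ℂ) → ℂ) (hg : AnalyticAt ℂ g 0) : HolGerm (Idx n m c) :=
  germOf (fun Z => g (pt 0 0 (uPart Z))) <| by
    have h : AnalyticAt ℂ (fun Z : Idx n m c → ℂ => (pt 0 0 (uPart Z) : Idx n m c → ℂ)) 0 := by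
      refine AnalyticAt.pi fun i => ?_
      rcases i with i | i | i
      · exact analyticAt_const
      · exact analyticAt_const
      · exact (ContinuousLinearMap.proj (R := ℂ) (φ := fun _ : Idx n m c => ℂ)
          (Sum.inr (Sum.inr i))).analyticAt 0
    have h0 : (pt 0 0 (uPart (0 : Idx n m c → ℂ)) : Idx n m c → ℂ) = 0 := by
      funext i
      rcases i with i | i | i <;> rfl
    exact AnalyticAt.comp (g := g) (by rw [h0]; exact hg) h

/-- The ring `𝒜^f_ℓ ⊂ ℂ{z, w, u}` of the series `A(z, w, u, (∂^α f(0, u))_{|α| ≤ ℓ})`, where `A` is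
a polynomial in its last arguments with coefficients in `𝒩{z, w, u}`. -/
def ringALevel (f : Fin N' → (Idx n m c → ℂ) → ℂ) (hf : ∀ s, AnalyticAt ℂ (f s) 0) (ℓ : ℕ) :
    Subring (HolGerm (Idx n m c)) :=
  Subring.closure (nash (Idx n m c) ∪
    {φ | ∃ (L : List (Idx n m c)) (s : Fin N'), L.length ≤ ℓ ∧
      φ = restrictU (iterPartial L (f s)) (analyticAt_iterPartial L (hf s))})

/-- The ring `𝒜^f`, the union of the increasing sequence of rings `𝒜^f_ℓ`. -/
def ringA (f : Fin N' → (Idx n m c → ℂ) → ℂ) (hf : ∀ s, AnalyticAt ℂ (f s) 0) :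
    Subring (HolGerm (Idx n m c)) :=
  ⨆ ℓ : ℕ, ringALevel f hf ℓ

end Rings

end KeyAlg

end

noncomputable section

set_option linter.unusedSectionVars false

namespace KeyAlg

/-! ### Algebraicity over subrings of a domain -/

section Derivations

variable {A B : Type*} [CommRing A] [CommRing B]

/-! By (♣), along any algebraic map into the complexification `𝓜`, algebraicity of all jets of
`f̄(ζ)` over a ring containing the algebraic germs passes to all jets of `f(Z)` (`Club.algOver_Z`)
and, by conjugation, conversely (`Club.algOver_zeta`). An algebraic relation can be pulled back even
along a map on which all its coefficients vanish: differentiate it until some coefficient survives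
(`map_mem_algClosure_of_iterDer`). This needs coefficient rings stable under differentiation, which
is why jets of every order enter.

Start from the points `Z = ζ = (0, 0, u)` and move alternately inside the leaves `ζ = const` and `Z
= const` of `𝓜`. The moves (`IsChain.stepMap`, `IsChain.conjMap`) keep the jets algebraic over those
at `(0, 0, u)`. Instead of counting moves, take a chain `V` of maximal generic rank
(`exists_isChain_tangentAlong`). No further move raises the rank, so the holomorphic fields spanning
the two foliations are generically tangent to the image of `V`. Such fields are closed under
brackets (`TangentAlong.lieBracket`). On `M`, embedded in `𝓜` by `Z ↦ (Z, Z̄)`, sections of the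
complex tangent bundle are combinations of them, hence so are all iterated brackets
(`isCRField_of_inCRLieAlgebra`). As the orbit of `0` has dimension `2n + m`, their values at `0`
fill `{Im w = 0, u = 0}`. Together with the `u`-directions, which every chain contains, the
`Z`-parts of these values span `ℂ^N` over `ℂ`, so the `Z`-part of `V` is generically a submersion
(`frequently_surjective`).

It remains to descend from `f` composed with this submersion to `f` itself
(`mem_algClosure_of_pull`). Added coordinates make it generically a local biholomorphism, a
transcendence degree count compares the algebraic germs on both sides, and the added coordinates are
then set to zero. The jets of `f̄` at `(0, 0, u)` are removed by one more use of (♣) at the base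
points (`Club.symRing_le`). -/

theorem derivation_sum_mul_pow (D : Derivation ℤ A A) (p : Polynomial A) (x : A) :
    D (p.eval x) = (p.sum fun i a => D a * x ^ i) + p.derivative.eval x * D x := by
  rw [Polynomial.eval_eq_sum, Polynomial.derivative_eval, Polynomial.sum, Polynomial.sum,
    Polynomial.sum, map_sum, Finset.sum_mul, ← Finset.sum_add_distrib]
  refine Finset.sum_congr rfl fun i _ => ?_
  rw [Derivation.leibniz, Derivation.leibniz_pow]
  simp only [smul_eq_mul, nsmul_eq_mul]
  ring

/-- `∂_{i₁} ⋯ ∂_{i_k}` for a list `[i₁, …, i_k]`. -/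
def iterDer {ι : Type*} (D : ι → Derivation ℤ A A) : List ι → A → A
  | [], x => x
  | i :: L, x => D i (iterDer D L x)

variable {ι : Type*} (D : ι → Derivation ℤ A A)

theorem iterDer_append (L : List ι) (i : ι) (x : A) :
    iterDer D (L ++ [i]) x = iterDer D L (D i x) := by
  induction L with
  | nil => rfl
  | cons j L ih => simp only [List.cons_append, iterDer, ih]

theorem iterDer_add (L : List ι) (x y : A) :
    iterDer D L (x + y) = iterDer D L x + iterDer D L y := by
  induction L with
  | nil => rfl
  | cons j L ih => simp only [iterDer, ih, map_add]

theorem iterDer_zero (L : List ι) : iterDer D L (0 : A) = 0 := by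
  induction L with
  | nil => rfl
  | cons j L ih => simp only [iterDer, ih, map_zero]

theorem iterDer_sum {κ : Type*} (s : Finset κ) (L : List ι) (x : κ → A) :
    iterDer D L (∑ k ∈ s, x k) = ∑ k ∈ s, iterDer D L (x k) := by
  classical
  induction s using Finset.induction_on with
  | empty => simp [iterDer_zero]
  | insert a s ha ih => rw [Finset.sum_insert ha, Finset.sum_insert ha, iterDer_add, ih]

theorem iterDer_mem {S : Subring A} (hD : ∀ i, ∀ x ∈ S, D i x ∈ S) (L : List ι) {x : A}
    (hx : x ∈ S) : iterDer D L x ∈ S := by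
  induction L with
  | nil => exact hx
  | cons j L ih => exact hD j _ ih

/-- Only the leading term of the Leibniz formula survives if all the lower derivatives of `x` are
in the kernel of `φ`. -/
theorem map_iterDer_mul (φ : A →+* B) (L : List ι) (x y : A)
    (h : ∀ L' : List ι, L'.length < L.length → φ (iterDer D L' x) = 0) :
    φ (iterDer D L (x * y)) = φ (iterDer D L x) * φ y := by
  -- Peel off the innermost derivative: those of `D i x` of order below `|L|` are derivatives of `x`
  -- of order below `|L| + 1`, so the vanishing hypothesis is inherited.
  induction L using List.reverseRecOn generalizing x y with
  | nil => simp [iterDer]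
  | append_singleton L i ih =>
    rw [iterDer_append, iterDer_append, Derivation.leibniz, iterDer_add, map_add, smul_eq_mul,
      smul_eq_mul, mul_comm y, ih x, ih (D i x), h L (by simp), zero_mul, zero_add]
    · intro L' hL'
      rw [← iterDer_append]
      exact h _ (by simpa using hL')
    · intro L' hL'
      exact h _ (by simp; omega)

end Derivations

section Algebraic

variable {A B : Type*} [CommRing A] [IsDomain A] [CommRing B] [IsDomain B]

/-- The subring of the elements that are algebraic over the subring `S`. -/
def algClosure (S : Subring A) : Subring A := (Subalgebra.algebraicClosure S A).toSubring

theorem le_algClosure (S : Subring A) : S ≤ algClosure S := fun x hx =>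
  isAlgebraic_algebraMap (R := S) (A := A) (⟨x, hx⟩ : S)

/-- If `φ` is injective on `S`, a nontrivial relation over `S` stays nontrivial after applying `φ`
to its coefficients. For non-injective `φ` see `map_mem_algClosure_of_iterDer`. -/
theorem algClosure_map_mem (φ : A →+* B) (S : Subring A) (hφ : ∀ x ∈ S, φ x = 0 → x = 0)
    {S' : Subring B} (hS : S.map φ ≤ S') {x : A} (hx : x ∈ algClosure S) :
    φ x ∈ algClosure S' := by
  have hx' : IsAlgebraic S x := hx
  let g : S →+* S' := (φ.comp S.subtype).codRestrict S' fun y => hS ⟨y, y.2, rfl⟩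
  refine IsAlgebraic.ringHom_of_comp_eq (R := S) (S := S') (a := x) g φ hx' ?_ ?_
  · rw [injective_iff_map_eq_zero]
    intro y hy
    exact Subtype.ext (hφ y y.2 (congrArg Subtype.val hy))
  · ext y; rfl

theorem algClosure_mono {S S' : Subring A} (h : S ≤ S') : algClosure S ≤ algClosure S' :=
  fun _ hx => algClosure_map_mem (RingHom.id A) S (fun _ _ h => h)
    (by simpa using h) hx

theorem algClosure_idem (S : Subring A) : algClosure (algClosure S) ≤ algClosure S := by
  intro x hx
  have hx' : IsAlgebraic (Subalgebra.algebraicClosure S A) x := hx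
  exact IsAlgebraic.restrictScalars S hx'

theorem algClosure_trans {S S' : Subring A} (h : S' ≤ algClosure S) :
    algClosure S' ≤ algClosure S :=
  (algClosure_mono h).trans (algClosure_idem S)

theorem mem_algClosure_of_mul {S : Subring A} {y z : A} (hy : y ≠ 0) (hyS : y ∈ algClosure S)
    (hyz : y * z ∈ algClosure S) : z ∈ algClosure S :=
  IsAlgebraic.of_mul (R := S) (mem_nonZeroDivisors_of_ne_zero hy) hyS hyz

/-- A derivation that maps `S` to `S` maps elements algebraic over `S` to such elements. -/
theorem derivation_mem_algClosure [CharZero A] (D : Derivation ℤ A A) (S : Subring A)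
    (hD : ∀ x ∈ S, D x ∈ S) {x : A} (hx : x ∈ algClosure S) : D x ∈ algClosure S := by
  classical
  have hx' : ∃ p : Polynomial S, p ≠ 0 ∧ Polynomial.aeval x p = 0 := hx
  -- A relation `p` of minimal degree is used so that `p'(x) ≠ 0`; then `D (p(x)) = 0` can be solved
  -- for `D x`.
  have hx'' : ∃ d, ∃ p : Polynomial S, p ≠ 0 ∧ Polynomial.aeval x p = 0 ∧ p.natDegree = d :=
    let ⟨p, h1, h2⟩ := hx'; ⟨_, p, h1, h2, rfl⟩
  obtain ⟨p, hp0, hp, hd⟩ := Nat.find_spec hx''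
  have hmin := fun m hm => Nat.find_min hx'' (m := m) hm
  have hev : ∀ q : Polynomial S, Polynomial.aeval x q = (q.map S.subtype).eval x := by
    intro q; rw [Polynomial.aeval_def, Polynomial.eval_map]; rfl
  have hdeg : p.natDegree ≠ 0 := by
    intro h
    obtain ⟨a, ha⟩ : ∃ a, p = Polynomial.C a := ⟨_, Polynomial.eq_C_of_natDegree_eq_zero h⟩
    rw [ha, Polynomial.aeval_C] at hp
    have ha0 : a = 0 := Subtype.ext hp
    exact hp0 (by rw [ha, ha0, Polynomial.C_0])
  have hder : p.derivative ≠ 0 := by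
    intro h
    exact hdeg (Polynomial.derivative_eq_zero.1 h)
  have hder' : Polynomial.aeval x p.derivative ≠ 0 := fun h =>
    hmin _ (hd ▸ Polynomial.natDegree_derivative_lt hdeg) ⟨_, hder, h, rfl⟩
  have hxmem : ∀ i, x ^ i ∈ algClosure S := fun i => pow_mem hx i
  have h1 := derivation_sum_mul_pow D (p.map S.subtype) x
  rw [← hev, hp, map_zero, Polynomial.derivative_map, ← hev] at h1
  refine mem_algClosure_of_mul hder' ?_ (z := D x) ?_
  · rw [hev, Polynomial.eval_eq_sum]
    refine sum_mem fun i _ => mul_mem (le_algClosure S ?_) (hxmem i)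
    rw [Polynomial.coeff_map]; exact (p.derivative.coeff i).2
  · rw [eq_neg_of_add_eq_zero_right h1.symm]
    refine neg_mem (sum_mem fun i _ => mul_mem (le_algClosure S (hD _ ?_)) (hxmem i))
    rw [Polynomial.coeff_map]; exact (p.coeff i).2

section IterDer

variable {ι : Type*} (D : ι → Derivation ℤ A A)

/-- Algebraic relations can be restricted along a homomorphism, even if it kills their
coefficients. -/
theorem map_mem_algClosure_of_iterDer (φ : A →+* B)
    (hφ : ∀ x : A, x ≠ 0 → ∃ L, φ (iterDer D L x) ≠ 0) {S : Subring A}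
    (hD : ∀ i, ∀ x ∈ S, D i x ∈ S) {x : A} (hx : x ∈ algClosure S) :
    φ x ∈ algClosure (S.map φ) := by
  classical
  obtain ⟨p, hp0, hp⟩ : ∃ p : Polynomial S, p ≠ 0 ∧ Polynomial.aeval x p = 0 := hx
  -- Choose the least order of differentiation at which some coefficient is not killed by `φ`. Every
  -- derivative of lower order of every coefficient is then killed, and the Leibniz formula for the
  -- differentiated relation reduces to its leading terms.
  have hex : ∃ e, ∃ L : List ι, L.length = e ∧ ∃ j, φ (iterDer D L (p.coeff j : A)) ≠ 0 := by
    obtain ⟨j, hj⟩ : ∃ j, p.coeff j ≠ 0 := by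
      by_contra! h
      exact hp0 (Polynomial.ext (by simpa using h))
    obtain ⟨L, hL⟩ := hφ (p.coeff j : A) (by simpa using hj)
    exact ⟨_, L, rfl, j, hL⟩
  obtain ⟨L, hL, j₀, hj₀⟩ := Nat.find_spec hex
  have hmin : ∀ L' : List ι, L'.length < L.length → ∀ j, φ (iterDer D L' (p.coeff j : A)) = 0 := by
    intro L' hL' j
    by_contra h
    exact Nat.find_min hex (hL ▸ hL') ⟨L', rfl, j, h⟩
  have hmem : ∀ j, φ (iterDer D L (p.coeff j : A)) ∈ S.map φ := fun j =>
    ⟨_, iterDer_mem D hD L (p.coeff j).2, rfl⟩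
  let q : Polynomial (S.map φ) := ∑ j ∈ p.support, Polynomial.monomial j ⟨_, hmem j⟩
  refine ⟨q, ?_, ?_⟩
  · intro hq
    have h1 : q.coeff j₀ = ⟨_, hmem j₀⟩ := by
      simp only [q, Polynomial.finsetSum_coeff, Polynomial.coeff_monomial]
      rw [Finset.sum_ite_eq']
      split_ifs with h
      · rfl
      · refine Subtype.ext ?_
        have : p.coeff j₀ = 0 := by simpa using h
        simp [this, iterDer_zero]
    rw [hq] at h1
    exact hj₀ (congrArg Subtype.val h1).symm
  · have h1 : Polynomial.aeval x p = ∑ j ∈ p.support, (p.coeff j : A) * x ^ j := by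
      rw [Polynomial.aeval_def, Polynomial.eval₂_eq_sum]; rfl
    rw [h1] at hp
    have h2 := congrArg (fun y => φ (iterDer D L y)) hp
    simp only [iterDer_sum, iterDer_zero, map_sum, map_zero] at h2
    rw [map_sum, ← h2]
    refine Finset.sum_congr rfl fun j _ => ?_
    rw [map_iterDer_mul D φ L _ _ (fun L' hL' => hmin L' hL' j), Polynomial.aeval_monomial, map_pow]
    rfl

end IterDer

end Algebraic

/-! ### The ring of holomorphic germs -/

section GermRing

/-- This is the identity theorem on a ball around `a` on which `g` is analytic: the ball contains a
point near which `g` vanishes. -/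
theorem eventuallyEq_zero_of_frequently {𝕜 E F : Type*} [RCLike 𝕜] [NormedAddCommGroup E]
    [NormedSpace 𝕜 E] [NormedAddCommGroup F] [NormedSpace 𝕜 F] [CompleteSpace F] {g : E → F}
    {a : E} (hg : AnalyticAt 𝕜 g a) (h : ∃ᶠ x in 𝓝 a, g =ᶠ[𝓝 x] 0) : g =ᶠ[𝓝 a] 0 := by
  obtain ⟨r, hr, hball⟩ := Metric.eventually_nhds_iff_ball.1 hg.eventually_analyticAt
  obtain ⟨x, hx, hxr⟩ := (h.and_eventually (Metric.ball_mem_nhds a hr)).exists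
  let : NormedSpace ℝ E := NormedSpace.restrictScalars ℝ 𝕜 E
  have := AnalyticOnNhd.eqOn_zero_of_preconnected_of_eventuallyEq_zero (f := g)
    (U := Metric.ball a r) hball (convex_ball a r).isPreconnected hxr hx
  exact this.eventuallyEq_of_mem (Metric.ball_mem_nhds a hr)

theorem conjFun_conjFun {ι : Type} (g : (ι → ℂ) → ℂ) : conjFun (conjFun g) = g := by
  funext x; simp [conjFun]

variable {ι T : Type} [Fintype ι] [Fintype T]

theorem analyticAt_coord {ι : Type*} [Fintype ι] (i : ι) (a : ι → ℂ) :
    AnalyticAt ℂ (fun x : ι → ℂ => x i) a :=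
  (ContinuousLinearMap.proj (R := ℂ) (φ := fun _ : ι => ℂ) i).analyticAt a

theorem _root_.AnalyticAt.coord {ι E : Type*} [Fintype ι] [NormedAddCommGroup E] [NormedSpace ℂ E]
    {V : E → ι → ℂ} {a : E} (hV : AnalyticAt ℂ V a) (i : ι) : AnalyticAt ℂ (fun t => V t i) a :=
  (analyticAt_coord i (V a)).comp hV

theorem germOf_eq_iff {g h : (ι → ℂ) → ℂ} {hg : AnalyticAt ℂ g 0} {hh : AnalyticAt ℂ h 0} :
    germOf g hg = germOf h hh ↔ g =ᶠ[𝓝 0] h :=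
  Subtype.ext_iff.trans Filter.Germ.coe_eq

theorem germOf_congr {g h : (ι → ℂ) → ℂ} (hg : AnalyticAt ℂ g 0) (hh : AnalyticAt ℂ h 0)
    (H : g =ᶠ[𝓝 0] h) : germOf g hg = germOf h hh :=
  germOf_eq_iff.2 H

theorem germOf_eq_zero_iff {g : (ι → ℂ) → ℂ} {hg : AnalyticAt ℂ g 0} :
    germOf g hg = 0 ↔ g =ᶠ[𝓝 0] 0 :=
  germOf_eq_iff (h := fun _ => 0) (hh := analyticAt_const)

theorem exists_germOf (φ : HolGerm ι) : ∃ (g : (ι → ℂ) → ℂ) (hg : AnalyticAt ℂ g 0),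
    φ = germOf g hg := by
  obtain ⟨_, g, hg, rfl⟩ := φ
  exact ⟨g, hg, rfl⟩

theorem germOf_add {g h : (ι → ℂ) → ℂ} (hg : AnalyticAt ℂ g 0) (hh : AnalyticAt ℂ h 0) :
    germOf g hg + germOf h hh = germOf (fun x => g x + h x) (hg.add hh) := rfl

theorem germOf_mul {g h : (ι → ℂ) → ℂ} (hg : AnalyticAt ℂ g 0) (hh : AnalyticAt ℂ h 0) :
    germOf g hg * germOf h hh = germOf (fun x => g x * h x) (hg.mul hh) := rfl

theorem germOf_sum {κ : Type*} (s : Finset κ) (g : κ → (ι → ℂ) → ℂ)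
    (hg : ∀ k, AnalyticAt ℂ (g k) 0) :
    ∑ k ∈ s, germOf (g k) (hg k) =
      germOf (fun x => ∑ k ∈ s, g k x) (Finset.analyticAt_fun_sum s fun k _ => hg k) := by
  classical
  induction s using Finset.induction_on with
  | empty => simp only [Finset.sum_empty]; rfl
  | insert a s ha ih =>
    rw [Finset.sum_insert ha, ih, germOf_add]
    exact germOf_congr _ _ (Eventually.of_forall fun x =>
      (Finset.sum_insert (f := fun k => g k x) ha).symm)

/-- If `g` is not the zero germ, there are points arbitrarily close to `a` where `g ≠ 0`. Near each
of them `h` vanishes, and the identity theorem applies to `h`. -/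
theorem eventuallyEq_zero_or_of_mul {E : Type*} [NormedAddCommGroup E] [NormedSpace ℂ E]
    {g h : E → ℂ} {a : E} (hg : AnalyticAt ℂ g a) (hh : AnalyticAt ℂ h a)
    (H : ∀ᶠ x in 𝓝 a, g x * h x = 0) : g =ᶠ[𝓝 a] 0 ∨ h =ᶠ[𝓝 a] 0 := by
  by_cases hg0 : g =ᶠ[𝓝 a] 0
  · exact Or.inl hg0
  · refine Or.inr (eventuallyEq_zero_of_frequently hh ?_)
    have h1 : ∃ᶠ x in 𝓝 a, g x ≠ 0 := fun h => hg0 (h.mono fun x hx => not_not.1 hx)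
    refine (h1.and_eventually (H.eventually_nhds.and hg.eventually_analyticAt)).mono ?_
    rintro x ⟨hx, hx1, hx2⟩
    filter_upwards [hx1, hx2.continuousAt.eventually_ne hx] with y h1 h2
    exact (mul_eq_zero.1 h1).resolve_left h2

instance : IsDomain (HolGerm ι) := by
  have : Nontrivial (HolGerm ι) := by
    refine ⟨1, 0, fun h => ?_⟩
    have h1 : (fun _ : ι → ℂ => (1 : ℂ)) =ᶠ[𝓝 0] 0 :=
      germOf_eq_zero_iff (hg := analyticAt_const).1 h
    exact one_ne_zero h1.self_of_nhds
  have : NoZeroDivisors (HolGerm ι) := by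
    refine ⟨fun {φ ψ} h => ?_⟩
    obtain ⟨g, hg, rfl⟩ := exists_germOf φ
    obtain ⟨k, hk, rfl⟩ := exists_germOf ψ
    rw [germOf_mul, germOf_eq_zero_iff] at h
    rw [germOf_eq_zero_iff, germOf_eq_zero_iff]
    exact eventuallyEq_zero_or_of_mul hg hk h
  exact NoZeroDivisors.to_isDomain _

theorem polyHom_apply (p : MvPolynomial ι ℂ) :
    polyHom ι p = germOf (fun x => MvPolynomial.eval x p) (analyticAt_mvPolynomial p) := rfl

/-- The inclusion of the constants. -/
def constHom (ι : Type) [Fintype ι] : ℂ →+* HolGerm ι := (polyHom ι).comp MvPolynomial.C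

theorem constHom_apply (a : ℂ) : constHom ι a = germOf (fun _ => a) analyticAt_const := by
  refine Subtype.ext ?_
  simp [constHom, polyHom, germOf]

instance : CharZero (HolGerm ι) := charZero_of_injective_ringHom (constHom ι).injective

/-- The pull-back `φ ↦ φ ∘ V` along a germ of a holomorphic map with `V(0) = 0`. -/
def pull (V : (T → ℂ) → (ι → ℂ)) (hV : AnalyticAt ℂ V 0) (h0 : V 0 = 0) :
    HolGerm ι →+* HolGerm T where
  toFun φ := ⟨φ.1.compTendsto V (by simpa [h0] using hV.continuousAt.tendsto), by
    obtain ⟨_, g, hg, rfl⟩ := φ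
    exact ⟨g ∘ V, AnalyticAt.comp (by rwa [h0]) hV, rfl⟩⟩
  map_one' := rfl
  map_zero' := rfl
  map_mul' φ ψ := by
    obtain ⟨_, g, hg, rfl⟩ := φ
    obtain ⟨_, h, hh, rfl⟩ := ψ
    rfl
  map_add' φ ψ := by
    obtain ⟨_, g, hg, rfl⟩ := φ
    obtain ⟨_, h, hh, rfl⟩ := ψ
    rfl

theorem _root_.AnalyticAt.comp_zero {E F G : Type*} [NormedAddCommGroup E] [NormedSpace ℂ E]
    [NormedAddCommGroup F] [NormedSpace ℂ F] [NormedAddCommGroup G] [NormedSpace ℂ G]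
    {g : F → G} {V : E → F} (hg : AnalyticAt ℂ g 0) (hV : AnalyticAt ℂ V 0) (h0 : V 0 = 0) :
    AnalyticAt ℂ (fun t => g (V t)) 0 :=
  AnalyticAt.comp (g := g) (by rwa [h0]) hV

theorem pull_germOf (V : (T → ℂ) → (ι → ℂ)) (hV : AnalyticAt ℂ V 0) (h0 : V 0 = 0)
    {g : (ι → ℂ) → ℂ} (hg : AnalyticAt ℂ g 0) :
    pull V hV h0 (germOf g hg) = germOf (fun t => g (V t)) (hg.comp_zero hV h0) := rfl

/-- The automorphism `g ↦ ḡ` of the ring of germs. -/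
def conjHom (ι : Type) [Fintype ι] : HolGerm ι →+* HolGerm ι where
  toFun φ := ⟨(φ.1.compTendsto (star : (ι → ℂ) → (ι → ℂ))
      (by simpa using (continuous_star (R := ι → ℂ)).tendsto 0)).map star, by
    obtain ⟨_, g, hg, rfl⟩ := φ
    exact ⟨conjFun g, analyticAt_conjFun hg, rfl⟩⟩
  map_one' := Subtype.ext (congrArg (fun a : ℂ => ((fun _ => a : (ι → ℂ) → ℂ) :
    (𝓝 (0 : ι → ℂ)).Germ ℂ)) (star_one ℂ))
  map_zero' := Subtype.ext (congrArg (fun a : ℂ => ((fun _ => a : (ι → ℂ) → ℂ) :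
    (𝓝 (0 : ι → ℂ)).Germ ℂ)) (star_zero ℂ))
  map_mul' φ ψ := by
    obtain ⟨g, hg, rfl⟩ := exists_germOf φ
    obtain ⟨h, hh, rfl⟩ := exists_germOf ψ
    refine germOf_congr (analyticAt_conjFun (hg.mul hh))
      ((analyticAt_conjFun hg).mul (analyticAt_conjFun hh)) (Eventually.of_forall fun x => ?_)
    simp [conjFun]
  map_add' φ ψ := by
    obtain ⟨g, hg, rfl⟩ := exists_germOf φ
    obtain ⟨h, hh, rfl⟩ := exists_germOf ψ
    refine germOf_congr (analyticAt_conjFun (hg.add hh))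
      ((analyticAt_conjFun hg).add (analyticAt_conjFun hh)) (Eventually.of_forall fun x => ?_)
    simp [conjFun]

theorem conjHom_germOf {g : (ι → ℂ) → ℂ} (hg : AnalyticAt ℂ g 0) :
    conjHom ι (germOf g hg) = germOf (conjFun g) (analyticAt_conjFun hg) := rfl

theorem conjHom_conjHom (φ : HolGerm ι) : conjHom ι (conjHom ι φ) = φ := by
  obtain ⟨g, hg, rfl⟩ := exists_germOf φ
  rw [conjHom_germOf, conjHom_germOf]
  exact germOf_congr _ _ (by rw [conjFun_conjFun])

/-! ### Derivatives of germs -/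

section Star

variable {E F : Type*} [NormedAddCommGroup E] [NormedSpace ℂ E] [StarAddMonoid E]
  [NormedStarGroup E] [StarModule ℂ E] [NormedAddCommGroup F] [NormedSpace ℂ F] [StarAddMonoid F]
  [NormedStarGroup F] [StarModule ℂ F]

/-- The linear map `v ↦ conj (A (conj v))`. -/
def conjCLM (A : E →L[ℂ] F) : E →L[ℂ] F :=
  ((starL ℂ : F ≃L⋆[ℂ] F) : F →L⋆[ℂ] F).comp (A.comp ((starL ℂ : E ≃L⋆[ℂ] E) : E →L⋆[ℂ] E))

theorem conjCLM_apply (A : E →L[ℂ] F) (v : E) : conjCLM A v = star (A (star v)) := rfl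

theorem hasFDerivAt_star_conj {g : E → F} {A : E →L[ℂ] F} {x : E}
    (h : HasFDerivAt g A (star x)) :
    HasFDerivAt (fun y => star (g (star y))) (conjCLM A) x := by
  rw [hasFDerivAt_iff_isLittleO_nhds_zero] at h ⊢
  have ht : Tendsto (star : E → E) (𝓝 0) (𝓝 0) := by
    simpa using (continuous_star (R := E)).tendsto 0
  have h2 := h.comp_tendsto ht
  refine (Asymptotics.isLittleO_iff.2 fun c hc => ?_)
  filter_upwards [Asymptotics.isLittleO_iff.1 h2 hc] with v hv
  simp only [Function.comp_apply, norm_star] at hv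
  rw [conjCLM_apply, star_add, ← star_sub, ← star_sub, norm_star]
  exact hv

theorem fderiv_star_conj (g : E → F) (x v : E) :
    fderiv ℂ (fun y => star (g (star y))) x v = star (fderiv ℂ g (star x) (star v)) := by
  by_cases h : DifferentiableAt ℂ g (star x)
  · rw [(hasFDerivAt_star_conj h.hasFDerivAt).fderiv, conjCLM_apply]
  -- Differentiability at `star x` and at `x` correspond, so otherwise both derivatives have the
  -- default value `0`.
  · rw [fderiv_zero_of_not_differentiableAt h, fderiv_zero_of_not_differentiableAt]
    · simp
    · intro h'
      apply h
      have h1 := (hasFDerivAt_star_conj (x := star x) (by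
        rw [star_star]; exact h'.hasFDerivAt)).differentiableAt
      simpa using h1

end Star

variable [DecidableEq ι]

/-- The partial derivative `∂/∂x_i`. -/
def partialFun (i : ι) (g : (ι → ℂ) → ℂ) : (ι → ℂ) → ℂ := fun x => fderiv ℂ g x (Pi.single i 1)

theorem analyticAt_partialFun (i : ι) {g : (ι → ℂ) → ℂ} (hg : AnalyticAt ℂ g 0) :
    AnalyticAt ℂ (partialFun i g) 0 := analyticAt_iterPartial [i] hg

theorem partialFun_congr {ι : Type} [DecidableEq ι] [Fintype ι] (i : ι) {g h : (ι → ℂ) → ℂ} (H : g =ᶠ[𝓝 0] h) :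
    partialFun i g =ᶠ[𝓝 0] partialFun i h := by
  filter_upwards [H.fderiv (𝕜 := ℂ)] with x hx
  simp only [partialFun, hx]

/-- The derivative is taken of a chosen representative; `ddFun_germOf` shows that the choice does
not matter. -/
def ddFun (i : ι) (φ : HolGerm ι) : HolGerm ι :=
  germOf (partialFun i (exists_germOf φ).choose)
    (analyticAt_partialFun i (exists_germOf φ).choose_spec.choose)

theorem ddFun_germOf (i : ι) {g : (ι → ℂ) → ℂ} (hg : AnalyticAt ℂ g 0) :
    ddFun i (germOf g hg) = germOf (partialFun i g) (analyticAt_partialFun i hg) :=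
  germOf_congr _ _ (partialFun_congr i
    (germOf_eq_iff.1 (exists_germOf (germOf g hg)).choose_spec.choose_spec).symm)

/-- The derivation `∂/∂x_i` of `ℂ{x}`. -/
def dd (i : ι) : Derivation ℤ (HolGerm ι) (HolGerm ι) :=
  Derivation.mk' (AddMonoidHom.toIntLinearMap (AddMonoidHom.mk' (ddFun i) (by
    intro φ ψ
    obtain ⟨g, hg, rfl⟩ := exists_germOf φ
    obtain ⟨h, hh, rfl⟩ := exists_germOf ψ
    rw [germOf_add, ddFun_germOf, ddFun_germOf, ddFun_germOf, germOf_add]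
    refine germOf_congr _ _ ?_
    filter_upwards [hg.eventually_analyticAt, hh.eventually_analyticAt] with x h1 h2
    simp only [partialFun]
    rw [fderiv_fun_add h1.differentiableAt h2.differentiableAt]
    rfl))) (by
    intro φ ψ
    change ddFun i (φ * ψ) = φ * ddFun i ψ + ψ * ddFun i φ
    obtain ⟨g, hg, rfl⟩ := exists_germOf φ
    obtain ⟨h, hh, rfl⟩ := exists_germOf ψ
    rw [germOf_mul, ddFun_germOf, ddFun_germOf, ddFun_germOf, germOf_mul, germOf_mul, germOf_add]
    refine germOf_congr _ _ ?_
    filter_upwards [hg.eventually_analyticAt, hh.eventually_analyticAt] with x h1 h2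
    simp only [partialFun]
    rw [fderiv_fun_mul h1.differentiableAt h2.differentiableAt]
    rfl)

theorem dd_germOf (i : ι) {g : (ι → ℂ) → ℂ} (hg : AnalyticAt ℂ g 0) :
    dd i (germOf g hg) = germOf (partialFun i g) (analyticAt_partialFun i hg) :=
  ddFun_germOf i hg

theorem iterDer_germOf (L : List ι) {g : (ι → ℂ) → ℂ} (hg : AnalyticAt ℂ g 0) :
    iterDer dd L (germOf g hg) = germOf (iterPartial L g) (analyticAt_iterPartial L hg) := by
  induction L with
  | nil => rfl
  | cons i L ih => rw [iterDer, ih, dd_germOf]; rfl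

/-- The coordinate directions are real, so partial derivatives commute with conjugation of the
coefficients. -/
theorem iterPartial_conjFun (L : List ι) (g : (ι → ℂ) → ℂ) :
    iterPartial L (conjFun g) = conjFun (iterPartial L g) := by
  induction L with
  | nil => rfl
  | cons i L ih =>
    funext x
    have h := fderiv_star_conj (iterPartial L g) x (Pi.single i 1)
    simp only [iterPartial, ih]
    refine h.trans ?_
    rw [conjFun, ← Pi.single_star, star_one]

/-- The `i`-th coordinate of a holomorphic map germ. -/
def coordGerm (V : (T → ℂ) → (ι → ℂ)) (hV : AnalyticAt ℂ V 0) (i : ι) : HolGerm T :=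
  germOf (fun t => V t i) (hV.coord i)

theorem clm_apply_eq_sum_single {F : Type*} [NormedAddCommGroup F] [NormedSpace ℂ F]
    (A : (ι → ℂ) →L[ℂ] F) (v : ι → ℂ) : A v = ∑ i, v i • A (Pi.single i 1) := by
  conv_lhs => rw [pi_eq_sum_univ' v]
  simp [map_sum]

/-- The chain rule in ring form. It yields stability under differentiation of the rings generated by
algebraic germs and pulled-back jets, since the coordinates of an algebraic map have algebraic
derivatives. -/
theorem dd_pull [DecidableEq T] (V : (T → ℂ) → (ι → ℂ)) (hV : AnalyticAt ℂ V 0) (h0 : V 0 = 0) (j : T)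
    (φ : HolGerm ι) :
    dd j (pull V hV h0 φ) = ∑ i, pull V hV h0 (dd i φ) * dd j (coordGerm V hV i) := by
  obtain ⟨g, hg, rfl⟩ := exists_germOf φ
  simp only [pull_germOf, dd_germOf, coordGerm, germOf_mul]
  rw [germOf_sum]
  refine germOf_congr _ _ ?_
  have hg' : ∀ᶠ t in 𝓝 (0 : T → ℂ), AnalyticAt ℂ g (V t) :=
    hV.continuousAt.eventually (by rw [h0]; exact hg.eventually_analyticAt)
  filter_upwards [hV.eventually_analyticAt, hg'] with t h1 h2
  have h3 := fderiv_comp t h2.differentiableAt h1.differentiableAt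
  simp only [partialFun]
  change fderiv ℂ (g ∘ V) t _ = _
  rw [h3, ContinuousLinearMap.comp_apply, clm_apply_eq_sum_single]
  refine Finset.sum_congr rfl fun i _ => ?_
  rw [fderiv_apply h1.differentiableAt, smul_eq_mul, mul_comm]
  rfl

theorem iteratedFDeriv_apply_single {g : (ι → ℂ) → ℂ} {k : ℕ} (I : Fin k → ι)
    {x : ι → ℂ} (hg : AnalyticAt ℂ g x) :
    iteratedFDeriv ℂ k g x (fun j => Pi.single (I j) 1) = iterPartial (List.ofFn I) g x := by
  induction k generalizing x with
  | zero => simp [iterPartial]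
  | succ k ih =>
    rw [iteratedFDeriv_succ_apply_left, List.ofFn_succ]
    change _ = fderiv ℂ (iterPartial (List.ofFn fun j => I j.succ) g) x (Pi.single (I 0) 1)
    have h1 : (fun y => iteratedFDeriv ℂ k g y (fun j => Pi.single (I j.succ) 1)) =ᶠ[𝓝 x]
        iterPartial (List.ofFn fun j => I j.succ) g := by
      filter_upwards [hg.eventually_analyticAt] with y hy
      exact ih _ hy
    rw [← h1.fderiv_eq]
    have h2 := ((hg.contDiffAt (n := ⊤)).iteratedFDeriv_right (i := k) (m := 1) (by simp)
      ).differentiableAt one_ne_zero |>.hasFDerivAt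
    have h3 := ((ContinuousMultilinearMap.apply ℂ (fun _ : Fin k => ι → ℂ) ℂ
      (fun j => Pi.single (I j.succ) 1)).hasFDerivAt.comp x h2).fderiv
    exact (congrArg (fun A : (ι → ℂ) →L[ℂ] ℂ => A (Pi.single (I 0) 1)) h3).symm

/-- A germ all of whose derivatives vanish at `0` has zero Taylor series. This supplies the
nonvanishing hypothesis of `map_mem_algClosure_of_iterDer` for pull-backs: the evaluation at `0`
already detects some derivative. -/
theorem exists_iterPartial_ne_zero {g : (ι → ℂ) → ℂ} (hg : AnalyticAt ℂ g 0)
    (h : ¬ g =ᶠ[𝓝 0] 0) : ∃ L, iterPartial L g 0 ≠ 0 := by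
  by_contra! H
  apply h
  have h0 : ∀ k, iteratedFDeriv ℂ k g 0 = 0 := by
    intro k
    refine ContinuousMultilinearMap.toMultilinearMap_injective ?_
    refine Module.Basis.ext_multilinear (fun _ => Pi.basisFun ℂ ι) fun I => ?_
    simpa using (iteratedFDeriv_apply_single I hg).trans (H _)
  obtain ⟨p, r, hp⟩ := hg
  filter_upwards [Metric.eball_mem_nhds (0 : ι → ℂ) hp.r_pos] with y hy
  have h1 := hp.hasSum_iteratedFDeriv (y := y) hy
  simp only [h0, zero_apply, smul_zero, zero_add] at h1
  exact h1.unique hasSum_zero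

theorem dd_polyHom (i : ι) (p : MvPolynomial ι ℂ) :
    dd i (polyHom ι p) ∈ (polyHom ι).range := by
  induction p using MvPolynomial.induction_on with
  | C a =>
    refine ⟨0, ?_⟩
    have h : polyHom ι (MvPolynomial.C a) = constHom ι a := rfl
    rw [h, constHom_apply, dd_germOf, map_zero, eq_comm, germOf_eq_zero_iff]
    exact Eventually.of_forall fun x => by simp [partialFun]
  | add p q hp hq => rw [map_add, map_add]; exact add_mem hp hq
  | mul_X p j hp =>
    rw [map_mul, Derivation.leibniz, smul_eq_mul, smul_eq_mul]
    refine add_mem (mul_mem ⟨_, rfl⟩ ?_) (mul_mem ⟨_, rfl⟩ hp)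
    refine ⟨MvPolynomial.C ((Pi.single i 1 : ι → ℂ) j), ?_⟩
    have h : polyHom ι (MvPolynomial.X j) = germOf (fun x => x j)
        (analyticAt_coord j 0) :=
      germOf_congr (analyticAt_mvPolynomial _) _ (Eventually.of_forall fun x => by simp)
    rw [h, dd_germOf, polyHom_apply]
    refine germOf_congr _ _ (Eventually.of_forall fun x => ?_)
    refine (MvPolynomial.eval_C _).trans ?_
    exact congrArg (fun A : (ι → ℂ) →L[ℂ] ℂ => A (Pi.single i 1))
      (ContinuousLinearMap.proj (R := ℂ) (φ := fun _ : ι => ℂ) j).fderiv.symm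

/-- Restriction of algebraic relations along a germ of a holomorphic map. -/
theorem pull_mem_algClosure (V : (T → ℂ) → (ι → ℂ)) (hV : AnalyticAt ℂ V 0) (h0 : V 0 = 0)
    {S : Subring (HolGerm ι)} (hS : ∀ i, ∀ φ ∈ S, dd i φ ∈ S) {φ : HolGerm ι}
    (hφ : φ ∈ algClosure S) : pull V hV h0 φ ∈ algClosure (S.map (pull V hV h0)) := by
  refine map_mem_algClosure_of_iterDer dd (pull V hV h0) ?_ hS hφ
  intro ψ hψ
  obtain ⟨g, hg, rfl⟩ := exists_germOf ψ
  rw [Ne, germOf_eq_zero_iff] at hψ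
  obtain ⟨L, hL⟩ := exists_iterPartial_ne_zero hg hψ
  refine ⟨L, fun h => hL ?_⟩
  rw [iterDer_germOf, pull_germOf, germOf_eq_zero_iff] at h
  simpa [h0] using h.self_of_nhds

end GermRing

/-! ### Algebraic germs -/

section Nash

variable {ι T : Type} [Fintype ι] [Fintype T]

/-- The ring of algebraic germs. -/
def nashRing (ι : Type) [Fintype ι] : Subring (HolGerm ι) := algClosure (polyHom ι).range

theorem pull_polyHom_mem {V : (T → ℂ) → (ι → ℂ)} (hV : AnalyticAt ℂ V 0) (h0 : V 0 = 0)
    {S : Subring (HolGerm T)} (hc : ∀ a, constHom T a ∈ S) (h : ∀ i, coordGerm V hV i ∈ S)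
    (p : MvPolynomial ι ℂ) : pull V hV h0 (polyHom ι p) ∈ S := by
  induction p using MvPolynomial.induction_on with
  | C a =>
    have : pull V hV h0 (polyHom ι (MvPolynomial.C a)) = constHom T a := by
      have h1 : polyHom ι (MvPolynomial.C a) = constHom ι a := rfl
      rw [h1, constHom_apply, constHom_apply, pull_germOf]
    rw [this]; exact hc a
  | add p q hp hq => rw [map_add, map_add]; exact add_mem hp hq
  | mul_X p i hp =>
    rw [map_mul, map_mul]
    refine mul_mem hp ?_
    have : pull V hV h0 (polyHom ι (MvPolynomial.X i)) = coordGerm V hV i := by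
      rw [polyHom_apply, pull_germOf]
      exact germOf_congr _ _ (Eventually.of_forall fun t => by simp)
    rw [this]; exact h i

theorem constHom_mem_nashRing (a : ℂ) : constHom ι a ∈ nashRing ι :=
  le_algClosure _ ⟨_, rfl⟩

theorem isNash_coord (i : ι) : IsNash (fun x : ι → ℂ => x i) :=
  ⟨analyticAt_coord i 0,
    le_algClosure _ ⟨MvPolynomial.X i, by
      rw [polyHom_apply]
      exact germOf_congr _ _ (Eventually.of_forall fun t => by simp)⟩⟩

theorem isNash_const (a : ℂ) : IsNash (fun _ : ι → ℂ => a) :=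
  ⟨analyticAt_const, constHom_apply (ι := ι) a ▸ constHom_mem_nashRing a⟩

theorem IsNash.add {g h : (ι → ℂ) → ℂ} (hg : IsNash g) (hh : IsNash h) :
    IsNash (fun x => g x + h x) :=
  ⟨hg.1.add hh.1, (nashRing ι).add_mem hg.2 hh.2⟩

theorem analyticAt_of_isNash {V : (T → ℂ) → (ι → ℂ)} (h : ∀ i, IsNash fun t => V t i) :
    AnalyticAt ℂ V 0 := AnalyticAt.pi fun i => (h i).1

/-- Pulling back a polynomial relation, possibly after differentiating it, gives a relation over
polynomials in the components of `V`. These are algebraic germs, so transitivity concludes, even if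
`V` maps into the zero set of the original coefficients. -/
theorem pull_mem_nashRing {V : (T → ℂ) → (ι → ℂ)} (h : ∀ i, IsNash fun t => V t i)
    (h0 : V 0 = 0) {φ : HolGerm ι} (hφ : φ ∈ nashRing ι) :
    pull V (analyticAt_of_isNash h) h0 φ ∈ nashRing T := by
  classical
  have h1 := pull_mem_algClosure V (analyticAt_of_isNash h) h0 (S := (polyHom ι).range)
    (by rintro i _ ⟨p, rfl⟩; exact dd_polyHom i p) hφ
  refine algClosure_trans ?_ h1
  rintro _ ⟨_, ⟨p, rfl⟩, rfl⟩
  exact pull_polyHom_mem _ h0 constHom_mem_nashRing (fun i => (h i).2) p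

theorem IsNash.comp {g : (ι → ℂ) → ℂ} (hg : IsNash g) {V : (T → ℂ) → (ι → ℂ)}
    (h : ∀ i, IsNash fun t => V t i) (h0 : V 0 = 0) : IsNash fun t => g (V t) :=
  ⟨hg.1.comp_zero (analyticAt_of_isNash h) h0, pull_mem_nashRing h h0 hg.2⟩

theorem dd_mem_nashRing [DecidableEq ι] (i : ι) {φ : HolGerm ι} (hφ : φ ∈ nashRing ι) :
    dd i φ ∈ nashRing ι :=
  derivation_mem_algClosure (dd i) _ (by rintro _ ⟨p, rfl⟩; exact dd_polyHom i p) hφ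

theorem conjHom_polyHom_mem (p : MvPolynomial ι ℂ) :
    conjHom ι (polyHom ι p) ∈ (polyHom ι).range := by
  refine ⟨p.map (starRingEnd ℂ), ?_⟩
  rw [polyHom_apply, polyHom_apply, conjHom_germOf]
  refine germOf_congr _ _ (Eventually.of_forall fun x => ?_)
  simp only [conjFun]
  rw [MvPolynomial.eval_map]
  have h := MvPolynomial.eval₂_comp_left (starRingEnd ℂ) (RingHom.id ℂ) (star x) p
  rw [RingHom.comp_id] at h
  have h2 : (starRingEnd ℂ) ∘ star x = x := by funext i; simp
  rw [h2] at h
  exact h.symm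

theorem conjHom_mem_algClosure {S S' : Subring (HolGerm ι)} (h : S.map (conjHom ι) ≤ S')
    {φ : HolGerm ι} (hφ : φ ∈ algClosure S) : conjHom ι φ ∈ algClosure S' := by
  refine algClosure_map_mem _ S (fun x _ hx => ?_) h hφ
  rw [← conjHom_conjHom x, hx, map_zero]

theorem conjHom_mem_nashRing {φ : HolGerm ι} (hφ : φ ∈ nashRing ι) :
    conjHom ι φ ∈ nashRing ι :=
  conjHom_mem_algClosure (by rintro _ ⟨_, ⟨p, rfl⟩, rfl⟩; exact conjHom_polyHom_mem p) hφ

theorem IsNash.conj {g : (ι → ℂ) → ℂ} (hg : IsNash g) : IsNash (conjFun g) :=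
  ⟨analyticAt_conjFun hg.1, conjHom_mem_nashRing hg.2⟩

end Nash

/-- Here the rings need not be domains: it is applied to the quotient `ℂ{𝓜}`, before this is known
to embed in a ring of germs. -/
theorem isAlgebraic_map_subring {A B : Type*} [CommRing A] [CommRing B] (φ : A →+* B)
    (S : Subring A) (hφ : ∀ x ∈ S, φ x = 0 → x = 0) {x : A} (hx : IsAlgebraic S x) :
    IsAlgebraic (S.map φ) (φ x) := by
  let g : S →+* S.map φ := (φ.comp S.subtype).codRestrict (S.map φ) fun y => ⟨y, y.2, rfl⟩
  refine IsAlgebraic.ringHom_of_comp_eq (R := S) (S := S.map φ) (a := x) g φ hx ?_ ?_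
  · rw [injective_iff_map_eq_zero]
    intro y hy
    exact Subtype.ext (hφ y y.2 (congrArg Subtype.val hy))
  · ext y; rfl

theorem derivation_mem_closure {A : Type*} [CommRing A] (D : Derivation ℤ A A) (s : Set A)
    (h : ∀ x ∈ s, D x ∈ Subring.closure s) {x : A} (hx : x ∈ Subring.closure s) :
    D x ∈ Subring.closure s := by
  induction hx using Subring.closure_induction with
  | mem x hx => exact h x hx
  | zero => rw [map_zero]; exact zero_mem _
  | one => rw [Derivation.map_one_eq_zero]; exact zero_mem _
  | add x y _ _ hx hy => rw [map_add]; exact add_mem hx hy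
  | neg x _ hx => rw [map_neg]; exact neg_mem hx
  | mul x y hx' hy' hx hy =>
    rw [Derivation.leibniz]
    exact add_mem (mul_mem hx' hy) (mul_mem hy' hx)

/-- `g` is holomorphic near `0` and its germ is algebraic over `B`. -/
def AlgOver {ι : Type} [Fintype ι] (B : Subring (HolGerm ι)) (g : (ι → ℂ) → ℂ) : Prop :=
  ∃ hg : AnalyticAt ℂ g 0, germOf g hg ∈ algClosure B

theorem AlgOver.congr {ι : Type} [Fintype ι] {B : Subring (HolGerm ι)} {g h : (ι → ℂ) → ℂ}
    (hg : AlgOver B g) (H : g =ᶠ[𝓝 0] h) : AlgOver B h :=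
  ⟨hg.1.congr H, germOf_congr hg.1 (hg.1.congr H) H ▸ hg.2⟩

theorem AlgOver.mono {ι : Type} [Fintype ι] {B B' : Subring (HolGerm ι)} {g : (ι → ℂ) → ℂ}
    (hg : AlgOver B g) (h : B ≤ algClosure B') : AlgOver B' g :=
  ⟨hg.1, algClosure_trans h hg.2⟩

theorem AlgOver.conj {ι : Type} [Fintype ι] {B B' : Subring (HolGerm ι)} {g : (ι → ℂ) → ℂ}
    (hg : AlgOver B g) (h : B.map (conjHom ι) ≤ B') : AlgOver B' (conjFun g) :=
  ⟨analyticAt_conjFun hg.1, conjHom_mem_algClosure h hg.2⟩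

/-! ### Condition (♣) in the coordinates `(Z, χ)` and its pull-back along algebraic maps -/

section Core

variable {n m c N' : ℕ} {M : Set (Idx n m c → ℂ)} {Q : Fin m → (Fin n ⊕ Idx n m c → ℂ) → ℂ}

theorem IsNormalForm.map_zero (hQ : IsNormalForm M Q) (j : Fin m) : Q j 0 = 0 := by
  have h := (hQ.normal_right j).self_of_nhds
  have h1 : (Sum.elim 0 0 : Fin n ⊕ Idx n m c → ℂ) = 0 := by ext (i | i) <;> rfl
  rwa [h1] at h

/-- The parametrization of `𝓜` by the coordinates `(Z, χ)`. -/
def embM (Q : Fin m → (Fin n ⊕ Idx n m c → ℂ) → ℂ) (y : Idx n m c ⊕ Fin n → ℂ) :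
    Idx n m c ⊕ Idx n m c → ℂ :=
  Sum.elim (fun i => y (Sum.inl i)) (pt (fun i => y (Sum.inr i))
    (fun j => conjFun (Q j) (Sum.elim (fun i => y (Sum.inr i)) (fun i => y (Sum.inl i))))
    (fun i => y (Sum.inl (Sum.inr (Sum.inr i)))))

theorem embM_mem (y : Idx n m c ⊕ Fin n → ℂ) : embM Q y ∈ complexification Q :=
  ⟨fun _ => rfl, rfl⟩

theorem eq_embM_of_mem {x : Idx n m c ⊕ Idx n m c → ℂ} (hx : x ∈ complexification Q) :
    x = embM Q (Sum.elim (fun i => x (Sum.inl i)) (fun i => x (Sum.inr (Sum.inl i)))) := by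
  funext i
  rcases i with i | i | i | i
  · rfl
  · rfl
  · exact hx.1 i
  · exact congrFun hx.2 i

theorem isNash_sumElim {T α β : Type} [Fintype T] {V : (T → ℂ) → α → ℂ} {W : (T → ℂ) → β → ℂ}
    (hV : ∀ i, IsNash fun t => V t i) (hW : ∀ i, IsNash fun t => W t i) (i : α ⊕ β) :
    IsNash fun t => (Sum.elim (V t) (W t) : α ⊕ β → ℂ) i := by
  rcases i with i | i
  · exact hV i
  · exact hW i

theorem conjFun_zero {ι : Type} {g : (ι → ℂ) → ℂ} (h : g 0 = 0) : conjFun g 0 = 0 := by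
  simp [conjFun, h]

theorem sumElim_zero {α β : Type} : (Sum.elim 0 0 : α ⊕ β → ℂ) = 0 := by
  ext (i | i) <;> rfl

theorem embM_zero (hQ : IsNormalForm M Q) : embM Q 0 = 0 := by
  funext i
  rcases i with i | i | i | i
  · rfl
  · rfl
  · refine Eq.trans ?_ (conjFun_zero (hQ.map_zero i))
    change conjFun (Q i) (Sum.elim 0 0) = _
    rw [sumElim_zero]
  · rfl

theorem isNash_embM (hQ : IsNormalForm M Q) (i : Idx n m c ⊕ Idx n m c) :
    IsNash fun y => embM Q y i := by
  rcases i with i | i | i | i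
  · exact isNash_coord _
  · exact isNash_coord _
  · refine ((hQ.algebraic i).conj).comp (isNash_sumElim (fun k => isNash_coord _)
      (fun k => isNash_coord _)) ?_
    exact sumElim_zero
  · exact isNash_coord _

variable {f : Fin N' → (Idx n m c → ℂ) → ℂ}

/-- The points of `𝓜` are exactly those of the form `embM Q y`, with `y` their `(Z, χ)`-coordinates.
Hence `ℂ{𝓜}` embeds in the domain of germs in `(Z, χ)`, where relations can be differentiated. -/
theorem pull_embM_eq_zero_iff (hQ : IsNormalForm M Q) (φ : HolGerm (Idx n m c ⊕ Idx n m c)) :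
    pull (embM Q) (analyticAt_of_isNash (isNash_embM hQ)) (embM_zero hQ) φ = 0 ↔
      φ ∈ vanishingIdeal (complexification Q) := by
  have hcont : Tendsto (embM Q) (𝓝 0) (𝓝 0) := by
    simpa [embM_zero hQ] using (analyticAt_of_isNash (isNash_embM hQ)).continuousAt.tendsto
  obtain ⟨g, hg, rfl⟩ := exists_germOf φ
  rw [pull_germOf, germOf_eq_zero_iff]
  constructor
  · intro h
    refine ⟨g, rfl, ?_⟩
    have hproj : Tendsto (fun x : Idx n m c ⊕ Idx n m c → ℂ =>
        (Sum.elim (fun i => x (Sum.inl i)) (fun i => x (Sum.inr (Sum.inl i))) :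
          Idx n m c ⊕ Fin n → ℂ)) (𝓝 0) (𝓝 0) := by
      have hc : Continuous (fun x : Idx n m c ⊕ Idx n m c → ℂ =>
        (Sum.elim (fun i => x (Sum.inl i)) (fun i => x (Sum.inr (Sum.inl i))) :
          Idx n m c ⊕ Fin n → ℂ)) := by
        refine continuous_pi fun i => ?_
        rcases i with i | i <;> exact continuous_apply _
      have h0 := hc.tendsto 0
      have h1 : (Sum.elim (fun i => (0 : Idx n m c ⊕ Idx n m c → ℂ) (Sum.inl i))
        (fun i => (0 : Idx n m c ⊕ Idx n m c → ℂ) (Sum.inr (Sum.inl i))) :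
          Idx n m c ⊕ Fin n → ℂ) = 0 := sumElim_zero
      rwa [h1] at h0
    rw [eventually_nhdsWithin_iff]
    filter_upwards [hproj.eventually h] with x hx hxM
    rw [eq_embM_of_mem hxM]
    exact hx
  · rintro ⟨k, hk, hk0⟩
    rw [eventually_nhdsWithin_iff] at hk0
    have hgk : g =ᶠ[𝓝 0] k := Filter.Germ.coe_eq.1 hk
    filter_upwards [hcont.eventually hgk, hcont.eventually hk0] with y h1 h2
    exact h1.trans (h2 (embM_mem y))

/-- The derivatives `∂^L f̄_s (ζ)`, in the coordinates `(Z, χ)` of `𝓜`. -/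
def zetaJets (hQ : IsNormalForm M Q) (hf : ∀ s, AnalyticAt ℂ (f s) 0) :
    Set (HolGerm (Idx n m c ⊕ Fin n)) :=
  {φ | ∃ (L : List (Idx n m c)) (s : Fin N'), φ = pull (embM Q)
    (analyticAt_of_isNash (isNash_embM hQ)) (embM_zero hQ)
      (inZeta (iterPartial L (conjFun (f s)))
        (analyticAt_iterPartial L (analyticAt_conjFun (hf s))))}

/-- The ring generated by the algebraic germs and the derivatives of `f̄(ζ)`, in the coordinates
`(Z, χ)` of `𝓜`. -/
def jetRing (hQ : IsNormalForm M Q) (hf : ∀ s, AnalyticAt ℂ (f s) 0) :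
    Subring (HolGerm (Idx n m c ⊕ Fin n)) :=
  Subring.closure (nash _ ∪ zetaJets hQ hf)

theorem isNash_embM_zeta (hQ : IsNormalForm M Q) (i : Idx n m c) :
    IsNash fun y => embM Q y (Sum.inr i) := isNash_embM hQ (Sum.inr i)

/-- Differentiating a pulled-back jet of `f̄(ζ)` gives jets of one order more, multiplied by
derivatives of the algebraic functions `ζ(Z, χ)`. Allowing jets of all orders is what makes the ring
stable. -/
theorem dd_mem_jetRing (hQ : IsNormalForm M Q) (hf : ∀ s, AnalyticAt ℂ (f s) 0)
    (i : Idx n m c ⊕ Fin n) {φ : HolGerm (Idx n m c ⊕ Fin n)} (hφ : φ ∈ jetRing hQ hf) :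
    dd i φ ∈ jetRing hQ hf := by
  refine derivation_mem_closure (dd i) _ ?_ hφ
  rintro φ (hφ | ⟨L, s, rfl⟩)
  · exact Subring.subset_closure (Or.inl (dd_mem_nashRing i hφ))
  · have h0 : (fun y k => embM Q y (Sum.inr k)) 0 = 0 := by
      funext k; exact congrFun (embM_zero hQ) (Sum.inr k)
    have key : ∀ L : List (Idx n m c), pull (embM Q) (analyticAt_of_isNash (isNash_embM hQ))
        (embM_zero hQ) (inZeta (iterPartial L (conjFun (f s)))
          (analyticAt_iterPartial L (analyticAt_conjFun (hf s)))) =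
        pull (fun y k => embM Q y (Sum.inr k)) (analyticAt_of_isNash (isNash_embM_zeta hQ)) h0
          (germOf (iterPartial L (conjFun (f s)))
            (analyticAt_iterPartial L (analyticAt_conjFun (hf s)))) := fun _ => rfl
    rw [key, dd_pull]
    refine sum_mem fun k _ => mul_mem ?_ ?_
    · refine Subring.subset_closure (Or.inr ⟨k :: L, s, ?_⟩)
      rw [key, dd_germOf]
      rfl
    · exact Subring.subset_closure (Or.inl (dd_mem_nashRing i (isNash_embM_zeta hQ k).2))

theorem analyticAt_comp_inl {g : (Idx n m c → ℂ) → ℂ} (hg : AnalyticAt ℂ g 0) :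
    AnalyticAt ℂ (fun y : Idx n m c ⊕ Fin n → ℂ => g fun i => y (Sum.inl i)) 0 :=
  hg.comp_zero (V := fun y : Idx n m c ⊕ Fin n → ℂ => fun i => y (Sum.inl i))
    (AnalyticAt.pi fun _ => analyticAt_coord _ _) rfl

/-- The pull-back along `embM` induces an injection on the quotient `ℂ{𝓜}`, and this carries the
relation of (♣) over to germs in `(Z, χ)`. -/
theorem Club.germOf_mem (hQ : IsNormalForm M Q) {hf : ∀ s, AnalyticAt ℂ (f s) 0}
    (hclub : Club Q f hf) (s : Fin N') :
    germOf (fun y : Idx n m c ⊕ Fin n → ℂ => f s fun i => y (Sum.inl i))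
      (analyticAt_comp_inl (hf s)) ∈ algClosure (jetRing hQ hf) := by
  obtain ⟨ℓ, hℓ⟩ := hclub
  have h := hℓ s
  let e := pull (embM Q) (analyticAt_of_isNash (isNash_embM hQ)) (embM_zero hQ)
  let e' := Ideal.Quotient.lift (vanishingIdeal (complexification Q)) e
    fun φ hφ => (pull_embM_eq_zero_iff hQ φ).2 hφ
  have h1 := isAlgebraic_map_subring e' _ (fun x _ hx => by
    obtain ⟨φ, rfl⟩ := Ideal.Quotient.mk_surjective x
    rw [Ideal.Quotient.lift_mk] at hx
    exact Ideal.Quotient.eq_zero_iff_mem.2 ((pull_embM_eq_zero_iff hQ φ).1 hx)) h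
  rw [Ideal.Quotient.lift_mk] at h1
  refine algClosure_mono ?_ h1
  rintro _ ⟨_, ⟨φ, hφ, rfl⟩, rfl⟩
  change e φ ∈ _
  have hle : ringR f hf ℓ ≤ (jetRing hQ hf).comap e := by
    refine Subring.closure_le.2 ?_
    rintro φ (hφ | ⟨L, s, -, rfl⟩)
    · exact Subring.subset_closure (Or.inl (pull_mem_nashRing (isNash_embM hQ) (embM_zero hQ) hφ))
    · exact Subring.subset_closure (Or.inr ⟨L, s, rfl⟩)
  exact hle hφ

/-- Since `Z` is among the coordinates `(Z, χ)`, the derivatives of `f(Z)` are partial derivatives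
there. They inherit algebraicity from `f` because `jetRing` is stable under differentiation. -/
theorem Club.jet_germOf_mem (hQ : IsNormalForm M Q) {hf : ∀ s, AnalyticAt ℂ (f s) 0}
    (hclub : Club Q f hf) (L : List (Idx n m c)) (s : Fin N') :
    germOf (fun y : Idx n m c ⊕ Fin n → ℂ => iterPartial L (f s) fun i => y (Sum.inl i))
      (analyticAt_comp_inl (analyticAt_iterPartial L (hf s))) ∈ algClosure (jetRing hQ hf) := by
  induction L with
  | nil => exact hclub.germOf_mem hQ s
  | cons k L ih =>
    have h := derivation_mem_algClosure (dd (Sum.inl k)) _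
      (fun _ => dd_mem_jetRing hQ hf (Sum.inl k)) ih
    rw [dd_germOf] at h
    convert h using 1
    refine germOf_congr _ _ ?_
    have hcont : Tendsto (fun y : Idx n m c ⊕ Fin n → ℂ => fun i => y (Sum.inl i)) (𝓝 0)
        (𝓝 (0 : Idx n m c → ℂ)) :=
      (continuous_pi fun _ => continuous_apply _ : Continuous
        (fun y : Idx n m c ⊕ Fin n → ℂ => fun i => y (Sum.inl i))).tendsto 0
    filter_upwards [hcont.eventually (analyticAt_iterPartial L (hf s)).eventually_analyticAt]
      with y hy
    have hlin := (ContinuousLinearMap.pi (R := ℂ) fun i : Idx n m c =>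
      ContinuousLinearMap.proj (R := ℂ) (φ := fun _ : Idx n m c ⊕ Fin n => ℂ)
        (Sum.inl i)).hasFDerivAt (x := y)
    have h3 := (hy.differentiableAt.hasFDerivAt.comp y hlin).fderiv
    have h4 := congrArg (fun A : (Idx n m c ⊕ Fin n → ℂ) →L[ℂ] ℂ => A (Pi.single (Sum.inl k) 1)) h3
    refine Eq.trans ?_ h4.symm
    simp only [ContinuousLinearMap.comp_apply]
    refine congrArg (fderiv ℂ (iterPartial L (f s)) fun i => y (Sum.inl i)) ?_
    funext i
    simp [Pi.single_apply]

/-- If the derivatives of `f̄` along the `ζ`-part of an algebraic map into `𝓜` are algebraic over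
`B`, then so are those of `f` along its `Z`-part. -/
theorem Club.algOver_Z (hQ : IsNormalForm M Q) {hf : ∀ s, AnalyticAt ℂ (f s) 0}
    (hclub : Club Q f hf) {T : Type} [Fintype T] {V : (T → ℂ) → (Idx n m c ⊕ Idx n m c → ℂ)}
    (hV : ∀ i, IsNash fun t => V t i) (hV0 : V 0 = 0)
    (hVM : ∀ᶠ t in 𝓝 0, V t ∈ complexification Q) {B : Subring (HolGerm T)}
    (hB : nashRing T ≤ B)
    (h : ∀ L s, AlgOver B fun t => iterPartial L (conjFun (f s)) fun i => V t (Sum.inr i))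
    (L : List (Idx n m c)) (s : Fin N') :
    AlgOver B fun t => iterPartial L (f s) fun i => V t (Sum.inl i) := by
  let W : (T → ℂ) → (Idx n m c ⊕ Fin n → ℂ) := fun t =>
    Sum.elim (fun i => V t (Sum.inl i)) (fun i => V t (Sum.inr (Sum.inl i)))
  have hW : ∀ i, IsNash fun t => W t i := isNash_sumElim (fun _ => hV _) (fun _ => hV _)
  have hW0 : W 0 = 0 := by
    funext i
    rcases i with i | i
    · exact congrFun hV0 _
    · exact congrFun hV0 _
  -- `W` is `V` in the coordinates `(Z, χ)`. The relations for the jets of `f` are pulled back along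
  -- `W`; stability of `jetRing` covers the case that their coefficients vanish along `W`.
  have h1 := pull_mem_algClosure W (analyticAt_of_isNash hW) hW0
    (fun i φ => dd_mem_jetRing hQ hf i) (hclub.jet_germOf_mem hQ L s)
  refine ⟨(analyticAt_comp_inl (analyticAt_iterPartial L (hf s))).comp_zero
    (analyticAt_of_isNash hW) hW0, ?_⟩
  refine algClosure_trans ?_ h1
  rw [Subring.map_le_iff_le_comap]
  refine Subring.closure_le.2 ?_
  rintro φ (hφ | ⟨L, s, rfl⟩)
  · exact le_algClosure B (hB (pull_mem_nashRing hW hW0 hφ))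
  · obtain ⟨h1, h2⟩ := h L s
    change pull W _ hW0 _ ∈ algClosure B
    have heq : pull W (analyticAt_of_isNash hW) hW0 (pull (embM Q)
        (analyticAt_of_isNash (isNash_embM hQ)) (embM_zero hQ)
          (inZeta (iterPartial L (conjFun (f s)))
            (analyticAt_iterPartial L (analyticAt_conjFun (hf s))))) = germOf _ h1 := by
      rw [inZeta, pull_germOf, pull_germOf]
      refine germOf_congr _ _ ?_
      filter_upwards [hVM] with t ht
      have := eq_embM_of_mem ht
      rw [this]
      rfl
    rw [heq]
    exact h2

end Core

/-! ### Conjugation on `𝓜`, and chains of algebraic maps starting at `(0, 0, u)` -/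

section Chains

variable {n m c N' : ℕ} {M : Set (Idx n m c → ℂ)} {Q : Fin m → (Fin n ⊕ Idx n m c → ℂ) → ℂ}
  {f : Fin N' → (Idx n m c → ℂ) → ℂ} {T : Type} [Fintype T]

/-- The involution `(Z, ζ) ↦ (ζ̄, Z̄)`. -/
def sig {ι : Type} (x : ι ⊕ ι → ℂ) : ι ⊕ ι → ℂ :=
  Sum.elim (fun i => star (x (Sum.inr i))) (fun i => star (x (Sum.inl i)))

theorem sig_sig {ι : Type} (x : ι ⊕ ι → ℂ) : sig (sig x) = x := by
  ext (i | i) <;> simp [sig]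

theorem sig_zero {ι : Type} : sig (0 : ι ⊕ ι → ℂ) = 0 := by
  ext (i | i) <;> simp [sig]

theorem continuous_sig {ι : Type} : Continuous (sig : (ι ⊕ ι → ℂ) → _) := by
  refine continuous_pi fun i => ?_
  rcases i with i | i <;> exact continuous_star.comp (continuous_apply _)

theorem tendsto_sig {ι : Type} : Tendsto (sig : (ι ⊕ ι → ℂ) → _) (𝓝 0) (𝓝 0) := by
  simpa only [sig_zero] using (continuous_sig (ι := ι)).tendsto 0

theorem tendsto_star_zero {ι : Type} : Tendsto (star : (ι → ℂ) → (ι → ℂ)) (𝓝 0) (𝓝 0) := by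
  simpa using (continuous_star (R := ι → ℂ)).tendsto 0

/-- Conjugating the equations `σ = Θ̄(χ, z, η)` at `sig x` turns them into `η = Θ(z, ζ)`, that is,
into the equations solved for the `w`-part of `Z` instead of that of `ζ`. -/
theorem sig_mem_iff {x : Idx n m c ⊕ Idx n m c → ℂ} : sig x ∈ complexification Q ↔
    (∀ j, wPart (x ∘ Sum.inl) j = Q j (Sum.elim (zPart (x ∘ Sum.inl)) (x ∘ Sum.inr))) ∧
      uPart (x ∘ Sum.inr) = uPart (x ∘ Sum.inl) := by
  have h : ∀ j, conjFun (Q j) (Sum.elim (zPart (sig x ∘ Sum.inr)) (sig x ∘ Sum.inl)) =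
      star (Q j (Sum.elim (zPart (x ∘ Sum.inl)) (x ∘ Sum.inr))) := by
    intro j
    simp only [conjFun]
    congr 2
    ext (i | i) <;> simp [sig, zPart]
  refine and_congr (forall_congr' fun j => ?_) ?_
  · rw [h j]
    exact star_injective.eq_iff
  · refine ⟨fun h => ?_, fun h => ?_⟩
    · funext i
      exact star_injective (congrFun h i).symm
    · funext i
      exact congrArg star (congrFun h i).symm

/-- By the reality condition on `Θ`, the equations solved for `σ` imply those solved for `η`. As
`sig` is an involution, the two descriptions of `𝓜` agree near `0`. -/
theorem eventually_sig_mem (hQ : IsNormalForm M Q) :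
    ∀ᶠ x in 𝓝 0, x ∈ complexification Q → sig x ∈ complexification Q := by
  have hc : Tendsto (fun x : Idx n m c ⊕ Idx n m c → ℂ =>
      (Sum.elim (zPart (x ∘ Sum.inr)) (x ∘ Sum.inl) : Fin n ⊕ Idx n m c → ℂ)) (𝓝 0) (𝓝 0) := by
    have hcont : Continuous (fun x : Idx n m c ⊕ Idx n m c → ℂ =>
        (Sum.elim (zPart (x ∘ Sum.inr)) (x ∘ Sum.inl) : Fin n ⊕ Idx n m c → ℂ)) := by
      refine continuous_pi fun i => ?_
      rcases i with i | i <;> exact continuous_apply _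
    have h0 := hcont.tendsto 0
    have h1 : (Sum.elim (zPart ((0 : Idx n m c ⊕ Idx n m c → ℂ) ∘ Sum.inr))
      ((0 : Idx n m c ⊕ Idx n m c → ℂ) ∘ Sum.inl) : Fin n ⊕ Idx n m c → ℂ) = 0 := sumElim_zero
    rwa [h1] at h0
  filter_upwards [hc.eventually (eventually_all.2 hQ.reality)] with x hx hxM
  refine sig_mem_iff.2 ⟨fun j => ?_, hxM.2⟩
  refine (hx j).symm.trans (congrArg (Q j) ?_)
  ext (i | i | i | i)
  · rfl
  · rfl
  · exact (hxM.1 i).symm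
  · exact (congrFun hxM.2 i).symm

theorem eventually_mem_of_sig_mem (hQ : IsNormalForm M Q) :
    ∀ᶠ x in 𝓝 0, sig x ∈ complexification Q → x ∈ complexification Q := by
  filter_upwards [tendsto_sig.eventually (eventually_sig_mem hQ)] with x hx h
  simpa only [sig_sig] using hx h

/-- The map `t ↦ σ(V(t̄))`, `σ(Z, ζ) = (ζ̄, Z̄)`. -/
def conjMap {ι : Type} (V : (T → ℂ) → (ι ⊕ ι → ℂ)) : (T → ℂ) → (ι ⊕ ι → ℂ) :=
  fun t => sig (V (star t))

theorem isNash_conjMap {ι : Type} {V : (T → ℂ) → (ι ⊕ ι → ℂ)}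
    (hV : ∀ i, IsNash fun t => V t i) (i : ι ⊕ ι) : IsNash fun t => conjMap V t i := by
  rcases i with i | i
  · exact (hV (Sum.inr i)).conj
  · exact (hV (Sum.inl i)).conj

theorem conjMap_zero {ι : Type} {V : (T → ℂ) → (ι ⊕ ι → ℂ)} (h : V 0 = 0) : conjMap V 0 = 0 := by
  simp only [conjMap, star_zero, h, sig_zero]

theorem eventually_conjMap_mem (hQ : IsNormalForm M Q) {V : (T → ℂ) → (Idx n m c ⊕ Idx n m c → ℂ)}
    (hV : AnalyticAt ℂ V 0) (hV0 : V 0 = 0) (hVM : ∀ᶠ t in 𝓝 0, V t ∈ complexification Q) :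
    ∀ᶠ t in 𝓝 0, conjMap V t ∈ complexification Q := by
  have hc : Tendsto V (𝓝 0) (𝓝 0) := by simpa only [hV0] using hV.continuousAt.tendsto
  filter_upwards [tendsto_star_zero.eventually hVM,
    tendsto_star_zero.eventually (hc.eventually (eventually_sig_mem hQ))] with t h1 h2
  exact h2 h1

theorem Club.algOver_zeta (hQ : IsNormalForm M Q) {hf : ∀ s, AnalyticAt ℂ (f s) 0}
    (hclub : Club Q f hf) {V : (T → ℂ) → (Idx n m c ⊕ Idx n m c → ℂ)}
    (hV : ∀ i, IsNash fun t => V t i) (hV0 : V 0 = 0)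
    (hVM : ∀ᶠ t in 𝓝 0, V t ∈ complexification Q) {B : Subring (HolGerm T)}
    (hB : nashRing T ≤ B)
    (h : ∀ L s, AlgOver B fun t => iterPartial L (f s) fun i => V t (Sum.inl i))
    (L : List (Idx n m c)) (s : Fin N') :
    AlgOver B fun t => iterPartial L (conjFun (f s)) fun i => V t (Sum.inr i) := by
  -- `conjMap` exchanges the roles of `Z` and `ζ`, so the statement for `f(Z)` is applied to it,
  -- with the conjugate of `B` as coefficient ring, and the result is conjugated back.
  have h1 := hclub.algOver_Z hQ (isNash_conjMap hV) (conjMap_zero hV0)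
    (eventually_conjMap_mem hQ (analyticAt_of_isNash hV) hV0 hVM) (B := B.map (conjHom T))
    (fun φ hφ => ⟨conjHom T φ, hB (conjHom_mem_nashRing hφ), conjHom_conjHom φ⟩)
    (fun L s => ?_) L s
  · have h2 := h1.conj (B' := B) (by
      rintro _ ⟨_, ⟨φ, hφ, rfl⟩, rfl⟩
      rw [conjHom_conjHom]; exact hφ)
    refine h2.congr (Eventually.of_forall fun t => ?_)
    simp only [iterPartial_conjFun, conjFun, conjMap, sig, Sum.elim_inl, star_star]
    rfl
  · refine ((h L s).conj le_rfl).congr (Eventually.of_forall fun t => ?_)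
    simp only [iterPartial_conjFun, conjFun, conjMap, sig, Sum.elim_inr]
    congr 2
    funext i
    simp

/-- The ring generated by the algebraic germs and the derivatives of `f` at `(0, 0, u)`, where
`u_i = t_{j(i)}`. -/
def uRing (f : Fin N' → (Idx n m c → ℂ) → ℂ) (j : Fin c → T) : Subring (HolGerm T) :=
  Subring.closure (nash T ∪ {φ | ∃ (L : List (Idx n m c)) (s : Fin N') (hg : AnalyticAt ℂ
    (fun t : T → ℂ => iterPartial L (f s) (pt 0 0 fun i => t (j i))) 0), φ = germOf _ hg})

/-- The ring generated by the algebraic germs and the derivatives of `f` and `f̄` at `(0, 0, u)`,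
where `u_i = t_{j(i)}`. -/
def symRing (f : Fin N' → (Idx n m c → ℂ) → ℂ) (j : Fin c → T) : Subring (HolGerm T) :=
  uRing f j ⊔ uRing (fun s => conjFun (f s)) j

theorem nashRing_le_uRing (f : Fin N' → (Idx n m c → ℂ) → ℂ) (j : Fin c → T) :
    nashRing T ≤ uRing f j := fun _ hφ => Subring.subset_closure (Or.inl hφ)

theorem pt_star (u : Fin c → ℂ) :
    (star (pt 0 0 (star u)) : Idx n m c → ℂ) = pt 0 0 u := by
  ext (i | i | i) <;> simp [pt]

theorem conj_uRing_le (f : Fin N' → (Idx n m c → ℂ) → ℂ) (j : Fin c → T) :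
    (uRing f j).map (conjHom T) ≤ uRing (fun s => conjFun (f s)) j := by
  rw [Subring.map_le_iff_le_comap]
  refine Subring.closure_le.2 ?_
  rintro φ (hφ | ⟨L, s, hg, rfl⟩)
  · exact nashRing_le_uRing _ _ (conjHom_mem_nashRing hφ)
  · have heq : conjFun (fun t : T → ℂ => iterPartial L (f s) (pt 0 0 fun i => t (j i))) =
        fun t => iterPartial L (conjFun (f s)) (pt 0 0 fun i => t (j i)) := by
      funext t
      rw [iterPartial_conjFun]
      simp only [conjFun]
      rw [← pt_star fun i => t (j i), star_star]
      rfl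
    refine Subring.subset_closure (Or.inr ⟨L, s, heq ▸ analyticAt_conjFun hg, ?_⟩)
    rw [conjHom_germOf]
    exact germOf_congr _ _ (by rw [heq])

/-- Conjugation swaps the two summands. This invariance is the reason for using jets of both `f` and
`f̄`: a single coefficient ring serves for a chain and for its conjugate. -/
theorem conj_symRing_le (f : Fin N' → (Idx n m c → ℂ) → ℂ) (j : Fin c → T) :
    (symRing f j).map (conjHom T) ≤ symRing f j := by
  rw [symRing, Subring.map_sup]
  refine sup_le ((conj_uRing_le f j).trans le_sup_right) (le_trans ?_ le_sup_left)
  refine (conj_uRing_le _ j).trans (le_of_eq ?_)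
  simp only [conjFun_conjFun]

variable (Q f) in
/-- An algebraic map `V` into `𝓜`, with `V(0) = 0` and with `u`-part `(t_{j(i)})_i`, along which
the derivatives of `f(Z)` and `f̄(ζ)` are algebraic over the ring generated by the algebraic germs
and the derivatives of `f` and `f̄` at `(0, 0, u)`. -/
structure IsChain (V : (T → ℂ) → (Idx n m c ⊕ Idx n m c → ℂ)) (j : Fin c → T) : Prop where
  nash : ∀ i, IsNash fun t => V t i
  zero : V 0 = 0
  mem : ∀ᶠ t in 𝓝 0, V t ∈ complexification Q
  inj : Function.Injective j
  u_eq : ∀ᶠ t in 𝓝 0, ∀ i, V t (Sum.inl (Sum.inr (Sum.inr i))) = t (j i)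
  algZ : ∀ L s, AlgOver (symRing f j) fun t => iterPartial L (f s) fun i => V t (Sum.inl i)
  algZeta : ∀ L s, AlgOver (symRing f j) fun t =>
    iterPartial L (conjFun (f s)) fun i => V t (Sum.inr i)

theorem IsChain.analyticAt {V : (T → ℂ) → (Idx n m c ⊕ Idx n m c → ℂ)} {j : Fin c → T}
    (h : IsChain Q f V j) : AnalyticAt ℂ V 0 := analyticAt_of_isNash h.nash

/-- Exchanging the roles of `Z` and `ζ` makes moves along `Z = const` out of moves along `ζ =
const`. The condition on `u` persists because the `u`-parts of `Z` and `ζ` agree on `𝓜`. -/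
theorem IsChain.conjMap (hQ : IsNormalForm M Q) {V : (T → ℂ) → (Idx n m c ⊕ Idx n m c → ℂ)}
    {j : Fin c → T} (h : IsChain Q f V j) : IsChain Q f (conjMap V) j where
  nash := isNash_conjMap h.nash
  zero := conjMap_zero h.zero
  mem := eventually_conjMap_mem hQ h.analyticAt h.zero h.mem
  inj := h.inj
  u_eq := by
    filter_upwards [tendsto_star_zero.eventually h.mem, tendsto_star_zero.eventually h.u_eq]
      with t h1 h2 i
    have h3 : V (star t) (Sum.inr (Sum.inr (Sum.inr i))) = star t (j i) :=
      (congrFun h1.2 i).trans (h2 i)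
    change star (V (star t) (Sum.inr (Sum.inr (Sum.inr i)))) = _
    rw [h3]
    simp
  algZ L s := by
    refine ((h.algZeta L s).conj (conj_symRing_le f j)).congr (Eventually.of_forall fun t => ?_)
    simp only [iterPartial_conjFun, conjFun, KeyAlg.conjMap, sig, Sum.elim_inl, star_star]
    rfl
  algZeta L s := by
    refine ((h.algZ L s).conj (conj_symRing_le f j)).congr (Eventually.of_forall fun t => ?_)
    simp only [iterPartial_conjFun, conjFun, KeyAlg.conjMap, sig, Sum.elim_inr]
    congr 2
    funext i
    simp

theorem isNash_pt {U : (T → ℂ) → Fin n → ℂ} {V : (T → ℂ) → Fin m → ℂ} {W : (T → ℂ) → Fin c → ℂ}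
    (hU : ∀ i, IsNash fun t => U t i) (hV : ∀ i, IsNash fun t => V t i)
    (hW : ∀ i, IsNash fun t => W t i) (i : Idx n m c) : IsNash fun t => pt (U t) (V t) (W t) i :=
  isNash_sumElim hU (isNash_sumElim hV hW) i

theorem pt_zero : (pt 0 0 0 : Idx n m c → ℂ) = 0 := by
  ext (i | i | i) <;> rfl

/-- The points `((0, 0, u), (0, 0, u))`, with `u_i = t_{j(i)}`. -/
def baseMap (n m : ℕ) (j : Fin c → T) (t : T → ℂ) : Idx n m c ⊕ Idx n m c → ℂ :=
  Sum.elim (pt 0 0 fun i => t (j i)) (pt 0 0 fun i => t (j i))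

theorem isNash_baseMap (j : Fin c → T) (i : Idx n m c ⊕ Idx n m c) :
    IsNash fun t => baseMap n m j t i := by
  have h := isNash_pt (n := n) (m := m) (U := fun _ => 0) (V := fun _ => 0)
    (W := fun (t : T → ℂ) i => t (j i)) (fun _ => isNash_const 0) (fun _ => isNash_const 0)
    (fun _ => isNash_coord _)
  exact isNash_sumElim h h i

theorem baseMap_zero (j : Fin c → T) : baseMap n m j 0 = 0 := by
  have : (pt 0 0 fun i => (0 : T → ℂ) (j i) : Idx n m c → ℂ) = 0 := pt_zero
  rw [baseMap, this, sumElim_zero]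

/-- This is the normality condition `Θ(0, χ, η) = η`, conjugated. -/
theorem eventually_baseMap_mem (hQ : IsNormalForm M Q) (j : Fin c → T) :
    ∀ᶠ t in 𝓝 0, baseMap n m j t ∈ complexification Q := by
  have hc : Tendsto (fun t => star (baseMap n m j t ∘ Sum.inl)) (𝓝 0)
      (𝓝 (0 : Idx n m c → ℂ)) := by
    have h1 := (analyticAt_of_isNash (isNash_baseMap (n := n) (m := m) j)).continuousAt
    have h2 : ContinuousAt (fun t => star (baseMap n m j t ∘ Sum.inl)) 0 :=
      continuous_star.continuousAt.comp
        (continuousAt_pi.2 fun i => (continuousAt_pi.1 h1) (Sum.inl i))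
    have h3 := h2.tendsto
    rw [baseMap_zero] at h3
    simpa using h3
  filter_upwards [hc.eventually (eventually_all.2 hQ.normal_right)] with t ht
  refine ⟨fun k => ?_, rfl⟩
  have h1 := ht k
  have h2 : (Sum.elim 0 (star (baseMap n m j t ∘ Sum.inl)) : Fin n ⊕ Idx n m c → ℂ) =
      star (Sum.elim (zPart (baseMap n m j t ∘ Sum.inr)) (baseMap n m j t ∘ Sum.inl)) := by
    ext (i | i)
    · simp [zPart, baseMap, pt]
    · rfl
  rw [conjFun, ← h2, h1]
  simp [wPart, baseMap, pt]

theorem algOver_jet_pt {f : Fin N' → (Idx n m c → ℂ) → ℂ} (hf : ∀ s, AnalyticAt ℂ (f s) 0)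
    (j : Fin c → T) (L : List (Idx n m c)) (s : Fin N') :
    AlgOver (uRing f j) fun t => iterPartial L (f s) (pt 0 0 fun i => t (j i)) := by
  have hb := isNash_baseMap (n := n) (m := m) j
  have hg : AnalyticAt ℂ (fun t : T → ℂ => iterPartial L (f s) (pt 0 0 fun i => t (j i))) 0 :=
    (analyticAt_iterPartial L (hf s)).comp_zero (V := fun t : T → ℂ => pt 0 0 fun i => t (j i))
      (analyticAt_of_isNash fun i => hb (Sum.inl i)) pt_zero
  exact ⟨hg, le_algClosure _ (Subring.subset_closure (Or.inr ⟨L, s, hg, rfl⟩))⟩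

theorem isChain_baseMap (hQ : IsNormalForm M Q) (hf : ∀ s, AnalyticAt ℂ (f s) 0) :
    IsChain Q f (baseMap n m (id : Fin c → Fin c)) id where
  nash := isNash_baseMap _
  zero := baseMap_zero _
  mem := eventually_baseMap_mem hQ _
  inj := Function.injective_id
  u_eq := Eventually.of_forall fun _ _ => rfl
  algZ L s := (algOver_jet_pt hf id L s).mono (le_sup_left.trans (le_algClosure _))
  algZeta L s := (algOver_jet_pt (fun s => analyticAt_conjFun (hf s)) id L s).mono
    (le_sup_right.trans (le_algClosure _))

/-- The derivatives of `f̄` at `(0, 0, u)` are algebraic over the ring generated by those of `f`. -/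
theorem Club.symRing_le (hQ : IsNormalForm M Q) {hf : ∀ s, AnalyticAt ℂ (f s) 0}
    (hclub : Club Q f hf) (j : Fin c → T) : symRing f j ≤ algClosure (uRing f j) := by
  refine sup_le (le_algClosure _) (Subring.closure_le.2 ?_)
  rintro φ (hφ | ⟨L, s, hg, rfl⟩)
  · exact le_algClosure _ (nashRing_le_uRing _ _ hφ)
  · exact (hclub.algOver_zeta hQ (isNash_baseMap j) (baseMap_zero j) (eventually_baseMap_mem hQ j)
      (nashRing_le_uRing f j) (fun L s => algOver_jet_pt hf j L s) L s).2

/-! ### Moving along the leaves `ζ = const` -/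

/-- The map `(t, s) ↦ ((z + s, Q(z + s, ζ), u), ζ)`, where `V(t) = ((z, w, u), ζ)`. -/
def stepMap (Q : Fin m → (Fin n ⊕ Idx n m c → ℂ) → ℂ)
    (V : (T → ℂ) → (Idx n m c ⊕ Idx n m c → ℂ)) (y : T ⊕ Fin n → ℂ) :
    Idx n m c ⊕ Idx n m c → ℂ :=
  Sum.elim (pt (fun i => V (fun k => y (Sum.inl k)) (Sum.inl (Sum.inl i)) + y (Sum.inr i))
    (fun l => Q l (Sum.elim
      (fun i => V (fun k => y (Sum.inl k)) (Sum.inl (Sum.inl i)) + y (Sum.inr i))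
      (fun i => V (fun k => y (Sum.inl k)) (Sum.inr i))))
    (fun i => V (fun k => y (Sum.inl k)) (Sum.inl (Sum.inr (Sum.inr i)))))
    (fun i => V (fun k => y (Sum.inl k)) (Sum.inr i))

theorem isNash_comp_inl {S : Type} [Fintype S] {g : (T → ℂ) → ℂ} (hg : IsNash g) :
    IsNash fun y : T ⊕ S → ℂ => g fun k => y (Sum.inl k) :=
  hg.comp (fun _ => isNash_coord _) rfl

theorem isNash_stepArg {V : (T → ℂ) → (Idx n m c ⊕ Idx n m c → ℂ)}
    (hV : ∀ i, IsNash fun t => V t i) (k : Fin n ⊕ Idx n m c) :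
    IsNash fun y : T ⊕ Fin n → ℂ => (Sum.elim
      (fun i => V (fun k => y (Sum.inl k)) (Sum.inl (Sum.inl i)) + y (Sum.inr i))
      (fun i => V (fun k => y (Sum.inl k)) (Sum.inr i)) : Fin n ⊕ Idx n m c → ℂ) k :=
  isNash_sumElim (fun _ => (isNash_comp_inl (hV _)).add (isNash_coord _))
    (fun _ => isNash_comp_inl (hV _)) k

theorem stepArg_zero {V : (T → ℂ) → (Idx n m c ⊕ Idx n m c → ℂ)} (hV0 : V 0 = 0) :
    (Sum.elim (fun i => V (fun k => (0 : T ⊕ Fin n → ℂ) (Sum.inl k)) (Sum.inl (Sum.inl i)) +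
      (0 : T ⊕ Fin n → ℂ) (Sum.inr i))
      (fun i => V (fun k => (0 : T ⊕ Fin n → ℂ) (Sum.inl k)) (Sum.inr i)) :
        Fin n ⊕ Idx n m c → ℂ) = 0 := by
  have h : (fun k => (0 : T ⊕ Fin n → ℂ) (Sum.inl k)) = 0 := rfl
  rw [h, hV0]
  ext (i | i) <;> simp

theorem isNash_stepMap (hQ : IsNormalForm M Q) {V : (T → ℂ) → (Idx n m c ⊕ Idx n m c → ℂ)}
    (hV : ∀ i, IsNash fun t => V t i) (hV0 : V 0 = 0) (i : Idx n m c ⊕ Idx n m c) :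
    IsNash fun y => stepMap Q V y i := by
  refine isNash_sumElim (isNash_pt ?_ ?_ ?_) ?_ i
  · exact fun i => (isNash_comp_inl (hV _)).add (isNash_coord _)
  · exact fun l => (hQ.algebraic l).comp (isNash_stepArg hV) (stepArg_zero hV0)
  · exact fun i => isNash_comp_inl (hV _)
  · exact fun i => isNash_comp_inl (hV _)

theorem stepMap_zero (hQ : IsNormalForm M Q) {V : (T → ℂ) → (Idx n m c ⊕ Idx n m c → ℂ)}
    (hV0 : V 0 = 0) : stepMap Q V 0 = 0 := by
  have h : ∀ i, V (fun k => (0 : T ⊕ Fin n → ℂ) (Sum.inl k)) i = 0 := congrFun hV0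
  ext (i | i)
  · rcases i with i | i | i
    · exact (congrArg (· + (0 : ℂ)) (h _)).trans (zero_add 0)
    · change Q i (Sum.elim _ _) = 0
      rw [stepArg_zero hV0, hQ.map_zero]
    · exact h _
  · exact h _

/-- Adding variables is injective on germs, as restricting to the value `0` of the new variables
recovers the old germ. So relations keep nonzero coefficients. -/
theorem AlgOver.comp_inl {S : Type} [Fintype S] {B : Subring (HolGerm T)} {g : (T → ℂ) → ℂ}
    (hg : AlgOver B g) {B' : Subring (HolGerm (T ⊕ S))}
    (hB : B ≤ B'.comap (pull (fun y : T ⊕ S → ℂ => fun k => y (Sum.inl k))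
      (AnalyticAt.pi fun _ => analyticAt_coord _ _) rfl)) :
    AlgOver B' fun y : T ⊕ S → ℂ => g fun k => y (Sum.inl k) := by
  have hP : AnalyticAt ℂ (fun y : T ⊕ S → ℂ => fun k => y (Sum.inl k)) 0 :=
    AnalyticAt.pi fun _ => analyticAt_coord _ _
  obtain ⟨hg, hgB⟩ := hg
  refine ⟨hg.comp_zero hP rfl, ?_⟩
  refine algClosure_map_mem (pull _ hP rfl) B ?_ ?_ hgB
  · intro φ _ hφ
    obtain ⟨h, hh, rfl⟩ := exists_germOf φ
    rw [pull_germOf, germOf_eq_zero_iff] at hφ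
    rw [germOf_eq_zero_iff]
    have hc : Tendsto (fun t : T → ℂ => (Sum.elim t 0 : T ⊕ S → ℂ)) (𝓝 0) (𝓝 0) := by
      have h1 : Continuous (fun t : T → ℂ => (Sum.elim t 0 : T ⊕ S → ℂ)) := by
        refine continuous_pi fun i => ?_
        rcases i with i | i
        · exact continuous_apply i
        · exact continuous_const
      simpa only [sumElim_zero] using h1.tendsto 0
    filter_upwards [hc.eventually hφ] with t ht using ht
  · exact Subring.map_le_iff_le_comap.2 hB

theorem uRing_le_comap_inl {S : Type} [Fintype S] (f : Fin N' → (Idx n m c → ℂ) → ℂ)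
    (j : Fin c → T) : uRing f j ≤ (uRing f fun i => (Sum.inl (j i) : T ⊕ S)).comap (pull
      (fun y : T ⊕ S → ℂ => fun k => y (Sum.inl k))
        (AnalyticAt.pi fun _ => analyticAt_coord _ _) rfl) := by
  refine Subring.closure_le.2 ?_
  rintro φ (hφ | ⟨L, s, hg, rfl⟩)
  · exact nashRing_le_uRing _ _ (pull_mem_nashRing
      (V := fun (y : T ⊕ S → ℂ) k => y (Sum.inl k)) (fun _ => isNash_coord _) rfl hφ)
  · exact Subring.subset_closure (Or.inr ⟨L, s, hg.comp_zero
      (V := fun (y : T ⊕ S → ℂ) k => y (Sum.inl k))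
      (AnalyticAt.pi fun _ => analyticAt_coord _ _) rfl, rfl⟩)

/-- The move leaves `ζ` alone, so the jets of `f̄(ζ)` stay algebraic, and (♣) carries this over to
the jets of `f` at the new `Z`. The new points lie in `𝓜` because they satisfy the equations solved
for `w`. -/
theorem IsChain.stepMap (hQ : IsNormalForm M Q) {hf : ∀ s, AnalyticAt ℂ (f s) 0}
    (hclub : Club Q f hf) {V : (T → ℂ) → (Idx n m c ⊕ Idx n m c → ℂ)}
    {j : Fin c → T} (h : IsChain Q f V j) :
    IsChain Q f (stepMap Q V) (fun i => (Sum.inl (j i) : T ⊕ Fin n)) := by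
  have hP : Tendsto (fun y : T ⊕ Fin n → ℂ => fun k => y (Sum.inl k)) (𝓝 0) (𝓝 0) :=
    (continuous_pi fun _ => continuous_apply _ : Continuous
        (fun y : T ⊕ Fin n → ℂ => fun i => y (Sum.inl i))).tendsto 0
  have hnash := isNash_stepMap hQ h.nash h.zero
  have hzero := stepMap_zero hQ h.zero
  have hcont : Tendsto (KeyAlg.stepMap Q V) (𝓝 0) (𝓝 0) := by
    simpa only [hzero] using (analyticAt_of_isNash hnash).continuousAt.tendsto
  have hmem : ∀ᶠ y in 𝓝 0, KeyAlg.stepMap Q V y ∈ complexification Q := by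
    filter_upwards [hcont.eventually (eventually_mem_of_sig_mem hQ), hP.eventually h.mem]
      with y h1 h2
    exact h1 (sig_mem_iff.2 ⟨fun l => rfl, h2.2⟩)
  have hzeta : ∀ L s, AlgOver (symRing f fun i => (Sum.inl (j i) : T ⊕ Fin n)) fun y =>
      iterPartial L (conjFun (f s)) fun i => KeyAlg.stepMap Q V y (Sum.inr i) := fun L s =>
    (h.algZeta L s).comp_inl (sup_le
      ((uRing_le_comap_inl f j).trans fun _ hφ => (le_sup_left : _ ≤ symRing f _) hφ)
      ((uRing_le_comap_inl _ j).trans fun _ hφ => (le_sup_right : _ ≤ symRing f _) hφ))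
  exact
  { nash := hnash
    zero := hzero
    mem := hmem
    inj := Sum.inl_injective.comp h.inj
    u_eq := hP.eventually h.u_eq
    algZ := hclub.algOver_Z hQ hnash hzero hmem
      ((nashRing_le_uRing _ _).trans le_sup_left) hzeta
    algZeta := hzeta }

end Chains

theorem _root_.AnalyticAt.clm_apply {𝕜 E F G : Type*} [NontriviallyNormedField 𝕜]
    [NormedAddCommGroup E] [NormedSpace 𝕜 E] [NormedAddCommGroup F] [NormedSpace 𝕜 F]
    [NormedAddCommGroup G] [NormedSpace 𝕜 G] {A : E → F →L[𝕜] G} {v : E → F} {x : E}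
    (hA : AnalyticAt 𝕜 A x) (hv : AnalyticAt 𝕜 v x) : AnalyticAt 𝕜 (fun y => A y (v y)) x :=
  AnalyticAt.comp (f := fun y => (A y, v y)) (x := x)
    ((ContinuousLinearMap.id 𝕜 (F →L[𝕜] G)).analyticAt_bilinear (A x, v x)) (hA.prod hv)

/-! ### Fields that are generically tangent to the image of a holomorphic map -/

section Tangent

variable {E F : Type*} [NormedAddCommGroup E] [NormedSpace ℂ E] [NormedAddCommGroup F]
  [NormedSpace ℂ F]

/-- `y` takes its values, up to division by a nonzero germ, in the image of the derivative
of `V`. -/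
def TangentAlong (V : E → F) (y : E → F) : Prop :=
  ∃ (b : E → ℂ) (a : E → E), AnalyticAt ℂ b 0 ∧ AnalyticAt ℂ a 0 ∧ ¬ b =ᶠ[𝓝 0] 0 ∧
    ∀ᶠ t in 𝓝 0, b t • y t = fderiv ℂ V t (a t)

theorem not_eventuallyEq_zero_mul {b b' : E → ℂ} (hb : AnalyticAt ℂ b 0) (hb' : AnalyticAt ℂ b' 0)
    (h : ¬ b =ᶠ[𝓝 0] 0) (h' : ¬ b' =ᶠ[𝓝 0] 0) : ¬ (fun t => b t * b' t) =ᶠ[𝓝 0] 0 := fun H =>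
  (eventuallyEq_zero_or_of_mul hb hb' H).elim h h'

theorem TangentAlong.add {V y y' : E → F} (h : TangentAlong V y) (h' : TangentAlong V y') :
    TangentAlong V fun t => y t + y' t := by
  obtain ⟨b, a, hb, ha, hb0, h⟩ := h
  obtain ⟨b', a', hb', ha', hb0', h'⟩ := h'
  refine ⟨fun t => b t * b' t, fun t => b' t • a t + b t • a' t, hb.mul hb',
    (hb'.smul ha).add (hb.smul ha'), not_eventuallyEq_zero_mul hb hb' hb0 hb0', ?_⟩
  filter_upwards [h, h'] with t h1 h2
  rw [map_add, map_smul, map_smul, ← h1, ← h2]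
  module

theorem TangentAlong.const_smul {V y : E → F} (h : TangentAlong V y) (k : ℂ) :
    TangentAlong V fun t => k • y t := by
  obtain ⟨b, a, hb, ha, hb0, h⟩ := h
  refine ⟨b, fun t => k • a t, hb, analyticAt_const.smul ha, hb0, ?_⟩
  filter_upwards [h] with t h1
  rw [map_smul, ← h1, smul_comm]

theorem TangentAlong.zero {V : E → F} : TangentAlong V fun _ => 0 :=
  ⟨fun _ => 1, fun _ => 0, analyticAt_const, analyticAt_const,
    fun h => one_ne_zero h.self_of_nhds, by simp⟩

/-- Differentiate `b • (Y ∘ V) = dV(a)` in the direction `a'` and replace `dV(a')` by `b' • y'`. The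
only terms outside the image of `dV` are the second derivative of `V` and a multiple of `Y ∘ V`. -/
theorem tangentAlong_deriv_aux [CompleteSpace E] [CompleteSpace F] {V : E → F} {Y : F → F}
    {a a' : E → E} {b b' : E → ℂ}
    (hV : AnalyticAt ℂ V 0) (hY : AnalyticAt ℂ Y (V 0)) (hb : AnalyticAt ℂ b 0)
    (ha : AnalyticAt ℂ a 0) (h : ∀ᶠ t in 𝓝 0, b t • Y (V t) = fderiv ℂ V t (a t))
    {y' : E → F} (h' : ∀ᶠ t in 𝓝 0, b' t • y' t = fderiv ℂ V t (a' t)) :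
    ∀ᶠ t in 𝓝 0, (b t * b' t) • fderiv ℂ Y (V t) (y' t) =
      fderiv ℂ (fderiv ℂ V) t (a' t) (a t) + fderiv ℂ V t (fderiv ℂ a t (a' t))
        - fderiv ℂ b t (a' t) • Y (V t) := by
  filter_upwards [h.eventually_nhds, h', hV.eventually_analyticAt, hb.eventually_analyticAt,
    ha.eventually_analyticAt, hV.continuousAt.eventually hY.eventually_analyticAt]
    with t h1 h2 h3 h4 h5 h6
  have e1 : HasFDerivAt (fun t => b t • Y (V t)) _ t :=
    h4.differentiableAt.hasFDerivAt.smul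
      (h6.differentiableAt.hasFDerivAt.comp t h3.differentiableAt.hasFDerivAt)
  have e2 : HasFDerivAt (fun t => fderiv ℂ V t (a t)) _ t :=
    h3.fderiv.differentiableAt.hasFDerivAt.clm_apply h5.differentiableAt.hasFDerivAt
  have e3 := e1.unique (e2.congr_of_eventuallyEq h1)
  have e4 := congrArg (fun A : E →L[ℂ] F => A (a' t)) e3
  simp only [add_apply, smul_apply,
    ContinuousLinearMap.comp_apply, ContinuousLinearMap.smulRight_apply,
    ContinuousLinearMap.flip_apply] at e4
  rw [← h2, map_smul, smul_smul] at e4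
  rw [eq_sub_iff_add_eq, add_comm (fderiv ℂ (fderiv ℂ V) t (a' t) (a t)), ← e4]

/-- In the difference of the two directional derivatives the second derivatives of `V` cancel by
symmetry; the remaining terms are in the image of `dV` or multiples of `Y ∘ V` and `Y' ∘ V`. -/
theorem TangentAlong.lieBracket [CompleteSpace E] [CompleteSpace F] {V : E → F} {Y Y' : F → F}
    (hV : AnalyticAt ℂ V 0) (hY : AnalyticAt ℂ Y (V 0)) (hY' : AnalyticAt ℂ Y' (V 0))
    (h : TangentAlong V fun t => Y (V t)) (h' : TangentAlong V fun t => Y' (V t)) :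
    TangentAlong V fun t => VectorField.lieBracket ℂ Y Y' (V t) := by
  obtain ⟨b, a, hb, ha, hb0, h⟩ := h
  obtain ⟨b', a', hb', ha', hb0', h'⟩ := h'
  have hbb := not_eventuallyEq_zero_mul hb hb' hb0 hb0'
  have hDa : AnalyticAt ℂ (fun t => fderiv ℂ a t (a' t)) 0 := AnalyticAt.clm_apply ha.fderiv ha'
  have hDa' : AnalyticAt ℂ (fun t => fderiv ℂ a' t (a t)) 0 := AnalyticAt.clm_apply ha'.fderiv ha
  have hDb : AnalyticAt ℂ (fun t => fderiv ℂ b t (a' t)) 0 := AnalyticAt.clm_apply hb.fderiv ha'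
  have hDb' : AnalyticAt ℂ (fun t => fderiv ℂ b' t (a t)) 0 := AnalyticAt.clm_apply hb'.fderiv ha
  -- One factor `b b'` clears the denominators of the directional derivatives. The second one turns
  -- the leftover multiples of `Y ∘ V` and `Y' ∘ V` into images under `dV`.
  refine ⟨fun t => (b t * b' t) * (b t * b' t), fun t =>
    (b t * b' t) • (fderiv ℂ a' t (a t) - fderiv ℂ a t (a' t)) -
      (fderiv ℂ b' t (a t) * b t) • a' t + (fderiv ℂ b t (a' t) * b' t) • a t,
    (hb.mul hb').mul (hb.mul hb'),
    (((hb.mul hb').smul (hDa'.sub hDa)).sub ((hDb'.mul hb).smul ha')).add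
      ((hDb.mul hb').smul ha), not_eventuallyEq_zero_mul (hb.mul hb') (hb.mul hb') hbb hbb, ?_⟩
  filter_upwards [h, h', tangentAlong_deriv_aux hV hY hb ha h h',
    tangentAlong_deriv_aux hV hY' hb' ha' h' h, hV.eventually_analyticAt] with t h1 h2 h3 h4 h5
  have hsymm : fderiv ℂ (fderiv ℂ V) t (a' t) (a t) = fderiv ℂ (fderiv ℂ V) t (a t) (a' t) :=
    (h5.contDiffAt (n := ⊤)).isSymmSndFDerivAt (by simp) _ _
  have h6 : (b t * b' t) • VectorField.lieBracket ℂ Y Y' (V t) =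
      fderiv ℂ V t (fderiv ℂ a' t (a t) - fderiv ℂ a t (a' t)) - fderiv ℂ b' t (a t) • Y' (V t)
        + fderiv ℂ b t (a' t) • Y (V t) := by
    rw [VectorField.lieBracket_eq, smul_sub, h3, mul_comm, h4, hsymm, map_sub]
    abel
  simp only [mul_smul (b t * b' t) (b t * b' t), h6, map_add, map_sub, map_smul, ← h1, ← h2]
  module

end Tangent

/-! ### Generic rank -/

section Rank

variable {E F : Type*} [NormedAddCommGroup E] [NormedSpace ℂ E] [NormedAddCommGroup F]
  [NormedSpace ℂ F]

/-- The linear map `A` has rank at least `r`. -/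
def RankGE (A : E →L[ℂ] F) (r : ℕ) : Prop :=
  ∃ κ : Fin r → E, LinearIndependent ℂ fun i => A (κ i)

theorem analyticAt_det {r : ℕ} {A : E → Matrix (Fin r) (Fin r) ℂ} {t : E}
    (hA : ∀ i j, AnalyticAt ℂ (fun t => A t i j) t) : AnalyticAt ℂ (fun t => (A t).det) t := by
  simp only [Matrix.det_apply']
  exact Finset.analyticAt_fun_sum _ fun σ _ =>
    analyticAt_const.mul (Finset.analyticAt_fun_prod _ fun i _ => hA _ _)

theorem analyticAt_adjugate {r : ℕ} {A : E → Matrix (Fin r) (Fin r) ℂ} {t : E}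
    (hA : ∀ i j, AnalyticAt ℂ (fun t => A t i j) t) (i j : Fin r) :
    AnalyticAt ℂ (fun t => (A t).adjugate i j) t := by
  simp only [Matrix.adjugate_apply]
  refine analyticAt_det fun k l => ?_
  by_cases h : k = j
  · subst h
    simp only [Matrix.updateRow_self]
    exact analyticAt_const
  · simp only [Matrix.updateRow_ne h]
    exact hA k l

/-- If `V` has generic rank at least `r`, and adding `y` to the image of its derivative does not
give more than `r` independent vectors, then `y` is generically tangent to the image of `V`. -/
theorem tangentAlong_of_rank [CompleteSpace F] [FiniteDimensional ℂ F] {V : E → F} {y : E → F}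
    {r : ℕ}
    (hV : AnalyticAt ℂ V 0) (hy : AnalyticAt ℂ y 0) (hr : ∃ᶠ t in 𝓝 0, RankGE (fderiv ℂ V t) r)
    (hmax : ∀ᶠ t in 𝓝 0, ∀ κ : Fin r → E,
      ¬ LinearIndependent ℂ (Fin.cons (y t) fun i => fderiv ℂ V t (κ i) : Fin (r + 1) → F)) :
    TangentAlong V y := by
  obtain ⟨ρ, hρ, hball⟩ := Metric.eventually_nhds_iff_ball.1 hV.eventually_analyticAt
  obtain ⟨t₀, ⟨κ, hκ⟩, ht₀⟩ := (hr.and_eventually (Metric.ball_mem_nhds 0 hρ)).exists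
  -- A left inverse fixed at the point `t₀` of rank at least `r` replaces the choice of an `r × r`
  -- minor: `A t₀ = 1`, so `det A` is a nonzero analytic germ.
  obtain ⟨ℓ, hℓ⟩ := LinearMap.exists_leftInverse_of_injective
    (Fintype.linearCombination ℂ fun i => fderiv ℂ V t₀ (κ i))
    (LinearMap.ker_eq_bot.2 hκ.fintypeLinearCombination_injective)
  let ℓ' : F →L[ℂ] (Fin r → ℂ) := LinearMap.toContinuousLinearMap ℓ
  let A : E → Matrix (Fin r) (Fin r) ℂ := fun t => Matrix.of fun i j => ℓ' (fderiv ℂ V t (κ j)) i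
  have hA : ∀ t ∈ Metric.ball (0 : E) ρ, ∀ i j, AnalyticAt ℂ (fun t => A t i j) t := by
    intro t ht i j
    exact ((ℓ'.analyticAt _).comp (AnalyticAt.clm_apply (hball t ht).fderiv analyticAt_const)).coord i
  have hdet : AnalyticOnNhd ℂ (fun t => (A t).det) (Metric.ball 0 ρ) := fun t ht =>
    analyticAt_det (hA t ht)
  have h0 : (0 : E) ∈ Metric.ball (0 : E) ρ := Metric.mem_ball_self hρ
  have hA₀ : A t₀ = 1 := by
    ext i j
    have h1 := LinearMap.congr_fun hℓ (Pi.single j 1)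
    rw [LinearMap.comp_apply, Fintype.linearCombination_apply_single, one_smul] at h1
    change ℓ (fderiv ℂ V t₀ (κ j)) i = _
    rw [h1, Matrix.one_apply]
    simp [Pi.single_apply]
  have hb0 : ¬ (fun t => (A t).det) =ᶠ[𝓝 0] 0 := by
    intro h
    let : NormedSpace ℝ E := NormedSpace.restrictScalars ℝ ℂ E
    have h1 := hdet.eqOn_zero_of_preconnected_of_eventuallyEq_zero
      (convex_ball (0 : E) ρ).isPreconnected h0 h ht₀
    simp [hA₀] at h1
  have hx : AnalyticAt ℂ (fun t => ∑ j, ((A t).adjugate.mulVec (ℓ' (y t))) j • κ j) 0 := by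
    refine Finset.analyticAt_fun_sum _ fun j _ => AnalyticAt.smul ?_ analyticAt_const
    simp only [Matrix.mulVec, dotProduct]
    exact Finset.analyticAt_fun_sum _ fun i _ => (analyticAt_adjugate (hA 0 h0) j i).mul
      (((ℓ'.analyticAt _).comp hy).coord i)
  -- Cramer's rule gives `det A • y = dV(Σ (adj A · ℓ y)_j κ_j)` where `det A ≠ 0`. The extra factor
  -- `det A` makes the identity trivially true where `det A = 0` as well.
  refine ⟨fun t => (A t).det * (A t).det, fun t => (A t).det •
    ∑ j, ((A t).adjugate.mulVec (ℓ' (y t))) j • κ j, (hdet 0 h0).mul (hdet 0 h0),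
    (hdet 0 h0).smul hx, not_eventuallyEq_zero_mul (hdet 0 h0) (hdet 0 h0) hb0 hb0, ?_⟩
  filter_upwards [hmax] with t ht
  by_cases hd : (A t).det = 0
  · simp [hd]
  · have hli : LinearIndependent ℂ fun i => fderiv ℂ V t (κ i) := by
      have h1 : LinearIndependent ℂ (A t).col :=
        Matrix.linearIndependent_cols_of_det_ne_zero hd
      exact LinearIndependent.of_comp (ℓ' : F →ₗ[ℂ] (Fin r → ℂ)) h1
    have hspan : y t ∈ Submodule.span ℂ (Set.range fun i => fderiv ℂ V t (κ i)) := by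
      by_contra h
      -- If `y t` were outside the span, it would give `r + 1` independent vectors, against
      -- maximality.
      exact ht κ (linearIndependent_finCons.2 ⟨hli, h⟩)
    obtain ⟨x, hx⟩ := (Submodule.mem_span_range_iff_exists_fun ℂ).1 hspan
    have hℓy : ℓ' (y t) = (A t).mulVec x := by
      rw [← hx, map_sum]
      funext i
      simp [Matrix.mulVec, dotProduct, A, mul_comm]
    rw [hℓy, Matrix.mulVec_mulVec, Matrix.adjugate_mul, Matrix.smul_mulVec, Matrix.one_mulVec,
      map_smul, mul_smul, map_sum, ← hx]
    congr 1
    rw [Finset.smul_sum]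
    refine Finset.sum_congr rfl fun j _ => ?_
    rw [map_smul, Pi.smul_apply, smul_eq_mul, mul_smul]

end Rank

/-! ### A chain of maximal generic rank -/

section MaxRank

variable {n m c N' : ℕ} {M : Set (Idx n m c → ℂ)} {Q : Fin m → (Fin n ⊕ Idx n m c → ℂ) → ℂ}
  {f : Fin N' → (Idx n m c → ℂ) → ℂ} {T : Type} [Fintype T]

/-- The vector field on `𝓜` that is `∂/∂z_k` in the coordinates `(z, ζ)`. -/
def leafField (Q : Fin m → (Fin n ⊕ Idx n m c → ℂ) → ℂ) (k : Fin n)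
    (x : Idx n m c ⊕ Idx n m c → ℂ) : Idx n m c ⊕ Idx n m c → ℂ :=
  Sum.elim (pt (Pi.single k 1) (fun l => fderiv ℂ (Q l)
    (Sum.elim (fun i => x (Sum.inl (Sum.inl i))) fun i => x (Sum.inr i))
      (Pi.single (Sum.inl k) 1)) 0) 0

theorem analyticAt_leafField (hQ : IsNormalForm M Q) (k : Fin n) :
    AnalyticAt ℂ (leafField Q k) 0 := by
  refine AnalyticAt.pi fun i => ?_
  rcases i with (i | i | i) | i
  · exact analyticAt_const
  · have h1 : AnalyticAt ℂ (fun x : Idx n m c ⊕ Idx n m c → ℂ => (Sum.elim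
        (fun i => x (Sum.inl (Sum.inl i))) fun i => x (Sum.inr i) : Fin n ⊕ Idx n m c → ℂ)) 0 := by
      refine AnalyticAt.pi fun i => ?_
      rcases i with i | i <;> exact analyticAt_coord _ _
    exact AnalyticAt.clm_apply ((hQ.algebraic i).1.fderiv.comp_zero h1 sumElim_zero)
      analyticAt_const
  · exact analyticAt_const
  · exact analyticAt_const

theorem tendsto_sumElim_zero {S : Type} :
    Tendsto (fun t : T → ℂ => (Sum.elim t 0 : T ⊕ S → ℂ)) (𝓝 0) (𝓝 0) := by
  have h1 : Continuous (fun t : T → ℂ => (Sum.elim t 0 : T ⊕ S → ℂ)) := by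
    refine continuous_pi fun i => ?_
    rcases i with i | i
    · exact continuous_apply i
    · exact continuous_const
  simpa only [sumElim_zero] using h1.tendsto 0

/-- On `𝓜` the reality condition gives `w = Q(z, ζ)`, so a step of length zero stays in place. Thus
the old derivative reappears in that of the longer chain at `s = 0`. -/
theorem eventually_stepMap_eq (hQ : IsNormalForm M Q)
    {V : (T → ℂ) → (Idx n m c ⊕ Idx n m c → ℂ)} (hV : AnalyticAt ℂ V 0) (hV0 : V 0 = 0)
    (hVM : ∀ᶠ t in 𝓝 0, V t ∈ complexification Q) :
    ∀ᶠ t in 𝓝 0, stepMap Q V (Sum.elim t 0) = V t := by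
  have hc : Tendsto V (𝓝 0) (𝓝 0) := by simpa only [hV0] using hV.continuousAt.tendsto
  filter_upwards [hVM, hc.eventually (eventually_sig_mem hQ)] with t h1 h2
  have h3 := (sig_mem_iff.1 (h2 h1)).1
  ext (i | i)
  · rcases i with i | i | i
    · exact add_zero _
    · refine Eq.trans ?_ (h3 i).symm
      refine congrArg (Q i) ?_
      ext (k | k)
      · exact add_zero _
      · rfl
    · rfl
  · rfl

theorem eventually_fderiv_stepMap_inl (hQ : IsNormalForm M Q)
    {V : (T → ℂ) → (Idx n m c ⊕ Idx n m c → ℂ)} (hV : ∀ i, IsNash fun t => V t i) (hV0 : V 0 = 0)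
    (hVM : ∀ᶠ t in 𝓝 0, V t ∈ complexification Q) :
    ∀ᶠ t in 𝓝 0, ∀ h, fderiv ℂ (stepMap Q V) (Sum.elim t 0) (Sum.elim h 0) = fderiv ℂ V t h := by
  have hS := (analyticAt_of_isNash (isNash_stepMap hQ hV hV0)).eventually_analyticAt
  filter_upwards [(eventually_stepMap_eq hQ (analyticAt_of_isNash hV) hV0 hVM).eventually_nhds,
    tendsto_sumElim_zero.eventually hS] with t h1 h2 h
  let incl : (T → ℂ) →L[ℂ] (T ⊕ Fin n → ℂ) := ContinuousLinearMap.pi fun i =>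
    Sum.elim (fun k => ContinuousLinearMap.proj (R := ℂ) (φ := fun _ : T => ℂ) k) (fun _ => 0) i
  have hincl : ∀ t, incl t = Sum.elim t 0 := by
    intro t; ext (i | i) <;> rfl
  have h3 : HasFDerivAt (stepMap Q V ∘ incl) _ t :=
    HasFDerivAt.comp t (by rw [hincl]; exact h2.differentiableAt.hasFDerivAt) incl.hasFDerivAt
  have h4 : V =ᶠ[𝓝 t] stepMap Q V ∘ incl := by
    filter_upwards [h1] with s hs
    rw [Function.comp_apply, hincl, hs]
  rw [h4.fderiv_eq, h3.fderiv, ContinuousLinearMap.comp_apply, hincl]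

theorem eventually_fderiv_stepMap_inr [DecidableEq T] (hQ : IsNormalForm M Q)
    {V : (T → ℂ) → (Idx n m c ⊕ Idx n m c → ℂ)} (hV : ∀ i, IsNash fun t => V t i) (hV0 : V 0 = 0)
    (k : Fin n) :
    ∀ᶠ t in 𝓝 0, fderiv ℂ (stepMap Q V) (Sum.elim t 0) (Pi.single (Sum.inr k) 1) =
      leafField Q k (V t) := by
  have hS := (analyticAt_of_isNash (isNash_stepMap hQ hV hV0)).eventually_analyticAt
  have hp : Tendsto (fun t => (Sum.elim (fun i => V t (Sum.inl (Sum.inl i)))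
      fun i => V t (Sum.inr i) : Fin n ⊕ Idx n m c → ℂ)) (𝓝 0) (𝓝 0) := by
    have hc := (analyticAt_of_isNash hV).continuousAt
    have h1 : ContinuousAt (fun t => (Sum.elim (fun i => V t (Sum.inl (Sum.inl i)))
      fun i => V t (Sum.inr i) : Fin n ⊕ Idx n m c → ℂ)) 0 := by
      refine continuousAt_pi.2 fun i => ?_
      rcases i with i | i <;> exact continuousAt_pi.1 hc _
    have h2 := h1.tendsto
    rw [hV0] at h2
    have h3 : (Sum.elim (fun i => (0 : Idx n m c ⊕ Idx n m c → ℂ) (Sum.inl (Sum.inl i)))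
      fun i => (0 : Idx n m c ⊕ Idx n m c → ℂ) (Sum.inr i) : Fin n ⊕ Idx n m c → ℂ) = 0 :=
      sumElim_zero
    rwa [h3] at h2
  filter_upwards [tendsto_sumElim_zero.eventually hS, hp.eventually
    (eventually_all.2 fun l => (hQ.algebraic l).1.eventually_analyticAt)] with t h1 h2
  set y₀ : T ⊕ Fin n → ℂ := Sum.elim t 0
  set p : Fin n ⊕ Idx n m c → ℂ := Sum.elim (fun i => V t (Sum.inl (Sum.inl i)))
      fun i => V t (Sum.inr i)
  have hline : ∀ {J : Type} [Fintype J] [DecidableEq J] (a : J → ℂ) (j : J),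
      HasDerivAt (fun s : ℂ => a + s • (Pi.single j 1 : J → ℂ)) (Pi.single j 1) 0 := by
    intro J _ _ a j
    simpa using ((hasDerivAt_id (0 : ℂ)).smul_const (Pi.single j 1 : J → ℂ)).const_add a
  have h3 : HasDerivAt (fun s : ℂ => stepMap Q V (y₀ + s • Pi.single (Sum.inr k) 1))
      (fderiv ℂ (stepMap Q V) y₀ (Pi.single (Sum.inr k) 1)) 0 := by
    have h4 : HasFDerivAt (stepMap Q V) (fderiv ℂ (stepMap Q V) y₀)
        (y₀ + (0 : ℂ) • Pi.single (Sum.inr k) 1) := by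
      simpa using h1.differentiableAt.hasFDerivAt
    exact h4.comp_hasDerivAt (0 : ℂ) (hline y₀ (Sum.inr k))
  refine h3.unique ?_
  have hin : ∀ s : ℂ, (fun k' => (y₀ + s • (Pi.single (Sum.inr k) 1 : T ⊕ Fin n → ℂ))
      (Sum.inl k')) = t := by
    intro s; funext k'; simp [y₀]
  have hir : ∀ (s : ℂ) (i : Fin n), (y₀ + s • (Pi.single (Sum.inr k) 1 : T ⊕ Fin n → ℂ))
      (Sum.inr i) = s * (Pi.single k 1 : Fin n → ℂ) i := by
    intro s i; simp [y₀, Pi.single_apply]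
  refine hasDerivAt_pi.2 fun i => ?_
  rcases i with (i | i | i) | i
  · have h4 : HasDerivAt (fun s : ℂ => V t (Sum.inl (Sum.inl i)) +
        s * (Pi.single k 1 : Fin n → ℂ) i) ((Pi.single k 1 : Fin n → ℂ) i) 0 := by
      simpa using ((hasDerivAt_id (0 : ℂ)).mul_const ((Pi.single k 1 : Fin n → ℂ) i)).const_add
        (V t (Sum.inl (Sum.inl i)))
    refine h4.congr_of_eventuallyEq (Eventually.of_forall fun s => ?_)
    simp only [stepMap, pt, Sum.elim_inl, hin, hir]
  · have h4 : HasDerivAt (fun s : ℂ => Q i (p + s • Pi.single (Sum.inl k) 1))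
        (fderiv ℂ (Q i) p (Pi.single (Sum.inl k) 1)) 0 := by
      have h5 : HasFDerivAt (Q i) (fderiv ℂ (Q i) p)
          (p + (0 : ℂ) • Pi.single (Sum.inl k) 1) := by
        simpa using (h2 i).differentiableAt.hasFDerivAt
      exact h5.comp_hasDerivAt (0 : ℂ) (hline p (Sum.inl k))
    refine h4.congr_of_eventuallyEq (Eventually.of_forall fun s => ?_)
    simp only [stepMap, pt, Sum.elim_inl, Sum.elim_inr, hin, hir]
    refine congrArg (Q i) ?_
    ext (l | l)
    · simp [p, Pi.single_apply]
    · simp [p]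
  · refine (hasDerivAt_const (0 : ℂ) (V t (Sum.inl (Sum.inr (Sum.inr i))))).congr_of_eventuallyEq
      (Eventually.of_forall fun s => ?_)
    simp only [stepMap, pt, Sum.elim_inl, Sum.elim_inr, hin]
  · refine (hasDerivAt_const (0 : ℂ) (V t (Sum.inr i))).congr_of_eventuallyEq
      (Eventually.of_forall fun s => ?_)
    simp only [stepMap, Sum.elim_inr, hin]

theorem sig_add {ι : Type} (x y : ι ⊕ ι → ℂ) : sig (x + y) = sig x + sig y := by
  ext (i | i) <;> simp [sig]

theorem sig_smul {ι : Type} (a : ℂ) (x : ι ⊕ ι → ℂ) : sig (a • x) = star a • sig x := by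
  ext (i | i) <;> simp [sig]

theorem sig_eq_star_swap {ι : Type} (x : ι ⊕ ι → ℂ) : sig x = star (x ∘ Sum.swap) := by
  ext (i | i) <;> rfl

theorem fderiv_conjMap {ι : Type} [Fintype ι] {V : (T → ℂ) → (ι ⊕ ι → ℂ)} {t : T → ℂ}
    (hV : DifferentiableAt ℂ V (star t)) (h : T → ℂ) :
    fderiv ℂ (conjMap V) t h = sig (fderiv ℂ V (star t) (star h)) := by
  let sw : (ι ⊕ ι → ℂ) →L[ℂ] (ι ⊕ ι → ℂ) := ContinuousLinearMap.pi fun i =>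
    ContinuousLinearMap.proj (R := ℂ) (φ := fun _ : ι ⊕ ι => ℂ) i.swap
  have h1 := fderiv_star_conj (fun t => sw (V t)) t h
  have h2 : HasFDerivAt (fun t => sw (V t)) (sw.comp (fderiv ℂ V (star t))) (star t) :=
    sw.hasFDerivAt.comp (star t) hV.hasFDerivAt
  rw [h2.fderiv] at h1
  rw [sig_eq_star_swap]
  have h3 : conjMap V = fun t => star (sw (V (star t))) := by
    funext t; rw [conjMap, sig_eq_star_swap]; rfl
  rw [h3]
  exact h1

/-- The derivative of `conjMap V` is that of `V` with antilinear bijections on both sides, and these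
preserve linear independence. -/
theorem rankGE_conjMap {ι : Type} [Fintype ι] {V : (T → ℂ) → (ι ⊕ ι → ℂ)} {t : T → ℂ} {r : ℕ}
    (hV : DifferentiableAt ℂ V t) (h : RankGE (fderiv ℂ V t) r) :
    RankGE (fderiv ℂ (conjMap V) (star t)) r := by
  obtain ⟨κ, hκ⟩ := h
  refine ⟨fun i => star (κ i), ?_⟩
  have h1 : ∀ i, fderiv ℂ (conjMap V) (star t) (star (κ i)) = sig (fderiv ℂ V t (κ i)) := by
    intro i
    rw [fderiv_conjMap (by rwa [star_star]), star_star, star_star]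
  simp only [h1]
  rw [Fintype.linearIndependent_iff] at hκ ⊢
  intro g hg i
  have h2 := congrArg sig hg
  have h3 : sig (∑ i, g i • sig (fderiv ℂ V t (κ i))) = ∑ i, star (g i) • fderiv ℂ V t (κ i) := by
    have hs : ∀ s : Finset (Fin r), sig (∑ i ∈ s, g i • sig (fderiv ℂ V t (κ i))) =
        ∑ i ∈ s, star (g i) • fderiv ℂ V t (κ i) := by
      intro s
      induction s using Finset.induction_on with
      | empty => simp [sig_zero]
      | insert a s ha ih =>
        rw [Finset.sum_insert ha, Finset.sum_insert ha, sig_add, ih, sig_smul, sig_sig]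
    exact hs _
  rw [h3, sig_zero] at h2
  exact star_eq_zero.1 (hκ _ h2 i)

/-- If moving along the leaves does not increase the generic rank, then the leaves are generically
tangent to the image. -/
theorem tangentAlong_leafField (hQ : IsNormalForm M Q)
    {V : (T → ℂ) → (Idx n m c ⊕ Idx n m c → ℂ)} (hV : ∀ i, IsNash fun t => V t i) (hV0 : V 0 = 0)
    (hVM : ∀ᶠ t in 𝓝 0, V t ∈ complexification Q) {r : ℕ}
    (hr : ∃ᶠ t in 𝓝 0, RankGE (fderiv ℂ V t) r)
    (hmax : ¬ ∃ᶠ y in 𝓝 0, RankGE (fderiv ℂ (stepMap Q V) y) (r + 1)) (k : Fin n) :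
    TangentAlong V fun t => leafField Q k (V t) := by
  classical
  refine tangentAlong_of_rank (analyticAt_of_isNash hV)
    ((analyticAt_leafField hQ k).comp_zero (analyticAt_of_isNash hV) hV0) hr ?_
  rw [not_frequently] at hmax
  filter_upwards [tendsto_sumElim_zero.eventually hmax, eventually_fderiv_stepMap_inl hQ hV hV0 hVM,
    eventually_fderiv_stepMap_inr hQ hV hV0 k] with t h1 h2 h3 κ hκ
  -- At `s = 0` the derivative of the longer chain contains both the derivative of `V` and the leaf
  -- field, the latter as the derivative in the new variable `s_k`.
  refine h1 ⟨Fin.cons (Pi.single (Sum.inr k) 1) fun i => Sum.elim (κ i) 0, ?_⟩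
  convert hκ using 1
  funext i
  refine Fin.cases ?_ (fun i => ?_) i
  · simp only [Fin.cons_zero, h3]
  · simp only [Fin.cons_succ, h2]

theorem TangentAlong.of_conjMap {ι : Type} [Fintype ι] {V : (T → ℂ) → (ι ⊕ ι → ℂ)}
    (hV : AnalyticAt ℂ V 0) {y : (T → ℂ) → (ι ⊕ ι → ℂ)} (h : TangentAlong (conjMap V) y) :
    TangentAlong V fun t => sig (y (star t)) := by
  obtain ⟨b, a, hb, ha, hb0, h⟩ := h
  refine ⟨conjFun b, fun t => star (a (star t)), analyticAt_conjFun hb,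
    AnalyticAt.pi fun i => analyticAt_conjFun (ha.coord i), fun H => hb0 ?_, ?_⟩
  · filter_upwards [tendsto_star_zero.eventually H] with t ht
    simpa [conjFun] using ht
  · filter_upwards [tendsto_star_zero.eventually h, hV.eventually_analyticAt] with t h1 h2
    rw [fderiv_conjMap (by rw [star_star]; exact h2.differentiableAt), star_star] at h1
    rw [conjFun, ← sig_smul, h1, sig_sig]

/-- There is a chain to whose image the leaves of both foliations of `𝓜` are generically
tangent. -/
theorem exists_isChain_tangentAlong (hQ : IsNormalForm M Q) {hf : ∀ s, AnalyticAt ℂ (f s) 0}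
    (hclub : Club Q f hf) :
    ∃ (T : Type) (_ : Fintype T) (V : (T → ℂ) → (Idx n m c ⊕ Idx n m c → ℂ)) (j : Fin c → T),
      IsChain Q f V j ∧ (∀ k, TangentAlong V fun t => leafField Q k (V t)) ∧
        ∀ k, TangentAlong V fun t => sig (leafField Q k (sig (V t))) := by
  classical
  -- The generic rank of a chain is bounded by the dimension of the target, however many parameters
  -- it has, so a maximal value exists.
  let P : ℕ → Prop := fun r => ∃ (T : Type) (_ : Fintype T)
    (V : (T → ℂ) → (Idx n m c ⊕ Idx n m c → ℂ)) (j : Fin c → T), IsChain Q f V j ∧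
      ∃ᶠ t in 𝓝 0, RankGE (fderiv ℂ V t) r
  have hP0 : P 0 := ⟨Fin c, inferInstance, _, _, isChain_baseMap hQ hf,
    (Eventually.of_forall fun t => ⟨Fin.elim0, linearIndependent_empty_type⟩).frequently⟩
  have hbound : ∀ r, P r → r ≤ Fintype.card (Idx n m c ⊕ Idx n m c) := by
    rintro r ⟨T, _, V, j, -, h⟩
    obtain ⟨t, κ, hκ⟩ := h.exists
    simpa using hκ.fintype_card_le_finrank
  set K := Fintype.card (Idx n m c ⊕ Idx n m c)
  have hspec : P (Nat.findGreatest P K) := Nat.findGreatest_spec (Nat.zero_le _) hP0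
  have hmax : ¬ P (Nat.findGreatest P K + 1) := fun h =>
    absurd (Nat.le_findGreatest (hbound _ h) h) (by omega)
  obtain ⟨T, _, V, j, hV, hr⟩ := hspec
  have key : ∀ V : (T → ℂ) → (Idx n m c ⊕ Idx n m c → ℂ), IsChain Q f V j →
      (∃ᶠ t in 𝓝 0, RankGE (fderiv ℂ V t) (Nat.findGreatest P K)) →
      ∀ k, TangentAlong V fun t => leafField Q k (V t) := fun V hV hr k =>
    tangentAlong_leafField hQ hV.nash hV.zero hV.mem hr
      (fun h => hmax ⟨_, inferInstance, _, _, hV.stepMap hQ hclub, h⟩) k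
  refine ⟨T, _, V, j, hV, key V hV hr, fun k => ?_⟩
  -- The conjugate chain also attains the maximal rank. The leaf fields of the first foliation along
  -- it become, after conjugation, those of the second foliation along `V`.
  have hr' : ∃ᶠ t in 𝓝 0, RankGE (fderiv ℂ (conjMap V) t) (Nat.findGreatest P K) := by
    refine tendsto_star_zero.frequently ((hr.and_eventually
      hV.analyticAt.eventually_analyticAt).mono fun t ht => ?_)
    exact rankGE_conjMap ht.2.differentiableAt ht.1
  have h := (key (conjMap V) (hV.conjMap hQ) hr' k).of_conjMap hV.analyticAt
  simpa only [conjMap, star_star] using h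

end MaxRank

/-! ### From real fields on `M` to holomorphic fields tangent to the image of a chain -/

section RealFields

variable {n m c N' : ℕ} {M : Set (Idx n m c → ℂ)} {Q : Fin m → (Fin n ⊕ Idx n m c → ℂ) → ℂ}
  {f : Fin N' → (Idx n m c → ℂ) → ℂ} {T : Type} [Fintype T]
  {V : (T → ℂ) → (Idx n m c ⊕ Idx n m c → ℂ)}

/-- The index of the coordinate `u_i`. -/
abbrev uIdx (i : Fin c) : Idx n m c := Sum.inr (Sum.inr i)

/-- The index of the coordinate `w_i`. -/
abbrev wIdx (i : Fin m) : Idx n m c := Sum.inr (Sum.inl i)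

variable (V) in
/-- The holomorphic vector fields that are generically tangent to the image of `V` and do not
involve `∂/∂u`. -/
structure IsTangentField (Y : (Idx n m c ⊕ Idx n m c → ℂ) → (Idx n m c ⊕ Idx n m c → ℂ)) :
    Prop where
  analytic : AnalyticAt ℂ Y 0
  tangent : TangentAlong V fun t => Y (V t)
  u_eq : ∀ᶠ x in 𝓝 0, ∀ i, Y x (Sum.inl (uIdx i)) = 0

theorem IsTangentField.add {Y Y' : (Idx n m c ⊕ Idx n m c → ℂ) → (Idx n m c ⊕ Idx n m c → ℂ)}
    (h : IsTangentField V Y) (h' : IsTangentField V Y') :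
    IsTangentField V fun x => Y x + Y' x where
  analytic := h.analytic.add h'.analytic
  tangent := h.tangent.add h'.tangent
  u_eq := by
    filter_upwards [h.u_eq, h'.u_eq] with x h1 h2 i
    rw [Pi.add_apply, h1, h2, add_zero]

theorem IsTangentField.const_smul
    {Y : (Idx n m c ⊕ Idx n m c → ℂ) → (Idx n m c ⊕ Idx n m c → ℂ)}
    (h : IsTangentField V Y) (a : ℂ) : IsTangentField V fun x => a • Y x where
  analytic := (analyticAt_const (v := a)).smul h.analytic
  tangent := h.tangent.const_smul a
  u_eq := by
    filter_upwards [h.u_eq] with x h1 i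
    rw [Pi.smul_apply, h1, smul_zero]

theorem isTangentField_zero : IsTangentField (n := n) (m := m) (c := c) V fun _ => 0 :=
  ⟨analyticAt_const, TangentAlong.zero, Eventually.of_forall fun _ _ => rfl⟩

theorem isTangentField_sum {κ : Type} (s : Finset κ) (a : κ → ℂ)
    {Y : κ → (Idx n m c ⊕ Idx n m c → ℂ) → (Idx n m c ⊕ Idx n m c → ℂ)}
    (h : ∀ i, IsTangentField V (Y i)) : IsTangentField V fun x => ∑ i ∈ s, a i • Y i x := by
  classical
  induction s using Finset.induction_on with
  | empty => simpa using isTangentField_zero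
  | insert i s hi ih =>
    simp only [Finset.sum_insert hi]
    exact ((h i).const_smul (a i)).add ih

theorem IsTangentField.lieBracket
    {Y Y' : (Idx n m c ⊕ Idx n m c → ℂ) → (Idx n m c ⊕ Idx n m c → ℂ)}
    (hV : AnalyticAt ℂ V 0) (hV0 : V 0 = 0) (h : IsTangentField V Y) (h' : IsTangentField V Y') :
    IsTangentField V (VectorField.lieBracket ℂ Y Y') where
  analytic := by
    have h1 : AnalyticAt ℂ (fun x => fderiv ℂ Y' x (Y x) - fderiv ℂ Y x (Y' x)) 0 :=
      (AnalyticAt.clm_apply h'.analytic.fderiv h.analytic).sub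
        (AnalyticAt.clm_apply h.analytic.fderiv h'.analytic)
    exact h1
  tangent := TangentAlong.lieBracket hV (by rw [hV0]; exact h.analytic)
    (by rw [hV0]; exact h'.analytic) h.tangent h'.tangent
  u_eq := by
    have key : ∀ {Y : (Idx n m c ⊕ Idx n m c → ℂ) → (Idx n m c ⊕ Idx n m c → ℂ)},
        IsTangentField V Y → ∀ᶠ x in 𝓝 0, ∀ v i, fderiv ℂ Y x v (Sum.inl (uIdx i)) = 0 := by
      intro Y h
      filter_upwards [h.u_eq.eventually_nhds, h.analytic.eventually_analyticAt] with x h1 h2 v i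
      have h3 := fderiv_apply h2.differentiableAt (Sum.inl (uIdx i))
      have h4 : (fun x => Y x (Sum.inl (uIdx i))) =ᶠ[𝓝 x] fun _ => 0 := by
        filter_upwards [h1] with y hy using hy i
      rw [h4.fderiv_eq, fderiv_fun_const] at h3
      exact (congrArg (fun A : (Idx n m c ⊕ Idx n m c → ℂ) →L[ℂ] ℂ => A v) h3).symm
    filter_upwards [key h, key h'] with x h1 h2 i
    change fderiv ℂ Y' x (Y x) (Sum.inl (uIdx i)) - fderiv ℂ Y x (Y' x) (Sum.inl (uIdx i)) = 0
    rw [h1, h2, sub_zero]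

theorem analyticAt_sig_conj {ι : Type} [Fintype ι] {Y : (ι ⊕ ι → ℂ) → (ι ⊕ ι → ℂ)}
    (hY : AnalyticAt ℂ Y 0) : AnalyticAt ℂ (fun x => sig (Y (sig x))) 0 := by
  have hsw : AnalyticAt ℂ (fun x : ι ⊕ ι → ℂ => x ∘ Sum.swap) 0 :=
    AnalyticAt.pi fun i => analyticAt_coord _ _
  refine AnalyticAt.pi fun i => ?_
  have h : ∀ i, AnalyticAt ℂ (fun x => conjFun (fun x => Y x i) (x ∘ Sum.swap)) 0 := fun i =>
    (analyticAt_conjFun (hY.coord i)).comp_zero hsw rfl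
  have he : ∀ x : ι ⊕ ι → ℂ, sig x = star (x ∘ Sum.swap) := sig_eq_star_swap
  rcases i with i | i
  · refine (h (Sum.inr i)).congr (Eventually.of_forall fun x => ?_)
    change _ = sig (Y (sig x)) _
    rw [he x]; rfl
  · refine (h (Sum.inl i)).congr (Eventually.of_forall fun x => ?_)
    change _ = sig (Y (sig x)) _
    rw [he x]; rfl

/-- The embedding `Z ↦ (Z, Z̄)`. -/
def dlt {ι : Type} (v : ι → ℂ) : ι ⊕ ι → ℂ := Sum.elim v (star v)

theorem sig_dlt {ι : Type} (v : ι → ℂ) : sig (dlt v) = dlt v := by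
  ext (i | i) <;> simp [sig, dlt]

theorem dlt_zero {ι : Type} : dlt (0 : ι → ℂ) = 0 := by
  ext (i | i) <;> simp [dlt]

/-- The real-linear embedding `Z ↦ (Z, Z̄)`. -/
def dltL (ι : Type) : (ι → ℂ) →L[ℝ] (ι ⊕ ι → ℂ) :=
  ContinuousLinearMap.pi (Sum.elim (fun i => ContinuousLinearMap.proj (R := ℝ) i)
    (fun i => (Complex.conjCLE : ℂ →L[ℝ] ℂ).comp (ContinuousLinearMap.proj (R := ℝ) i)))

theorem dltL_apply {ι : Type} (v : ι → ℂ) : dltL ι v = dlt v := by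
  ext (i | i) <;> rfl

theorem tendsto_dlt {ι : Type} : Tendsto (dlt : (ι → ℂ) → _) (𝓝 0) (𝓝 0) := by
  have h := (dltL ι).continuous.tendsto 0
  rw [map_zero] at h
  exact h.congr dltL_apply

variable (V M) in
/-- `G` is, on `M` near `0`, a combination of tangent fields with real-analytic coefficients. -/
def IsCombination (G : (Idx n m c → ℂ) → (Idx n m c ⊕ Idx n m c → ℂ)) : Prop :=
  ∃ (κ : Type) (_ : Fintype κ) (a : κ → (Idx n m c → ℂ) → ℂ)
    (Y : κ → (Idx n m c ⊕ Idx n m c → ℂ) → (Idx n m c ⊕ Idx n m c → ℂ)),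
    (∀ i, AnalyticAt ℝ (a i) 0) ∧ (∀ i, IsTangentField V (Y i)) ∧
      ∀ᶠ Z in 𝓝[M] 0, G Z = ∑ i, a i Z • Y i (dlt Z)

theorem IsCombination.add {G G' : (Idx n m c → ℂ) → (Idx n m c ⊕ Idx n m c → ℂ)}
    (h : IsCombination M V G) (h' : IsCombination M V G') :
    IsCombination M V fun Z => G Z + G' Z := by
  obtain ⟨κ, _, a, Y, ha, hY, h⟩ := h
  obtain ⟨κ', _, a', Y', ha', hY', h'⟩ := h'
  refine ⟨κ ⊕ κ', inferInstance, Sum.elim a a', Sum.elim Y Y', ?_, ?_, ?_⟩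
  · rintro (i | i)
    exacts [ha i, ha' i]
  · rintro (i | i)
    exacts [hY i, hY' i]
  · filter_upwards [h, h'] with Z h1 h2
    rw [h1, h2, Fintype.sum_sum_type]
    rfl

theorem IsCombination.smul {G : (Idx n m c → ℂ) → (Idx n m c ⊕ Idx n m c → ℂ)}
    (h : IsCombination M V G) {b : (Idx n m c → ℂ) → ℂ} (hb : AnalyticAt ℝ b 0) :
    IsCombination M V fun Z => b Z • G Z := by
  obtain ⟨κ, _, a, Y, ha, hY, h⟩ := h
  refine ⟨κ, inferInstance, fun i Z => b Z * a i Z, Y, fun i => hb.mul (ha i), hY, ?_⟩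
  filter_upwards [h] with Z h1
  rw [h1, Finset.smul_sum]
  exact Finset.sum_congr rfl fun i _ => (mul_smul _ _ _).symm

theorem isCombination_field {Y : (Idx n m c ⊕ Idx n m c → ℂ) → (Idx n m c ⊕ Idx n m c → ℂ)}
    (hY : IsTangentField V Y) : IsCombination M V fun Z => Y (dlt Z) :=
  ⟨Unit, inferInstance, fun _ _ => 1, fun _ => Y, fun _ => analyticAt_const, fun _ => hY,
    Eventually.of_forall fun Z => by simp⟩

theorem IsCombination.congr {G G' : (Idx n m c → ℂ) → (Idx n m c ⊕ Idx n m c → ℂ)}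
    (h : IsCombination M V G) (hG : ∀ᶠ Z in 𝓝[M] 0, G' Z = G Z) : IsCombination M V G' := by
  obtain ⟨κ, _, a, Y, ha, hY, h⟩ := h
  refine ⟨κ, inferInstance, a, Y, ha, hY, ?_⟩
  filter_upwards [h, hG] with Z h1 h2
  rw [h2, h1]

theorem isCombination_sum {κ : Type} (s : Finset κ)
    {G : κ → (Idx n m c → ℂ) → (Idx n m c ⊕ Idx n m c → ℂ)}
    (h : ∀ i, IsCombination M V (G i)) : IsCombination M V fun Z => ∑ i ∈ s, G i Z := by
  classical
  induction s using Finset.induction_on with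
  | empty =>
    simpa using isCombination_field (M := M) (isTangentField_zero (V := V))
  | insert i s hi ih =>
    simp only [Finset.sum_insert hi]
    exact (h i).add ih

variable (V M) in
/-- The properties of the elements of the Lie algebra generated by the sections of the complex
tangent bundle of `M`. -/
structure IsCRField (X : (Idx n m c → ℂ) → (Idx n m c → ℂ)) : Prop where
  analytic : AnalyticAt ℝ X 0
  tangent : ∀ g : (Idx n m c → ℂ) → ℂ, AnalyticAt ℝ g 0 → (∀ᶠ Z in 𝓝[M] 0, g Z = 0) →
    ∀ᶠ Z in 𝓝[M] 0, fderiv ℝ g Z (X Z) = 0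
  comb : IsCombination M V fun Z => dlt (X Z)

theorem IsCRField.tangent_pi {X : (Idx n m c → ℂ) → (Idx n m c → ℂ)} (h : IsCRField M V X)
    {ι : Type} [Fintype ι] {g : (Idx n m c → ℂ) → ι → ℂ} (hg : AnalyticAt ℝ g 0)
    (hg0 : ∀ᶠ Z in 𝓝[M] 0, g Z = 0) : ∀ᶠ Z in 𝓝[M] 0, fderiv ℝ g Z (X Z) = 0 := by
  have hgi : ∀ i, AnalyticAt ℝ (fun Z => g Z i) 0 := fun i =>
    ((ContinuousLinearMap.proj (R := ℝ) (φ := fun _ : ι => ℂ) i).analyticAt _).comp hg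
  have h1 : ∀ᶠ Z in 𝓝[M] 0, ∀ i, fderiv ℝ (fun Z => g Z i) Z (X Z) = 0 :=
    eventually_all.2 fun i => h.tangent _ (hgi i) (hg0.mono fun Z hZ => congrFun hZ i)
  filter_upwards [h1, nhdsWithin_le_nhds hg.eventually_analyticAt] with Z h2 h3
  funext i
  have h4 := h2 i
  rw [fderiv_apply h3.differentiableAt] at h4
  exact h4

theorem IsCRField.add {X X' : (Idx n m c → ℂ) → (Idx n m c → ℂ)} (h : IsCRField M V X)
    (h' : IsCRField M V X') : IsCRField M V (X + X') where
  analytic := h.analytic.add h'.analytic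
  tangent g hg hg0 := by
    filter_upwards [h.tangent g hg hg0, h'.tangent g hg hg0] with Z h1 h2
    rw [Pi.add_apply, map_add, h1, h2, add_zero]
  comb := (h.comb.add h'.comb).congr (Eventually.of_forall fun Z => by
    simp only [← dltL_apply, Pi.add_apply, map_add])

theorem IsCRField.smul {X : (Idx n m c → ℂ) → (Idx n m c → ℂ)} (h : IsCRField M V X) (a : ℝ) :
    IsCRField M V (a • X) where
  analytic := analyticAt_const.smul h.analytic
  tangent g hg hg0 := by
    filter_upwards [h.tangent g hg hg0] with Z h1
    rw [Pi.smul_apply, map_smul, h1, smul_zero]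
  comb := (h.comb.smul (b := fun _ => (a : ℂ)) analyticAt_const).congr
    (Eventually.of_forall fun Z => by
      simp only [← dltL_apply, Pi.smul_apply, map_smul]
      rw [Complex.coe_smul])

theorem fderiv_combination {κ : Type} [Fintype κ] {ι : Type} [Fintype ι]
    {a : κ → (ι → ℂ) → ℂ} {Y : κ → (ι ⊕ ι → ℂ) → (ι ⊕ ι → ℂ)} {Z : ι → ℂ}
    (ha : ∀ i, DifferentiableAt ℝ (a i) Z) (hY : ∀ i, DifferentiableAt ℂ (Y i) (dlt Z))
    (v : ι → ℂ) :
    HasFDerivAt (fun Z => ∑ i, a i Z • Y i (dlt Z))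
      (fderiv ℝ (fun Z => ∑ i, a i Z • Y i (dlt Z)) Z) Z ∧
    fderiv ℝ (fun Z => ∑ i, a i Z • Y i (dlt Z)) Z v =
      ∑ i, (fderiv ℝ (a i) Z v • Y i (dlt Z) + a i Z • fderiv ℂ (Y i) (dlt Z) (dlt v)) := by
  have hY' : ∀ i, HasFDerivAt (fun Z => Y i (dlt Z))
      (((fderiv ℂ (Y i) (dlt Z)).restrictScalars ℝ).comp (dltL ι)) Z := fun i => by
    have h1 : HasFDerivAt (Y i) ((fderiv ℂ (Y i) (dlt Z)).restrictScalars ℝ) (dltL ι Z) := by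
      rw [dltL_apply]
      exact (hY i).hasFDerivAt.restrictScalars ℝ
    exact (h1.comp Z (dltL ι).hasFDerivAt).congr_of_eventuallyEq
      (Eventually.of_forall fun Z => by simp only [Function.comp_apply, dltL_apply])
  have h := HasFDerivAt.fun_sum (u := Finset.univ) fun i _ =>
    (ha i).hasFDerivAt.smul (hY' i)
  refine ⟨h.differentiableAt.hasFDerivAt, ?_⟩
  refine (congrArg (fun A : (ι → ℂ) →L[ℝ] (ι ⊕ ι → ℂ) => A v) h.fderiv).trans ?_
  simp only [sum_apply, add_apply, smul_apply,
    ContinuousLinearMap.smulRight_apply, ContinuousLinearMap.comp_apply,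
    ContinuousLinearMap.coe_restrictScalars', dltL_apply]
  exact Finset.sum_congr rfl fun i _ => add_comm _ _

/-- The expansion of `dlt (X' Z)` holds only on `M`, but `X` is tangent to `M`, so it may be
differentiated along `X`. As each `Y' i` is holomorphic, its derivative along `X` is the complex
derivative applied to `dlt (X Z)`, which is in turn expanded in the `Y j`. -/
theorem IsCRField.eventually_fderiv {X X' : (Idx n m c → ℂ) → (Idx n m c → ℂ)}
    (h : IsCRField M V X) (h' : IsCRField M V X')
    {κ κ' : Type} [Fintype κ] [Fintype κ'] {a : κ → (Idx n m c → ℂ) → ℂ}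
    {Y : κ → (Idx n m c ⊕ Idx n m c → ℂ) → (Idx n m c ⊕ Idx n m c → ℂ)}
    {a' : κ' → (Idx n m c → ℂ) → ℂ}
    {Y' : κ' → (Idx n m c ⊕ Idx n m c → ℂ) → (Idx n m c ⊕ Idx n m c → ℂ)}
    (ha' : ∀ i, AnalyticAt ℝ (a' i) 0) (hY' : ∀ i, IsTangentField V (Y' i))
    (hX : ∀ᶠ Z in 𝓝[M] 0, dlt (X Z) = ∑ i, a i Z • Y i (dlt Z))
    (hX' : ∀ᶠ Z in 𝓝[M] 0, dlt (X' Z) = ∑ i, a' i Z • Y' i (dlt Z)) :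
    ∀ᶠ Z in 𝓝[M] 0, dlt (fderiv ℝ X' Z (X Z)) =
      (∑ i, fderiv ℝ (a' i) Z (X Z) • Y' i (dlt Z)) +
        ∑ i, ∑ j, (a' i Z * a j Z) • fderiv ℂ (Y' i) (dlt Z) (Y j (dlt Z)) := by
  have hda : ∀ᶠ Z in 𝓝 (0 : Idx n m c → ℂ), ∀ i, DifferentiableAt ℝ (a' i) Z :=
    eventually_all.2 fun i => (ha' i).eventually_analyticAt.mono fun Z hZ => hZ.differentiableAt
  have hdY : ∀ᶠ Z in 𝓝 (0 : Idx n m c → ℂ), ∀ i, DifferentiableAt ℂ (Y' i) (dlt Z) :=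
    eventually_all.2 fun i => tendsto_dlt.eventually
      ((hY' i).analytic.eventually_analyticAt.mono fun Z hZ => hZ.differentiableAt)
  have hg : AnalyticAt ℝ (fun Z => dltL (Idx n m c) (X' Z) - ∑ i, a' i Z • Y' i (dltL (Idx n m c) Z)) 0 := by
    refine AnalyticAt.sub (((dltL (Idx n m c)).analyticAt _).comp h'.analytic) ?_
    refine Finset.analyticAt_fun_sum _ fun i _ => (ha' i).smul ?_
    have h1 : AnalyticAt ℝ (Y' i) (dltL (Idx n m c) 0) := by
      rw [map_zero]; exact (hY' i).analytic.restrictScalars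
    exact h1.comp ((dltL (Idx n m c)).analyticAt 0)
  have h0 := h.tangent_pi hg (by
    filter_upwards [hX'] with Z hZ
    simp only [dltL_apply]
    rw [hZ, sub_self])
  filter_upwards [h0, hX, nhdsWithin_le_nhds hda, nhdsWithin_le_nhds hdY,
    nhdsWithin_le_nhds h'.analytic.eventually_analyticAt] with Z h1 h2 h3 h4 h5
  obtain ⟨h6, h7⟩ := fderiv_combination h3 h4 (X Z)
  have h8 : HasFDerivAt (fun Z => dltL (Idx n m c) (X' Z)) _ Z :=
    (dltL (Idx n m c)).hasFDerivAt.comp Z h5.differentiableAt.hasFDerivAt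
  have h9 := (h8.sub h6).fderiv
  have h10 : (fun Z => dltL (Idx n m c) (X' Z) - ∑ i, a' i Z • Y' i (dltL (Idx n m c) Z)) =
      fun Z => dltL (Idx n m c) (X' Z) - ∑ i, a' i Z • Y' i (dlt Z) := by
    funext Z; simp only [dltL_apply]
  rw [h10] at h1
  have h11 := (congrArg (fun A : (Idx n m c → ℂ) →L[ℝ] _ => A (X Z)) h9).symm.trans h1
  simp only [sub_apply, ContinuousLinearMap.comp_apply, dltL_apply] at h11
  rw [h7, sub_eq_zero] at h11
  rw [h11, Finset.sum_add_distrib]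
  congr 1
  refine Finset.sum_congr rfl fun i _ => ?_
  rw [h2, map_sum, Finset.smul_sum]
  refine Finset.sum_congr rfl fun j _ => ?_
  rw [map_smul, smul_smul]

/-- Tangency survives because `dg(X)` and `dg(X')` again vanish on `M` whenever `g` does. For the
expansion, brackets of combinations give derivatives of coefficients times the old fields, plus
products of coefficients times holomorphic brackets. -/
theorem IsCRField.lieBracket (hV : AnalyticAt ℂ V 0) (hV0 : V 0 = 0)
    {X X' : (Idx n m c → ℂ) → (Idx n m c → ℂ)}
    (h : IsCRField M V X) (h' : IsCRField M V X') :
    IsCRField M V (VectorField.lieBracket ℝ X X') where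
  analytic := by
    have h1 : AnalyticAt ℝ (fun x => fderiv ℝ X' x (X x) - fderiv ℝ X x (X' x)) 0 :=
      (AnalyticAt.clm_apply h'.analytic.fderiv h.analytic).sub
        (AnalyticAt.clm_apply h.analytic.fderiv h'.analytic)
    exact h1
  tangent g hg hg0 := by
    have h1 := h.tangent _ (AnalyticAt.clm_apply hg.fderiv h'.analytic) (h'.tangent g hg hg0)
    have h2 := h'.tangent _ (AnalyticAt.clm_apply hg.fderiv h.analytic) (h.tangent g hg hg0)
    filter_upwards [h1, h2, nhdsWithin_le_nhds hg.eventually_analyticAt,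
      nhdsWithin_le_nhds h.analytic.eventually_analyticAt,
      nhdsWithin_le_nhds h'.analytic.eventually_analyticAt] with Z h1 h2 h3 h4 h5
    rw [VectorField.fderiv_apply_lieBracket (n := ⊤) h3.contDiffAt (by simp) h5.differentiableAt
      h4.differentiableAt, h1, h2, sub_zero]
  comb := by
    obtain ⟨κ, _, a, Y, ha, hY, hX⟩ := h.comb
    obtain ⟨κ', _, a', Y', ha', hY', hX'⟩ := h'.comb
    have h1 := h.eventually_fderiv h' ha' hY' hX hX'
    have h2 := h'.eventually_fderiv h ha hY hX' hX
    have hc1 : IsCombination M V fun Z => ∑ i, fderiv ℝ (a' i) Z (X Z) • Y' i (dlt Z) :=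
      isCombination_sum _ fun i => (isCombination_field (hY' i)).smul
        (AnalyticAt.clm_apply (ha' i).fderiv h.analytic)
    have hc2 : IsCombination M V fun Z => ∑ i, (-fderiv ℝ (a i) Z (X' Z)) • Y i (dlt Z) :=
      isCombination_sum _ fun i => (isCombination_field (hY i)).smul
        (AnalyticAt.clm_apply (ha i).fderiv h'.analytic).neg
    have hc3 : IsCombination M V fun Z => ∑ i, ∑ j, (a' i Z * a j Z) •
        VectorField.lieBracket ℂ (Y j) (Y' i) (dlt Z) :=
      isCombination_sum _ fun i => isCombination_sum _ fun j =>
        (isCombination_field ((hY j).lieBracket hV hV0 (hY' i))).smul ((ha' i).mul (ha j))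
    refine ((hc1.add hc2).add hc3).congr ?_
    filter_upwards [h1, h2] with Z h3 h4
    rw [VectorField.lieBracket_eq]
    rw [← dltL_apply, map_sub, dltL_apply, dltL_apply, h3, h4]
    rw [Finset.sum_comm (s := (Finset.univ : Finset κ))]
    simp only [VectorField.lieBracket_eq, smul_sub, Finset.sum_sub_distrib, neg_smul,
      Finset.sum_neg_distrib, mul_comm]
    abel

end RealFields

/-! ### The values at `0` of the fields, and generic submersivity of the chain -/

section Orbits

variable {n m c N' : ℕ} {M : Set (Idx n m c → ℂ)} {Q : Fin m → (Fin n ⊕ Idx n m c → ℂ) → ℂ}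
  {f : Fin N' → (Idx n m c → ℂ) → ℂ} {T : Type} [Fintype T]
  {V : (T → ℂ) → (Idx n m c ⊕ Idx n m c → ℂ)}

/-- Within `M`, `g` also has derivative `0`, and derivatives within a set agree on its tangent cone.
-/
theorem fderiv_eq_zero_of_mem_tangentConeAt {E F : Type*} [NormedAddCommGroup E] [NormedSpace ℝ E]
    [NormedAddCommGroup F] [NormedSpace ℝ F] {M : Set E} {g : E → F} {p v : E}
    (hg : DifferentiableAt ℝ g p) (h0 : ∀ᶠ Z in 𝓝[M] p, g Z = 0) (hp : p ∈ M)
    (hv : v ∈ tangentConeAt ℝ M p) : fderiv ℝ g p v = 0 := by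
  have h1 : HasFDerivWithinAt g (0 : E →L[ℝ] F) M p :=
    (hasFDerivWithinAt_const (0 : F) p M).congr_of_eventuallyEq h0 (h0.self_of_nhdsWithin hp)
  exact hg.hasFDerivAt.hasFDerivWithinAt.unique_on h1 hv

/-- The real-linear map `Z ↦ (z, Z̄)`. -/
def argL (n m c : ℕ) : (Idx n m c → ℂ) →L[ℝ] (Fin n ⊕ Idx n m c → ℂ) :=
  ContinuousLinearMap.pi (Sum.elim (fun i => ContinuousLinearMap.proj (R := ℝ) (Sum.inl i))
    (fun i => (Complex.conjCLE : ℂ →L[ℝ] ℂ).comp (ContinuousLinearMap.proj (R := ℝ) i)))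

theorem argL_apply (Z : Idx n m c → ℂ) : argL n m c Z = Sum.elim (zPart Z) (star Z) := by
  ext (i | i) <;> rfl

/-- The defining function `w_l - Q_l(z, Z̄)` of `M`. -/
def wDef (Q : Fin m → (Fin n ⊕ Idx n m c → ℂ) → ℂ) (l : Fin m) (Z : Idx n m c → ℂ) : ℂ :=
  Z (wIdx l) - Q l (argL n m c Z)

theorem analyticAt_wDef (hQ : IsNormalForm M Q) (l : Fin m) : AnalyticAt ℝ (wDef Q l) 0 := by
  have h1 : AnalyticAt ℝ (Q l) (argL n m c 0) := by
    rw [map_zero]; exact (hQ.algebraic l).1.restrictScalars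
  exact ((analyticAt_coord (wIdx l) 0).restrictScalars).sub (h1.comp ((argL n m c).analyticAt 0))

theorem eventually_wDef_eq_zero (hQ : IsNormalForm M Q) :
    ∀ᶠ Z in 𝓝[M] 0, ∀ l, wDef Q l Z = 0 := by
  rw [eventually_nhdsWithin_iff]
  filter_upwards [hQ.mem_iff] with Z hZ hZM l
  rw [wDef, argL_apply, ← (hZ.1 hZM).1 l]
  exact sub_self _

theorem tendsto_argL : Tendsto (argL n m c) (𝓝 0) (𝓝 0) := by
  simpa using (argL n m c).continuous.tendsto 0

theorem fderiv_wDef {l : Fin m} {Z : Idx n m c → ℂ} (h : DifferentiableAt ℂ (Q l) (argL n m c Z))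
    (v : Idx n m c → ℂ) :
    fderiv ℝ (wDef Q l) Z v = v (wIdx l) - fderiv ℂ (Q l) (argL n m c Z) (argL n m c v) := by
  have h1 : HasFDerivAt (fun Z : Idx n m c → ℂ => Z (wIdx l))
      (ContinuousLinearMap.proj (R := ℝ) (φ := fun _ : Idx n m c => ℂ) (wIdx l)) Z :=
    (ContinuousLinearMap.proj (R := ℝ) (φ := fun _ : Idx n m c => ℂ) (wIdx l)).hasFDerivAt
  have h2 := (h.hasFDerivAt.restrictScalars ℝ).comp Z (argL n m c).hasFDerivAt
  have h3 : HasFDerivAt (wDef Q l) _ Z := h1.sub h2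
  rw [h3.fderiv]
  rfl

theorem argL_I_smul (v : Idx n m c → ℂ) :
    argL n m c (Complex.I • v) = Complex.I • (Sum.elim (zPart v) (-star v) : _ → ℂ) := by
  rw [argL_apply]
  ext (i | i) <;> simp [zPart]

/-- The linearized equations hold for `v` and for `i v`. Combining the two cancels the part
antilinear in `v`: this leaves only the `z`-derivatives of `Q`, and forces the `u`-components, which
are real for both vectors, to vanish. -/
theorem eventually_complexTangent_eq (hQ : IsNormalForm M Q) :
    ∀ᶠ Z in 𝓝[M] 0, ∀ v ∈ complexTangent M Z,
      (∀ l, v (wIdx l) = ∑ k, v (Sum.inl k) *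
        fderiv ℂ (Q l) (argL n m c Z) (Pi.single (Sum.inl k) 1)) ∧ ∀ i, v (uIdx i) = 0 := by
  have hu : ∀ᶠ Z in 𝓝[M] 0, ∀ i : Fin c, Z (uIdx i) - star (Z (uIdx i)) = 0 := by
    rw [eventually_nhdsWithin_iff]
    filter_upwards [hQ.mem_iff] with Z hZ hZM i
    exact sub_eq_zero.2 (congrFun (hZ.1 hZM).2 i)
  filter_upwards [eventually_eventually_nhdsWithin.2 (eventually_wDef_eq_zero hQ),
    eventually_eventually_nhdsWithin.2 hu, self_mem_nhdsWithin,
    nhdsWithin_le_nhds (tendsto_argL.eventually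
      (eventually_all.2 fun l => (hQ.algebraic l).1.eventually_analyticAt)),
    nhdsWithin_le_nhds (eventually_all.2 fun l => (analyticAt_wDef hQ l).eventually_analyticAt)]
    with Z h1 h2 h3 h4 h5 v hv
  refine ⟨fun l => ?_, fun i => ?_⟩
  · have key : ∀ v ∈ tangentConeAt ℝ M Z,
        v (wIdx l) = fderiv ℂ (Q l) (argL n m c Z) (argL n m c v) := by
      intro v hv
      have h6 := fderiv_eq_zero_of_mem_tangentConeAt (h5 l).differentiableAt
        (h1.mono fun Z hZ => hZ l) h3 hv
      rwa [fderiv_wDef (h4 l).differentiableAt, sub_eq_zero] at h6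
    have h6 := key v hv.1
    have h7 := key _ hv.2
    rw [argL_I_smul, map_smul, Pi.smul_apply, smul_eq_mul, smul_eq_mul] at h7
    have h8 := mul_left_cancel₀ Complex.I_ne_zero h7
    have h9 : (2 : ℂ) * v (wIdx l) = fderiv ℂ (Q l) (argL n m c Z)
        ((2 : ℂ) • (Sum.elim (zPart v) 0 : Fin n ⊕ Idx n m c → ℂ)) := by
      rw [two_mul]
      nth_rewrite 1 [h6]
      rw [h8, ← map_add, argL_apply v]
      congr 1
      ext (i | i)
      · simp [two_mul]
      · simp
    rw [map_smul, smul_eq_mul] at h9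
    rw [mul_left_cancel₀ two_ne_zero h9, clm_apply_eq_sum_single, Fintype.sum_sum_type]
    simp [zPart]
  · let D : (Idx n m c → ℂ) →L[ℝ] ℂ :=
      ContinuousLinearMap.proj (R := ℝ) (φ := fun _ : Idx n m c => ℂ) (uIdx i) -
        (Complex.conjCLE : ℂ →L[ℝ] ℂ).comp
          (ContinuousLinearMap.proj (R := ℝ) (φ := fun _ : Idx n m c => ℂ) (uIdx i))
    have key : ∀ v ∈ tangentConeAt ℝ M Z, v (uIdx i) - star (v (uIdx i)) = 0 := by
      intro v hv
      have h6 := fderiv_eq_zero_of_mem_tangentConeAt (g := D) D.differentiableAt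
        (h2.mono fun Z hZ => hZ i) h3 hv
      rw [D.fderiv] at h6
      exact h6
    have h6 := key v hv.1
    have h7 := key _ hv.2
    simp only [Pi.smul_apply, smul_eq_mul, star_mul', Complex.star_def, Complex.conj_I] at h6 h7
    have h8 : Complex.I * (v (uIdx i) + (starRingEnd ℂ) (v (uIdx i))) = 0 := by
      rw [← h7]; ring
    have h9 := (mul_eq_zero.1 h8).resolve_left Complex.I_ne_zero
    have h10 : (2 : ℂ) * v (uIdx i) = 0 := by
      linear_combination h6 + h9
    exact (mul_eq_zero.1 h10).resolve_left two_ne_zero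

theorem isTangentField_leafField (hQ : IsNormalForm M Q) {k : Fin n}
    (h : TangentAlong V fun t => leafField Q k (V t)) : IsTangentField V (leafField Q k) :=
  ⟨analyticAt_leafField hQ k, h, Eventually.of_forall fun _ _ => rfl⟩

theorem isTangentField_sig_leafField (hQ : IsNormalForm M Q) {k : Fin n}
    (h : TangentAlong V fun t => sig (leafField Q k (sig (V t)))) :
    IsTangentField V fun x => sig (leafField Q k (sig x)) :=
  ⟨analyticAt_sig_conj (analyticAt_leafField hQ k), h,
    Eventually.of_forall fun _ _ => star_zero ℂ⟩

/-- A complex tangent vector is determined by its `z`-components. Hence `dlt X` is the combination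
of the leaf fields with coefficients `X_k` and of the conjugate leaf fields with coefficients
`X̄_k`. -/
theorem isCRField_of_section (hQ : IsNormalForm M Q)
    (h1 : ∀ k, TangentAlong V fun t => leafField Q k (V t))
    (h2 : ∀ k, TangentAlong V fun t => sig (leafField Q k (sig (V t))))
    {X : (Idx n m c → ℂ) → (Idx n m c → ℂ)} (hX : AnalyticAt ℝ X 0)
    (hXM : ∀ᶠ p in 𝓝[M] 0, X p ∈ complexTangent M p) : IsCRField M V X where
  analytic := hX
  tangent g hg hg0 := by
    filter_upwards [hXM, eventually_eventually_nhdsWithin.2 hg0, self_mem_nhdsWithin,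
      nhdsWithin_le_nhds hg.eventually_analyticAt] with Z h3 h4 h5 h6
    exact fderiv_eq_zero_of_mem_tangentConeAt h6.differentiableAt h4 h5 h3.1
  comb := by
    have hXk : ∀ k : Fin n, AnalyticAt ℝ (fun Z => X Z (Sum.inl k)) 0 := fun k =>
      ((ContinuousLinearMap.proj (R := ℝ) (φ := fun _ : Idx n m c => ℂ) (Sum.inl k)).analyticAt
        _).comp hX
    have hXk' : ∀ k : Fin n, AnalyticAt ℝ (fun Z => star (X Z (Sum.inl k))) 0 := fun k =>
      ((Complex.conjCLE : ℂ →L[ℝ] ℂ).analyticAt _).comp (hXk k)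
    have hc := (isCombination_sum (M := M) Finset.univ fun k =>
      (isCombination_field (isTangentField_leafField hQ (h1 k))).smul (hXk k)).add
      (isCombination_sum Finset.univ fun k =>
        (isCombination_field (isTangentField_sig_leafField hQ (h2 k))).smul (hXk' k))
    refine hc.congr ?_
    filter_upwards [hXM, eventually_complexTangent_eq hQ] with Z h3 h4
    obtain ⟨hw, hu⟩ := h4 _ h3
    have harg : ∀ k l, leafField Q k (dlt Z) (Sum.inl (wIdx l)) =
        fderiv ℂ (Q l) (argL n m c Z) (Pi.single (Sum.inl k) 1) := fun k l => by
      rw [argL_apply]; rfl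
    have hinl : ∀ i, X Z i = ∑ k, X Z (Sum.inl k) * leafField Q k (dlt Z) (Sum.inl i) := by
      rintro (i | i | i)
      · have : ∀ k, leafField Q k (dlt Z) (Sum.inl (Sum.inl i)) = (Pi.single k 1 : Fin n → ℂ) i :=
          fun _ => rfl
        simp [this, Pi.single_apply]
      · simp only [harg]
        exact hw i
      · have : ∀ k, leafField Q k (dlt Z) (Sum.inl (uIdx i)) = 0 := fun _ => rfl
        simp [this, hu i]
    have hs0 : ∀ k i, leafField Q k (dlt Z) (Sum.inr i) = 0 := fun _ _ => rfl
    have hs1 : ∀ k i, sig (leafField Q k (dlt Z)) (Sum.inl i) = 0 := fun k i => by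
      simp [sig, hs0]
    have hs2 : ∀ k i, sig (leafField Q k (dlt Z)) (Sum.inr i) =
        star (leafField Q k (dlt Z) (Sum.inl i)) := fun k i => rfl
    ext (i | i)
    · simp only [sig_dlt, Pi.add_apply, Finset.sum_apply, Pi.smul_apply, smul_eq_mul, hs1, mul_zero,
        Finset.sum_const_zero, add_zero]
      exact hinl i
    · simp only [sig_dlt, Pi.add_apply, Finset.sum_apply, Pi.smul_apply, smul_eq_mul, hs0, hs2,
        mul_zero, Finset.sum_const_zero, zero_add]
      change star (X Z i) = _
      rw [hinl i, star_sum]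
      simp only [star_mul']

theorem isCRField_of_inCRLieAlgebra (hQ : IsNormalForm M Q) (hV : AnalyticAt ℂ V 0) (hV0 : V 0 = 0)
    (h1 : ∀ k, TangentAlong V fun t => leafField Q k (V t))
    (h2 : ∀ k, TangentAlong V fun t => sig (leafField Q k (sig (V t))))
    {X : (Idx n m c → ℂ) → (Idx n m c → ℂ)} (hX : InCRLieAlgebra M 0 X) : IsCRField M V X := by
  induction hX with
  | section_mem X hX hXM => exact isCRField_of_section hQ h1 h2 hX hXM
  | add X Y _ _ hX hY => exact hX.add hY
  | smul a X _ hX => exact hX.smul a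
  | bracket X Y _ _ hX hY => exact hX.lieBracket hV hV0 hY

variable (n m c) in
/-- The space `{(z, w, u) : Im w = 0, u = 0}`. -/
def orbitSpace : Submodule ℝ (Idx n m c → ℂ) where
  carrier := {v | (∀ l, (v (wIdx l)).im = 0) ∧ ∀ i, v (uIdx i) = 0}
  add_mem' := by
    rintro v w ⟨h1, h2⟩ ⟨h3, h4⟩
    exact ⟨fun l => by simp [h1, h3], fun i => by simp [h2, h4]⟩
  zero_mem' := ⟨fun _ => rfl, fun _ => rfl⟩
  smul_mem' := by
    rintro a v ⟨h1, h2⟩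
    exact ⟨fun l => by simp [h1], fun i => by simp [h2]⟩

theorem finrank_orbitSpace_le : Module.finrank ℝ (orbitSpace n m c) ≤ 2 * n + m := by
  let L : (Idx n m c → ℂ) →ₗ[ℝ] (Fin n → ℂ) × (Fin m → ℝ) :=
    (LinearMap.pi fun i => LinearMap.proj (Sum.inl i)).prod
      (LinearMap.pi fun l => Complex.reLm.comp (LinearMap.proj (wIdx l)))
  have h := LinearMap.finrank_le_finrank_of_injective (f := L.comp (orbitSpace n m c).subtype) (by
    rw [injective_iff_map_eq_zero]
    rintro ⟨v, h1, h2⟩ hv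
    refine Subtype.ext (funext fun i => ?_)
    rcases i with i | i | i
    · exact congrFun (congrArg Prod.fst hv) i
    · exact Complex.ext (congrFun (congrArg Prod.snd hv) i) (h1 i)
    · exact h2 i)
  refine h.trans (le_of_eq ?_)
  rw [Module.finrank_prod, Module.finrank_pi_fintype]
  simp [Complex.finrank_real_complex, mul_comm]

/-- The two normality conditions compute this derivative on complementary directions: `Q(z, 0, τ, u)
= τ` settles the `z`-directions and `Q(0, χ, τ, u) = τ` all others. -/
theorem fderiv_zero_apply (hQ : IsNormalForm M Q) (l : Fin m) (a : Fin n → ℂ) (b : Idx n m c → ℂ) :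
    fderiv ℂ (Q l) 0 (Sum.elim a b) = b (wIdx l) := by
  have hd : HasFDerivAt (Q l) (fderiv ℂ (Q l) 0) 0 := (hQ.algebraic l).1.differentiableAt.hasFDerivAt
  let P : (Idx n m c → ℂ) →L[ℂ] ℂ :=
    ContinuousLinearMap.proj (R := ℂ) (φ := fun _ : Idx n m c => ℂ) (wIdx l)
  let A : (Idx n m c → ℂ) →L[ℂ] (Fin n ⊕ Idx n m c → ℂ) := ContinuousLinearMap.pi
    (Sum.elim (fun i => ContinuousLinearMap.proj (R := ℂ) (Sum.inl i))
      (Sum.elim (fun _ => 0) fun i => ContinuousLinearMap.proj (R := ℂ) (Sum.inr i)))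
  let A' : (Idx n m c → ℂ) →L[ℂ] (Fin n ⊕ Idx n m c → ℂ) := ContinuousLinearMap.pi
    (Sum.elim (fun _ => 0) fun i => ContinuousLinearMap.proj (R := ℂ) i)
  have hA : ∀ x, A x = Sum.elim (zPart x) (pt 0 (wPart x) (uPart x)) := by
    intro x; ext (i | i | i | i) <;> rfl
  have hA' : ∀ x, A' x = (Sum.elim 0 x : Fin n ⊕ Idx n m c → ℂ) := by
    intro x; ext (i | i) <;> rfl
  have key : ∀ B : (Idx n m c → ℂ) →L[ℂ] (Fin n ⊕ Idx n m c → ℂ),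
      (∀ᶠ x in 𝓝 0, Q l (B x) = wPart x l) → (fderiv ℂ (Q l) 0).comp B = P := by
    intro B hB
    have h1 : HasFDerivAt (Q l ∘ B) ((fderiv ℂ (Q l) 0).comp B) 0 :=
      HasFDerivAt.comp 0 (by rwa [map_zero]) B.hasFDerivAt
    exact h1.unique (P.hasFDerivAt.congr_of_eventuallyEq hB)
  have h1 := key A (by simpa only [hA] using hQ.normal_left l)
  have h2 := key A' (by simpa only [hA'] using hQ.normal_right l)
  have h3 := congrArg (fun B : (Idx n m c → ℂ) →L[ℂ] ℂ => B (pt a 0 0)) h1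
  have h4 := congrArg (fun B : (Idx n m c → ℂ) →L[ℂ] ℂ => B b) h2
  simp only [ContinuousLinearMap.comp_apply, hA, hA'] at h3 h4
  have h5 : (Sum.elim a b : Fin n ⊕ Idx n m c → ℂ) =
      Sum.elim (zPart (pt a 0 0 : Idx n m c → ℂ)) (pt 0 (wPart (pt a 0 0 : Idx n m c → ℂ))
        (uPart (pt a 0 0 : Idx n m c → ℂ))) + (Sum.elim 0 b : Fin n ⊕ Idx n m c → ℂ) := by
    ext (i | i | i | i)
    · simp [zPart, pt]
    · simp [pt]
    · simp [pt, wPart]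
    · simp [pt, uPart]
  rw [h5, map_add, h3, h4]
  exact zero_add _

/-- At `0` the linearized equation of `M` reads `w = w̄`, and none of the fields in the expansion
has a `∂/∂u`-component. -/
theorem IsCRField.apply_zero_mem (hQ : IsNormalForm M Q) (h0 : (0 : Idx n m c → ℂ) ∈ M)
    {X : (Idx n m c → ℂ) → (Idx n m c → ℂ)} (hX : IsCRField M V X) : X 0 ∈ orbitSpace n m c := by
  refine ⟨fun l => ?_, fun i => ?_⟩
  · have h1 := (hX.tangent _ (analyticAt_wDef hQ l) ((eventually_wDef_eq_zero hQ).mono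
      fun Z hZ => hZ l)).self_of_nhdsWithin h0
    rw [fderiv_wDef (by rw [map_zero]; exact (hQ.algebraic l).1.differentiableAt), map_zero,
      argL_apply, fderiv_zero_apply hQ, sub_eq_zero] at h1
    have h2 := congrArg Complex.im h1
    simp only [Pi.star_apply, Complex.star_def, Complex.conj_im] at h2
    linarith
  · obtain ⟨κ, _, a, Y, -, hY, h⟩ := hX.comb
    have h1 := h.self_of_nhdsWithin h0
    rw [dlt_zero] at h1
    have h2 := congrFun h1 (Sum.inl (uIdx i))
    rw [Finset.sum_apply] at h2
    refine h2.trans (Finset.sum_eq_zero fun k _ => ?_)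
    rw [Pi.smul_apply, (hY k).u_eq.self_of_nhds, smul_zero]

theorem IsCRField.exists_field (h0 : (0 : Idx n m c → ℂ) ∈ M)
    {X : (Idx n m c → ℂ) → (Idx n m c → ℂ)} (hX : IsCRField M V X) :
    ∃ Y, IsTangentField V Y ∧ Y 0 = dlt (X 0) := by
  obtain ⟨κ, _, a, Y, -, hY, h⟩ := hX.comb
  have h1 := h.self_of_nhdsWithin h0
  rw [dlt_zero] at h1
  exact ⟨_, isTangentField_sum Finset.univ (fun i => a i 0) hY, h1.symm⟩

/-- If the orbit of `0` has the maximal dimension, then the fields that are generically tangent to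
the image of `V` span its tangent space at `0`. -/
theorem exists_isTangentField (hQ : IsNormalForm M Q) (h0 : (0 : Idx n m c → ℂ) ∈ M)
    (hdim : orbitDim M 0 = 2 * n + m) (hV : AnalyticAt ℂ V 0) (hV0 : V 0 = 0)
    (h1 : ∀ k, TangentAlong V fun t => leafField Q k (V t))
    (h2 : ∀ k, TangentAlong V fun t => sig (leafField Q k (sig (V t))))
    {v : Idx n m c → ℂ} (hv : v ∈ orbitSpace n m c) :
    ∃ Y, IsTangentField V Y ∧ Y 0 = dlt v := by
  have hle : orbitTangent M 0 ≤ orbitSpace n m c := by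
    refine Submodule.span_le.2 ?_
    rintro _ ⟨X, hX, rfl⟩
    exact (isCRField_of_inCRLieAlgebra hQ hV hV0 h1 h2 hX).apply_zero_mem hQ h0
  -- The dimension hypothesis enters here: the orbit tangent space is contained in a space of
  -- dimension at most `2n + m`.
  have heq : orbitTangent M 0 = orbitSpace n m c :=
    Submodule.eq_of_le_of_finrank_le hle (finrank_orbitSpace_le.trans hdim.ge)
  rw [← heq] at hv
  refine Submodule.span_induction ?_ ?_ ?_ ?_ hv
  · rintro _ ⟨X, hX, rfl⟩
    exact (isCRField_of_inCRLieAlgebra hQ hV hV0 h1 h2 hX).exists_field h0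
  · exact ⟨_, isTangentField_zero, dlt_zero.symm⟩
  · rintro v w _ _ ⟨Y, hY, hY0⟩ ⟨Y', hY', hY0'⟩
    refine ⟨_, hY.add hY', ?_⟩
    rw [hY0, hY0', ← dltL_apply, ← dltL_apply, ← dltL_apply, map_add]
  · rintro a v _ ⟨Y, hY, hY0⟩
    refine ⟨_, hY.const_smul (a : ℂ), ?_⟩
    rw [hY0, ← dltL_apply, ← dltL_apply, map_smul, Complex.coe_smul]

theorem not_eventuallyEq_zero_prod {E κ : Type*} [NormedAddCommGroup E] [NormedSpace ℂ E]
    (s : Finset κ) {b : κ → E → ℂ} (hb : ∀ i, AnalyticAt ℂ (b i) 0)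
    (h : ∀ i, ¬ b i =ᶠ[𝓝 0] 0) : ¬ (fun t => ∏ i ∈ s, b i t) =ᶠ[𝓝 0] 0 := by
  classical
  induction s using Finset.induction_on with
  | empty => exact fun h => one_ne_zero h.self_of_nhds
  | insert i s hi ih =>
    simp only [Finset.prod_insert hi]
    exact not_eventuallyEq_zero_mul (hb i) (Finset.analyticAt_fun_prod _ fun i _ => hb i) (h i) ih

/-- The `Z`-part of a chain of maximal rank is generically a submersion. -/
theorem frequently_surjective (hQ : IsNormalForm M Q) (h0 : (0 : Idx n m c → ℂ) ∈ M)
    (hdim : orbitDim M 0 = 2 * n + m) {j : Fin c → T} (hV : IsChain Q f V j)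
    (h1 : ∀ k, TangentAlong V fun t => leafField Q k (V t))
    (h2 : ∀ k, TangentAlong V fun t => sig (leafField Q k (sig (V t)))) :
    ∃ᶠ t in 𝓝 0, Function.Surjective (fderiv ℂ (fun t i => V t (Sum.inl i)) t) := by
  classical
  -- The unit vectors in the `z`- and `w`-directions lie in `orbitSpace`, so each is the value at
  -- `0` of the `Z`-part of a tangent field. The `u`-directions come from the parameters `t_{j(k)}`
  -- of the chain.
  have hex : ∀ i : Fin n ⊕ Fin m, ∃ Y, IsTangentField V Y ∧
      Y 0 = dlt (Pi.single (i.elim Sum.inl wIdx : Idx n m c) 1) := by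
    rintro i
    refine exists_isTangentField hQ h0 hdim hV.analyticAt hV.zero h1 h2 ?_
    rcases i with i | i
    · exact ⟨fun l => by simp, fun l => by simp⟩
    · exact ⟨fun l => by by_cases h : l = i <;> simp [Pi.single_apply, h], fun l => by simp⟩
  choose Y hY hY0 using hex
  choose b a hb ha hb0 hba using fun i => (hY i).tangent
  let v : (T → ℂ) → (Idx n m c → ℂ) := fun t i => V t (Sum.inl i)
  have hv : AnalyticAt ℂ v 0 := AnalyticAt.pi fun i => hV.analyticAt.coord _
  have hfv : ∀ᶠ t in 𝓝 0, ∀ h i, fderiv ℂ v t h i = fderiv ℂ V t h (Sum.inl i) := by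
    filter_upwards [hv.eventually_analyticAt, hV.analyticAt.eventually_analyticAt] with t h3 h4 h i
    have e1 := fderiv_apply h3.differentiableAt i
    have e2 := fderiv_apply h4.differentiableAt (Sum.inl i)
    exact congrArg (fun A : (T → ℂ) →L[ℂ] ℂ => A h) (e1.symm.trans e2)
  let col : (T → ℂ) → Idx n m c → Idx n m c → ℂ := fun t => Sum.elim
    (fun k i => Y (Sum.inl k) (V t) (Sum.inl i)) (Sum.elim
      (fun k i => Y (Sum.inr k) (V t) (Sum.inl i)) fun k => fderiv ℂ v t (Pi.single (j k) 1))
  let A : (T → ℂ) → Matrix (Idx n m c) (Idx n m c) ℂ := fun t => Matrix.of fun i k => col t k i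
  have hcol : ContinuousAt A 0 := by
    refine continuousAt_pi.2 fun i => continuousAt_pi.2 fun k => ?_
    have hYc : ∀ k, ContinuousAt (fun t => Y k (V t) (Sum.inl i)) 0 := fun k =>
      (((hY k).analytic.comp_zero hV.analyticAt hV.zero).coord _).continuousAt
    rcases k with k | k | k
    · exact hYc (Sum.inl k)
    · exact hYc (Sum.inr k)
    · exact ((AnalyticAt.clm_apply hv.fderiv analyticAt_const).coord i).continuousAt
  have hY00 : ∀ k i, Y k (V 0) (Sum.inl i) =
      (Pi.single (k.elim Sum.inl wIdx : Idx n m c) 1 : Idx n m c → ℂ) i := by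
    intro k i
    rw [hV.zero, hY0]; rfl
  have hu0 : ∀ k i, fderiv ℂ v 0 (Pi.single (j k) 1) (uIdx i) =
      (Pi.single k 1 : Fin c → ℂ) i := by
    intro k i
    have e1 := fderiv_apply hv.differentiableAt (uIdx i)
    have e2 : (fun t => v t (uIdx i)) =ᶠ[𝓝 0] fun t => t (j i) := by
      filter_upwards [hV.u_eq] with t ht using ht i
    have e3 : HasFDerivAt (fun t : T → ℂ => t (j i))
        (ContinuousLinearMap.proj (R := ℂ) (φ := fun _ : T => ℂ) (j i)) 0 :=
      (ContinuousLinearMap.proj (R := ℂ) (φ := fun _ : T => ℂ) (j i)).hasFDerivAt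
    rw [e2.fderiv_eq, e3.fderiv] at e1
    have e4 := congrArg (fun A : (T → ℂ) →L[ℂ] ℂ => A (Pi.single (j k) 1)) e1.symm
    refine Eq.trans e4 ?_
    change (Pi.single (j k) 1 : T → ℂ) (j i) = _
    by_cases h : i = k
    · subst h; simp
    · rw [Pi.single_eq_of_ne h, Pi.single_eq_of_ne (fun h' => h (hV.inj h'))]
  have hdet0 : (A 0).det ≠ 0 := by
    -- At `0` the matrix is block triangular with identity diagonal blocks: the `z`- and `w`-columns
    -- are unit vectors, and the `u`-columns have identity `u`-block.
    intro hdet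
    obtain ⟨x, hx, hAx⟩ := Matrix.exists_mulVec_eq_zero_iff.2 hdet
    have hrow : ∀ i, ∑ k, col 0 k i * x k = 0 := fun i => congrFun hAx i
    have hsplit : ∀ i, (∑ k, (Pi.single (Sum.inl k : Idx n m c) 1 : Idx n m c → ℂ) i * x (Sum.inl k))
        + ((∑ k, (Pi.single (wIdx k : Idx n m c) 1 : Idx n m c → ℂ) i * x (wIdx k)) +
          ∑ k, fderiv ℂ v 0 (Pi.single (j k) 1) i * x (uIdx k)) = 0 := by
      intro i
      have := hrow i
      rw [Fintype.sum_sum_type, Fintype.sum_sum_type] at this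
      simp only [col, Sum.elim_inl, Sum.elim_inr, hY00] at this
      exact this
    have hxu : ∀ i, x (uIdx i) = 0 := by
      intro i
      have := hsplit (uIdx i)
      simp only [hu0] at this
      simpa [Pi.single_apply] using this
    refine hx (funext fun i => ?_)
    have := hsplit i
    simp only [hxu, mul_zero, Finset.sum_const_zero, add_zero] at this
    rcases i with i | i | i
    · simpa [Pi.single_apply] using this
    · simpa [Pi.single_apply] using this
    · exact hxu i
  have hdet : ∀ᶠ t in 𝓝 0, (A t).det ≠ 0 :=
    (Continuous.matrix_det continuous_id).continuousAt.comp hcol |>.eventually_ne hdet0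
  have hprod := not_eventuallyEq_zero_prod Finset.univ hb hb0
  -- Where no denominator `b i` vanishes, every column is really in the image of the derivative of
  -- the `Z`-part. Such points accumulate at `0`, and near `0` the columns form a basis.
  have hfreq : ∃ᶠ t in 𝓝 0, ∏ i, b i t ≠ 0 := fun h => hprod (h.mono fun x hx => not_not.1 hx)
  refine (hfreq.and_eventually (hdet.and (hfv.and (eventually_all.2 hba)))).mono ?_
  rintro t ⟨hbt, hdt, hfvt, hbat⟩ x
  have hbi : ∀ i, b i t ≠ 0 := fun i => (Finset.prod_ne_zero_iff.1 hbt) i (Finset.mem_univ i)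
  have hmem : ∀ k, col t k ∈ LinearMap.range (fderiv ℂ v t : (T → ℂ) →ₗ[ℂ] _) := by
    have hYmem : ∀ k, (fun i => Y k (V t) (Sum.inl i)) ∈
        LinearMap.range (fderiv ℂ v t : (T → ℂ) →ₗ[ℂ] _) := by
      intro k
      refine ⟨(b k t)⁻¹ • a k t, ?_⟩
      funext i
      change fderiv ℂ v t ((b k t)⁻¹ • a k t) i = _
      rw [hfvt, map_smul, ← hbat k, smul_smul, inv_mul_cancel₀ (hbi k), one_smul]
    rintro (k | k | k)
    · exact hYmem (Sum.inl k)
    · exact hYmem (Sum.inr k)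
    · exact ⟨_, rfl⟩
  have hx : x = ∑ k, ((A t)⁻¹.mulVec x) k • col t k := by
    have h3 : (A t).mulVec ((A t)⁻¹.mulVec x) = x := by
      rw [Matrix.mulVec_mulVec, Matrix.mul_nonsing_inv _ (isUnit_iff_ne_zero.2 hdt),
        Matrix.one_mulVec]
    conv_lhs => rw [← h3]
    funext i
    rw [Finset.sum_apply]
    simp only [Pi.smul_apply, smul_eq_mul]
    simp only [Matrix.mulVec, dotProduct, A, mul_comm]
    rfl
  have : x ∈ LinearMap.range (fderiv ℂ v t : (T → ℂ) →ₗ[ℂ] _) := by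
    rw [hx]
    exact sum_mem fun k _ => Submodule.smul_mem _ _ (hmem k)
  exact this

end Orbits

/-! ### Descent along generically submersive algebraic maps -/

section Descent

theorem mem_algClosure_of_map_injective {A B : Type*} [CommRing A] [IsDomain A] [CommRing B]
    [IsDomain B] {φ : A →+* B} (hφ : Function.Injective φ) {S : Subring A} {x : A}
    (hx : φ x ∈ algClosure (S.map φ)) : x ∈ algClosure S := by
  have hx' : IsAlgebraic (S.map φ) (φ x) := hx
  let g : S →+* S.map φ := (φ.comp S.subtype).codRestrict _ fun y => ⟨y, y.2, rfl⟩
  refine IsAlgebraic.of_ringHom_of_comp_eq g φ hx' ?_ hφ ?_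
  · rintro ⟨_, y, hy, rfl⟩
    exact ⟨⟨y, hy⟩, rfl⟩
  · ext y; rfl

theorem derivation_mem_sup {A : Type*} [CommRing A] (D : Derivation ℤ A A) {S S' : Subring A}
    (hS : ∀ x ∈ S, D x ∈ S ⊔ S') (hS' : ∀ x ∈ S', D x ∈ S ⊔ S') {x : A} (hx : x ∈ S ⊔ S') :
    D x ∈ S ⊔ S' := by
  have h : S ⊔ S' = Subring.closure (S ∪ S' : Set A) := by
    rw [Subring.closure_union, Subring.closure_eq, Subring.closure_eq]
  rw [h] at hx hS hS' ⊢
  exact derivation_mem_closure D _ (fun y hy => hy.elim (hS y) (hS' y)) hx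

/-- Exchange in the matroid of algebraic independence: an independent family in the closure of `y`
with at least as many members has the same closure as `y`. -/
theorem mem_algClosure_adjoin_of_card_le {K A κ T : Type*} [Field K] [CommRing A] [IsDomain A]
    [Algebra K A] [Fintype κ] [Fintype T] {x : κ → A} {y : T → A} (hx : AlgebraicIndependent K x)
    (hxy : ∀ k, x k ∈ algClosure (Algebra.adjoin K (Set.range y)).toSubring)
    (hcard : Fintype.card T ≤ Fintype.card κ) (j : T) :
    y j ∈ algClosure (Algebra.adjoin K (Set.range x)).toSubring := by
  let M := AlgebraicIndependent.matroid K A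
  have hind : M.Indep (Set.range x) := AlgebraicIndependent.matroid_indep_iff.2 hx.to_subtype_range
  have hsub : Set.range x ⊆ M.closure (Set.range y) := by
    rintro _ ⟨k, rfl⟩
    rw [AlgebraicIndependent.matroid_closure_eq]
    exact hxy k
  have hr : M.eRk (M.closure (Set.range y)) ≤ M.eRk (Set.range x) := by
    rw [M.eRk_closure_eq, hind.eRk_eq_encard, ← Set.image_univ, ← Set.image_univ,
      hx.injective.encard_image]
    refine (M.eRk_le_encard _).trans ((Set.encard_image_le _ _).trans ?_)
    rw [Set.encard_univ, Set.encard_univ, ENat.card_eq_coe_fintype_card,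
      ENat.card_eq_coe_fintype_card]
    exact_mod_cast hcard
  have h := (M.isRkFinite_of_finite (Set.finite_range x)
    ).closure_eq_closure_of_subset_of_eRk_ge_eRk hsub hr
  have hj : y j ∈ M.closure (Set.range x) := by
    rw [h, M.closure_closure]
    exact M.subset_closure _ (Set.subset_univ _) ⟨j, rfl⟩
  rw [AlgebraicIndependent.matroid_closure_eq] at hj
  exact hj

theorem polyHom_injective (ι : Type) [Fintype ι] : Function.Injective (polyHom ι) := by
  rw [injective_iff_map_eq_zero]
  intro p hp
  rw [polyHom_apply, germOf_eq_zero_iff] at hp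
  have h := AnalyticOnNhd.eq_of_eventuallyEq (f := fun x : ι → ℂ => MvPolynomial.eval x p)
    (g := 0) (AnalyticOnNhd.eval_mvPolynomial p) (fun _ _ => analyticAt_const) hp
  exact MvPolynomial.funext fun x => by simpa using congrFun h x

variable {ι T : Type} [Fintype ι] [Fintype T]

/-- Near a point `t` where `dV` is onto, `V` is open, so `g ∘ V = 0` near `t` forces `g = 0` near `V
t`. Such points `V t` accumulate at `0`. -/
theorem pull_injective {V : (T → ℂ) → (ι → ℂ)} (hV : AnalyticAt ℂ V 0) (h0 : V 0 = 0)
    (h : ∃ᶠ t in 𝓝 0, Function.Surjective (fderiv ℂ V t)) :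
    Function.Injective (pull V hV h0) := by
  rw [injective_iff_map_eq_zero]
  intro φ hφ
  obtain ⟨g, hg, rfl⟩ := exists_germOf φ
  rw [pull_germOf, germOf_eq_zero_iff] at hφ
  rw [germOf_eq_zero_iff]
  refine eventuallyEq_zero_of_frequently hg ?_
  have ht : Tendsto V (𝓝 0) (𝓝 0) := by simpa [h0] using hV.continuousAt.tendsto
  refine ht.frequently ((h.and_eventually
    (hφ.eventually_nhds.and hV.eventually_analyticAt)).mono ?_)
  rintro t ⟨h1, h2, h3⟩
  have h4 := h3.hasStrictFDerivAt.map_nhds_eq_of_surj (LinearMap.range_eq_top.2 h1)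
  rw [← h4]
  exact h2

/-- Select columns of `A` forming a basis of the target; `s` consists of the remaining coordinates,
which can be prescribed freely. -/
theorem exists_complement {A : (T → ℂ) →ₗ[ℂ] (ι → ℂ)} (hA : Function.Surjective A) :
    ∃ s : Set T, Fintype.card T = Fintype.card ι + Nat.card s ∧
      ∀ (y : ι → ℂ) (z : s → ℂ), ∃ x, A x = y ∧ ∀ j : s, x j = z j := by
  classical
  obtain ⟨κ, a, ha, hspan, hli⟩ := exists_linearIndependent' ℂ fun j => A (Pi.single j 1)
  have := Finite.of_injective a ha
  have := Fintype.ofFinite κ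
  have htop : Submodule.span ℂ (Set.range fun j => A (Pi.single j 1)) = ⊤ := by
    have h1 := congrArg (Submodule.map A) (Pi.basisFun ℂ T).span_eq
    rw [Submodule.map_span, ← Set.range_comp, Submodule.map_top, LinearMap.range_eq_top.2 hA] at h1
    simpa [Function.comp_def] using h1
  rw [htop] at hspan
  have hcard : Fintype.card κ = Fintype.card ι := by
    have := Module.finrank_eq_card_basis (Module.Basis.mk hli hspan.ge)
    simpa using this.symm
  refine ⟨(Set.range a)ᶜ, ?_, fun y z => ?_⟩
  · have h1 := Set.ncard_add_ncard_compl (Set.range a)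
    rw [← Nat.card_coe_set_eq, ← Nat.card_coe_set_eq, Nat.card_range_of_injective ha,
      Nat.card_eq_fintype_card (α := κ), Nat.card_eq_fintype_card (α := T)] at h1
    omega
  · let x₀ : T → ℂ := fun j => if h : j ∈ (Set.range a)ᶜ then z ⟨j, h⟩ else 0
    have hy : y - A x₀ ∈ Submodule.span ℂ (Set.range ((fun j => A (Pi.single j 1)) ∘ a)) := by
      rw [hspan]; trivial
    obtain ⟨b, hb⟩ := (Submodule.mem_span_range_iff_exists_fun ℂ).1 hy
    refine ⟨x₀ + ∑ k, b k • Pi.single (a k) 1, ?_, fun j => ?_⟩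
    · rw [map_add, map_sum]
      simp only [map_smul]
      rw [← eq_sub_iff_add_eq']
      exact hb
    · have h1 : ∀ k, (Pi.single (a k) (1 : ℂ) : T → ℂ) j = 0 := fun k =>
        Pi.single_eq_of_ne (fun h => j.2 ⟨k, h.symm⟩) _
      have h2 : x₀ j = z j := by simp only [x₀]; rw [dif_pos j.2]
      simp [Finset.sum_apply, h1, h2]

theorem polyHom_X (i : ι) :
    polyHom ι (MvPolynomial.X i) = germOf (fun x => x i) (analyticAt_coord i 0) :=
  germOf_congr (analyticAt_mvPolynomial _) _ (Eventually.of_forall fun x => by simp)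

theorem pull_constHom {V : (T → ℂ) → (ι → ℂ)} (hV : AnalyticAt ℂ V 0) (h0 : V 0 = 0) (a : ℂ) :
    pull V hV h0 (constHom ι a) = constHom T a := by
  rw [constHom_apply, constHom_apply, pull_germOf]

theorem pull_polyHom_X {V : (T → ℂ) → (ι → ℂ)} (hV : AnalyticAt ℂ V 0) (h0 : V 0 = 0) (i : ι) :
    pull V hV h0 (polyHom ι (MvPolynomial.X i)) = coordGerm V hV i := by
  rw [polyHom_X]
  rfl

/-- The components of `V` are algebraically independent by injectivity, and algebraic over the
coordinates of `T`, of which there are no more. So the coordinates are algebraic over the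
components, and with them all algebraic germs. -/
theorem nashRing_le_of_pull_injective {V : (T → ℂ) → (ι → ℂ)} (hV : ∀ i, IsNash fun t => V t i)
    (h0 : V 0 = 0) (hinj : Function.Injective (pull V (analyticAt_of_isNash hV) h0))
    (hcard : Fintype.card T ≤ Fintype.card ι) :
    nashRing T ≤ algClosure ((polyHom ι).range.map (pull V (analyticAt_of_isNash hV) h0)) := by
  let : Algebra ℂ (HolGerm T) := (constHom T).toAlgebra
  have hx : ((MvPolynomial.aeval (coordGerm V (analyticAt_of_isNash hV))) :
      MvPolynomial ι ℂ →ₐ[ℂ] HolGerm T).toRingHom =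
      (pull V (analyticAt_of_isNash hV) h0).comp (polyHom ι) := by
    refine MvPolynomial.ringHom_ext (fun a => ?_) fun i => ?_
    · exact (MvPolynomial.aeval_C _ a).trans (pull_constHom (analyticAt_of_isNash hV) h0 a).symm
    · exact (MvPolynomial.aeval_X _ i).trans
        (pull_polyHom_X (analyticAt_of_isNash hV) h0 i).symm
  have hy : ((MvPolynomial.aeval fun j => germOf (fun t : T → ℂ => t j) (analyticAt_coord j 0)) :
      MvPolynomial T ℂ →ₐ[ℂ] HolGerm T).toRingHom = polyHom T := by
    refine MvPolynomial.ringHom_ext (fun a => ?_) fun j => ?_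
    · exact MvPolynomial.aeval_C _ a
    · exact (MvPolynomial.aeval_X _ j).trans (polyHom_X j).symm
  have hx' : (polyHom ι).range.map (pull V (analyticAt_of_isNash hV) h0) =
      (Algebra.adjoin ℂ (Set.range (coordGerm V (analyticAt_of_isNash hV)))).toSubring := by
    rw [Algebra.adjoin_range_eq_range_aeval, RingHom.map_range, ← hx]
    rfl
  have hy' : (polyHom T).range = (Algebra.adjoin ℂ (Set.range fun j =>
      germOf (fun t : T → ℂ => t j) (analyticAt_coord j 0))).toSubring := by
    rw [Algebra.adjoin_range_eq_range_aeval, ← hy]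
    rfl
  have hind : AlgebraicIndependent ℂ (coordGerm V (analyticAt_of_isNash hV)) := by
    have h1 : Function.Injective ((pull V (analyticAt_of_isNash hV) h0).comp (polyHom ι)) :=
      hinj.comp (polyHom_injective ι)
    rw [← hx] at h1
    exact h1
  rw [hx']
  refine algClosure_trans ?_
  rintro _ ⟨p, rfl⟩
  rw [← hy]
  have h2 : Algebra.adjoin ℂ (Set.range fun j => germOf (fun t : T → ℂ => t j)
      (analyticAt_coord j 0)) ≤ Subalgebra.restrictScalars ℂ (Subalgebra.algebraicClosure
      (Algebra.adjoin ℂ (Set.range (coordGerm V (analyticAt_of_isNash hV)))) (HolGerm T)) := by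
    refine Algebra.adjoin_le ?_
    rintro _ ⟨j, rfl⟩
    refine mem_algClosure_adjoin_of_card_le (y := fun j => germOf (fun t : T → ℂ => t j)
      (analyticAt_coord j 0)) hind (fun k => ?_) hcard j
    rw [← hy']
    exact (hV k).2
  refine h2 ?_
  rw [Algebra.adjoin_range_eq_range_aeval]
  exact ⟨p, rfl⟩

/-- Complete `v` by some of the coordinates of `T` to a map that is generically a local
biholomorphism. Relations descend along it by injectivity, giving a relation for `φ` with extra
polynomial variables, which are then set to zero. -/
theorem mem_algClosure_of_pull [DecidableEq ι] {v : (T → ℂ) → (ι → ℂ)}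
    (hv : ∀ i, IsNash fun t => v t i) (h0 : v 0 = 0)
    (hsurj : ∃ᶠ t in 𝓝 0, Function.Surjective (fderiv ℂ v t)) {S : Subring (HolGerm ι)}
    (hnash : nashRing ι ≤ S) (hS : ∀ i, ∀ φ ∈ S, dd i φ ∈ S) {φ : HolGerm ι}
    (hφ : pull v (analyticAt_of_isNash hv) h0 φ ∈
      algClosure (nashRing T ⊔ S.map (pull v (analyticAt_of_isNash hv) h0))) :
    φ ∈ algClosure S := by
  classical
  -- The complementary coordinates depend on the point `t`, but there are finitely many subsets of
  -- `T`, so one of them works at points accumulating at `0`.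
  obtain ⟨s, hs⟩ : ∃ s : Set T, ∃ᶠ t in 𝓝 0, Fintype.card T = Fintype.card ι + Nat.card s ∧
      ∀ (y : ι → ℂ) (z : s → ℂ), ∃ x, fderiv ℂ v t x = y ∧ ∀ j : s, x j = z j := by
    by_contra H
    rw [not_exists] at H
    have H' := eventually_all.2 fun s => not_frequently.1 (H s)
    obtain ⟨t, h1, h2⟩ := (hsurj.and_eventually H').exists
    obtain ⟨s, h3⟩ := exists_complement (A := (fderiv ℂ v t : (T → ℂ) →ₗ[ℂ] (ι → ℂ))) h1
    exact h2 s h3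
  let Φ : (T → ℂ) → (ι ⊕ s → ℂ) := fun t => Sum.elim (v t) fun j => t j
  have hΦ : ∀ i, IsNash fun t => Φ t i := by
    rintro (i | i)
    · exact hv i
    · exact isNash_coord (i : T)
  have hΦ0 : Φ 0 = 0 := by
    funext i
    rcases i with i | i
    · exact congrFun h0 i
    · rfl
  have hΦa := analyticAt_of_isNash hΦ
  have hva := analyticAt_of_isNash hv
  have hcard : Fintype.card T ≤ Fintype.card (ι ⊕ s) := by
    obtain ⟨t, h1, -⟩ := hs.exists
    rw [Fintype.card_sum, h1, Nat.card_eq_fintype_card]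
  have hinj : Function.Injective (pull Φ hΦa hΦ0) := by
    refine pull_injective _ _ ((hs.and_eventually (hva.eventually_analyticAt.and
      hΦa.eventually_analyticAt)).mono ?_)
    rintro t ⟨⟨-, h1⟩, h2, h3⟩ y
    obtain ⟨x, hx1, hx2⟩ := h1 (fun i => y (Sum.inl i)) fun j => y (Sum.inr j)
    refine ⟨x, funext fun i => ?_⟩
    have h4 : fderiv ℂ Φ t x i = fderiv ℂ (fun t => Φ t i) t x := by
      rw [fderiv_apply h3.differentiableAt]
      rfl
    rw [h4]
    rcases i with i | i
    · change fderiv ℂ (fun t => v t i) t x = _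
      rw [fderiv_apply h2.differentiableAt]
      exact congrFun hx1 i
    · refine Eq.trans ?_ (hx2 i)
      exact congrArg (fun B : (T → ℂ) →L[ℂ] ℂ => B x)
        (ContinuousLinearMap.proj (R := ℂ) (φ := fun _ : T => ℂ) (i : T)).fderiv
  let π : (ι ⊕ s → ℂ) → (ι → ℂ) := fun x i => x (Sum.inl i)
  have hπ : ∀ i, IsNash fun x => π x i := fun i => isNash_coord (Sum.inl i)
  let e : (ι → ℂ) → (ι ⊕ s → ℂ) := fun Z => Sum.elim Z 0
  have he : ∀ i, IsNash fun x => e x i := by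
    rintro (i | i)
    · exact isNash_coord i
    · exact isNash_const 0
  have he0 : e 0 = 0 := sumElim_zero
  let pπ := pull π (analyticAt_of_isNash hπ) rfl
  let S₁ : Subring (HolGerm (ι ⊕ s)) := (polyHom (ι ⊕ s)).range ⊔ S.map pπ
  have hcomp : ∀ ψ, pull Φ hΦa hΦ0 (pπ ψ) = pull v hva h0 ψ := by
    intro ψ
    obtain ⟨g, hg, rfl⟩ := exists_germOf ψ
    rfl
  have hcomp' : ∀ ψ, pull e (analyticAt_of_isNash he) he0 (pπ ψ) = ψ := by
    intro ψ
    obtain ⟨g, hg, rfl⟩ := exists_germOf ψ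
    rfl
  have h1 : pπ φ ∈ algClosure S₁ := by
    refine mem_algClosure_of_map_injective hinj ?_
    rw [hcomp]
    refine algClosure_trans (sup_le ?_ ?_) hφ
    · refine (nashRing_le_of_pull_injective hΦ hΦ0 hinj hcard).trans (algClosure_mono ?_)
      exact (Subring.gc_map_comap _).monotone_l le_sup_left
    · refine le_trans ?_ (le_algClosure _)
      rintro _ ⟨ψ, hψ, rfl⟩
      rw [← hcomp]
      exact ⟨_, (le_sup_right : _ ≤ S₁) ⟨ψ, hψ, rfl⟩, rfl⟩
  have hS₁ : ∀ i, ∀ ψ ∈ S₁, dd i ψ ∈ S₁ := by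
    intro i ψ hψ
    refine derivation_mem_sup (dd i) ?_ ?_ hψ
    · rintro _ ⟨p, rfl⟩
      exact (le_sup_left : _ ≤ S₁) (dd_polyHom i p)
    · rintro _ ⟨ψ, hψ, rfl⟩
      rw [dd_pull]
      refine sum_mem fun k _ => mul_mem ((le_sup_right : _ ≤ S₁) ⟨_, hS k ψ hψ, rfl⟩) ?_
      refine (le_sup_left : _ ≤ S₁) ?_
      have h5 : coordGerm π (analyticAt_of_isNash hπ) k =
          polyHom (ι ⊕ s) (MvPolynomial.X (Sum.inl k)) := (polyHom_X _).symm
      rw [h5]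
      exact dd_polyHom i _
  -- Setting the extra coordinates to zero could annihilate the coefficients of the relation;
  -- stability of `S₁` under differentiation, from `hS₁`, rules out any harm.
  have h2 := pull_mem_algClosure e (analyticAt_of_isNash he) he0 hS₁ h1
  rw [hcomp'] at h2
  refine algClosure_mono ?_ h2
  rw [Subring.map_sup]
  refine sup_le ?_ ?_
  · rintro _ ⟨_, ⟨p, rfl⟩, rfl⟩
    exact hnash (pull_mem_nashRing he he0 (le_algClosure _ ⟨p, rfl⟩))
  · rintro _ ⟨_, ⟨ψ, hψ, rfl⟩, rfl⟩
    rwa [hcomp']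

end Descent

/-! ### The ring generated by the derivatives along `z = w = 0` -/

section RingA

variable {n m c N' : ℕ}

/-- The ring generated by the algebraic germs and all the germs `∂^α f(0, 0, u)`. -/
def restrictedJetRing (f : Fin N' → (Idx n m c → ℂ) → ℂ) (hf : ∀ s, AnalyticAt ℂ (f s) 0) :
    Subring (HolGerm (Idx n m c)) :=
  Subring.closure (nash (Idx n m c) ∪ {φ | ∃ (L : List (Idx n m c)) (s : Fin N'),
    φ = restrictU (iterPartial L (f s)) (analyticAt_iterPartial L (hf s))})

theorem restrictedJetRing_le_ringA (f : Fin N' → (Idx n m c → ℂ) → ℂ) (hf : ∀ s, AnalyticAt ℂ (f s) 0) :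
    restrictedJetRing f hf ≤ ringA f hf := by
  refine Subring.closure_le.2 ?_
  rintro φ (hφ | ⟨L, s, rfl⟩)
  · exact le_iSup (ringALevel f hf) 0 (Subring.subset_closure (Or.inl hφ))
  · exact le_iSup (ringALevel f hf) L.length
      (Subring.subset_closure (Or.inr ⟨L, s, le_rfl, rfl⟩))

theorem dd_mem_restrictedJetRing {f : Fin N' → (Idx n m c → ℂ) → ℂ} {hf : ∀ s, AnalyticAt ℂ (f s) 0}
    (i : Idx n m c) {φ : HolGerm (Idx n m c)} (hφ : φ ∈ restrictedJetRing f hf) :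
    dd i φ ∈ restrictedJetRing f hf := by
  refine derivation_mem_closure (dd i) _ ?_ hφ
  have hr : ∀ k, IsNash fun Z : Idx n m c → ℂ => (pt 0 0 (uPart Z) : Idx n m c → ℂ) k := by
    rintro (k | k | k)
    · exact isNash_const 0
    · exact isNash_const 0
    · exact isNash_coord (Sum.inr (Sum.inr k))
  have hr0 : (pt 0 0 (uPart (0 : Idx n m c → ℂ)) : Idx n m c → ℂ) = 0 := pt_zero
  rintro φ (hφ | ⟨L, s, rfl⟩)
  · exact Subring.subset_closure (Or.inl (dd_mem_nashRing i hφ))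
  · have h : restrictU (iterPartial L (f s)) (analyticAt_iterPartial L (hf s)) =
        pull _ (analyticAt_of_isNash hr) hr0
          (germOf (iterPartial L (f s)) (analyticAt_iterPartial L (hf s))) := rfl
    rw [h, dd_pull]
    refine sum_mem fun k _ => mul_mem (Subring.subset_closure (Or.inr ⟨k :: L, s, ?_⟩))
      (Subring.subset_closure (Or.inl (dd_mem_nashRing i (hr k).2)))
    rw [dd_germOf]
    rfl

/-- If `f` is algebraic over the jets at `(0, 0, u)` along a generically submersive algebraic map,
then it is algebraic over them. -/
theorem IsChain.mem_algClosure_restrictedJetRing {T : Type} [Fintype T]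
    {Q : Fin m → (Fin n ⊕ Idx n m c → ℂ) → ℂ} {f : Fin N' → (Idx n m c → ℂ) → ℂ}
    {hf : ∀ s, AnalyticAt ℂ (f s) 0} {V : (T → ℂ) → (Idx n m c ⊕ Idx n m c → ℂ)} {j : Fin c → T}
    (hV : IsChain Q f V j) (hsym : symRing f j ≤ algClosure (uRing f j))
    (hsurj : ∃ᶠ t in 𝓝 0, Function.Surjective (fderiv ℂ (fun t i => V t (Sum.inl i)) t))
    (s : Fin N') : germOf (f s) (hf s) ∈ algClosure (restrictedJetRing f hf) := by
  have hv : ∀ i : Idx n m c, IsNash fun t => V t (Sum.inl i) := fun i => hV.nash _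
  have h0 : (fun i : Idx n m c => V 0 (Sum.inl i)) = 0 := by rw [hV.zero]; rfl
  refine mem_algClosure_of_pull (S := restrictedJetRing f hf) hv h0 hsurj
    (fun φ hφ => Subring.subset_closure (Or.inl hφ)) (fun i φ hφ => dd_mem_restrictedJetRing i hφ) ?_
  refine algClosure_mono ?_ ((hV.algZ [] s).mono hsym).2
  refine Subring.closure_le.2 ?_
  rintro φ (hφ | ⟨L, s, hg, rfl⟩)
  · exact (le_sup_left : nashRing T ≤ _) hφ
  -- Since the `u`-part of the chain is `(t_{j(i)})`, a jet at `(0, 0, u)` in these parameters is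
  -- the pull-back of the same jet restricted to `z = w = 0`.
  · refine (le_sup_right : _ ≤ nashRing T ⊔ _)
      ⟨_, Subring.subset_closure (Or.inr ⟨L, s, rfl⟩), ?_⟩
    rw [restrictU, pull_germOf]
    refine germOf_congr _ _ ?_
    filter_upwards [hV.u_eq] with t ht
    exact congrArg (fun u => iterPartial L (f s) (pt 0 0 u)) (funext ht)

end RingA

end KeyAlg

end

/-- `M ⊂ ℂ^N`, `N = n + m + c`, is a germ at `0` of a generic real-algebraic submanifold of CR
dimension `n` and codimension `d = m + c`, of constant orbit dimension at `0`, with CR orbits of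
codimension `c` in `M` (i.e. of dimension `2n + m`), written in normal coordinates `(z, w, u)`. For
subrings of a domain, being algebraic over the ring is the same as being algebraic over its
quotient field. -/
theorem proposition3p2 {n m c N' : ℕ}
    (M : Set (KeyAlg.Idx n m c → ℂ))
    (hM : KeyAlg.IsGenericRealAlgebraic M (m + c))
    (hconst : KeyAlg.HasConstantOrbitDim M 0)
    (hdim : KeyAlg.orbitDim M 0 = 2 * n + m)
    (Q : Fin m → (Fin n ⊕ KeyAlg.Idx n m c → ℂ) → ℂ)
    (hQ : KeyAlg.IsNormalForm M Q)
    (f : Fin N' → (KeyAlg.Idx n m c → ℂ) → ℂ)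
    (hf : ∀ s, AnalyticAt ℂ (f s) 0)
    (hf0 : ∀ s, f s 0 = 0)
    (hclub : KeyAlg.Club Q f hf) :
    ∀ s, IsAlgebraic (KeyAlg.ringA f hf) (KeyAlg.germOf (f s) (hf s)) := by
  obtain ⟨T, _, V, j, hV, h1, h2⟩ := KeyAlg.exists_isChain_tangentAlong hQ hclub
  intro s
  exact KeyAlg.algClosure_mono (KeyAlg.restrictedJetRing_le_ringA f hf)
    (hV.mem_algClosure_restrictedJetRing (hclub.symRing_le hQ j)
      (KeyAlg.frequently_surjective hQ hM.1 hdim hV h1 h2) s)
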